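/- Let $d_1,d_2\ge 1$, $0<r<R$, $\alpha,\delta\in(0,1]$, $K>0$, and write $B_\rho=\{v\in\mathbb R^{d_2}:|v|<\rho\}$. Let $b\in L^\infty\cap H^1(B_R,\mathbb R^{d_1})$ be nondegenerate in the sense that $$\big|\{v\in B_R: |\mu+b(v)\cdot\nu|\le\epsilon\}\big|\le K\epsilon^\alpha\qquad\text{for all }\mu\in\mathbb R,\ \nu\in\mathbb S^{d_1-1},\ \epsilon>0 .$$ Let $h,g_0\in L^2(\mathbb R_t\times\mathbb R^{d_1}_x\times B_R)$ and $g_1\in L^2(\mathbb R_t\times\mathbb R^{d_1}_x\times B_R,\mathbb R^{d_2})$ satisfy $$(\partial_t+b(v)\cdot\nabla_x)h=\operatorname{div}_v g_1+g_0$$ in the sense of distributions on $\mathbb R\times\mathbb R^{d_1}\times B_R$, and assume in addition that $h\in L^2_{t,x}(H^\delta_v(B_R))$. Set $$\gamma:=\frac{2\alpha\delta}{(4+\alpha)(2+2\delta+d_2)} .$$ Then $h\in H^\gamma(\mathbb R\times\mathbb R^{d_1}\times B_r)$ and $$\|h\|_{H^\gamma(\mathbb R\times\mathbb R^{d_1}\times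 B_r)}\le C_b\left(\|h\|_{L^2_{t,x}(H^\delta_v(B_R))}+\|g_1\|_{L^2(\mathbb R\times\mathbb R^{d_1}\times B_R)}+\|g_0\|_{L^2(\mathbb R\times\mathbb R^{d_1}\times B_R)}\right),$$ where, for given exponents $\alpha$ and $\delta$, the constant $C_b>0$ depends only on $d_1$, $d_2$, $K$, $R-r$, and upper bounds for $\|b\|_{L^\infty(B_R)}$ and $\|Db\|_{L^2(B_R)}$. Here $H^s$ with $s\in(0,1)$ carries the norm given by the $L^2$ norm and the Gagliardo seminorm $\iint |f(y)-f(z)|^2|y-z|^{-n-2s}\,dy\,dz$ ($n$ the dimension) on the domain, and $H^1$ carries the norm given by the $L^2$ norms of the function and its weak gradient. -/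

import Mathlib

open MeasureTheory Set
open scoped ENNReal NNReal ContDiff

noncomputable section

namespace Kinetic

/-- The Euclidean space `ℝ^d`, with its Euclidean norm and Lebesgue measure. -/
abbrev E (d : ℕ) : Type := EuclideanSpace ℝ (Fin d)

/-- The phase space `ℝ_t × ℝ^{d₁}_x × ℝ^{d₂}_v`, with Lebesgue measure. -/
abbrev Phase (d₁ d₂ : ℕ) : Type := ℝ × E d₁ × E d₂

/-- The open cylinder `ℝ × ℝ^{d₁} × B_R`. -/
def cyl (d₁ d₂ : ℕ) (R : ℝ) : Set (Phase d₁ d₂) := {z | z.2.2 ∈ Metric.ball (0 : E d₂) R}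

/-- Lebesgue measure on the ball `B_R ⊂ ℝ^d`. -/
def ballMeasure (d : ℕ) (R : ℝ) : Measure (E d) := volume.restrict (Metric.ball 0 R)

/-- Lebesgue measure on the cylinder `ℝ × ℝ^{d₁} × B_R`. -/
def cylMeasure (d₁ d₂ : ℕ) (R : ℝ) : Measure (Phase d₁ d₂) := volume.restrict (cyl d₁ d₂ R)

/-- `φ ∈ C_c^∞(Ω)`. -/
structure IsTest {X : Type*} [NormedAddCommGroup X] [NormedSpace ℝ X]
    (Ω : Set X) (φ : X → ℝ) : Prop where
  smooth : ContDiff ℝ ∞ φ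
  compact : HasCompactSupport φ
  subset : tsupport φ ⊆ Ω

/-- `b ∈ L^∞ ∩ H^1(B_R, ℝ^{d₁})`, and `Db` is its weak derivative:
`∫ (∂_e φ) b = - ∫ φ (Db e)` for all `φ ∈ C_c^∞(B_R)` and all directions `e`.
(As `B_R` is bounded, `b ∈ L^∞` contains `b ∈ L²`.) -/
structure IsBoundedH1 {d₁ d₂ : ℕ} (R : ℝ) (b : E d₂ → E d₁) (Db : E d₂ → E d₂ →L[ℝ] E d₁) :
    Prop where
  memLp_top : MemLp b ∞ (ballMeasure d₂ R)
  memLp_two : MemLp Db 2 (ballMeasure d₂ R)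
  weak : ∀ φ : E d₂ → ℝ, IsTest (Metric.ball 0 R) φ → ∀ e : E d₂,
    ∫ v, (fderiv ℝ φ v e) • b v ∂(ballMeasure d₂ R) = - ∫ v, φ v • Db v e ∂(ballMeasure d₂ R)

/-- The nondegeneracy condition on `B_R` with constants `K` and `α`:
`|{v ∈ B_R : |μ + b(v)·ν| ≤ ε}| ≤ K ε^α` for all `μ ∈ ℝ`, all unit vectors `ν`, all `ε > 0`. -/
def Nondegenerate {d₁ d₂ : ℕ} (R K α : ℝ) (b : E d₂ → E d₁) : Prop :=
  ∀ (μ : ℝ) (ν : E d₁), ‖ν‖ = 1 → ∀ ε : ℝ, 0 < ε →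
    volume {v : E d₂ | v ∈ Metric.ball (0 : E d₂) R ∧ |μ + inner ℝ (b v) ν| ≤ ε}
      ≤ ENNReal.ofReal (K * ε ^ α)

/-- `(∂_t + b(v)·∇_x) h = div_v g₁ + g₀` in the sense of distributions on `ℝ × ℝ^{d₁} × B_R`.
Here `fderiv ℝ φ z (1, b(v), 0) = ∂_t φ + b(v)·∇_x φ` and
`fderiv ℝ φ z (0, 0, g₁) = g₁·∇_v φ`. -/
def SolvesTransport {d₁ d₂ : ℕ} (R : ℝ) (b : E d₂ → E d₁)
    (h g₀ : Phase d₁ d₂ → ℝ) (g₁ : Phase d₁ d₂ → E d₂) : Prop :=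
  ∀ φ : Phase d₁ d₂ → ℝ, IsTest (cyl d₁ d₂ R) φ →
    - ∫ z, h z * fderiv ℝ φ z (1, b z.2.2, 0) ∂(cylMeasure d₁ d₂ R)
      = - (∫ z, fderiv ℝ φ z (0, 0, g₁ z) ∂(cylMeasure d₁ d₂ R))
        + ∫ z, g₀ z * φ z ∂(cylMeasure d₁ d₂ R)

/-- The squared Gagliardo seminorm of order `s ∈ (0,1)` on the ball `B_R ⊂ ℝ^d`. -/
def ballGagliardoSq {d : ℕ} (s R : ℝ) (f : E d → ℝ) : ℝ≥0∞ :=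
  ∫⁻ v, ∫⁻ w, ENNReal.ofReal (|f v - f w| ^ 2 / ‖v - w‖ ^ ((d : ℝ) + 2 * s))
    ∂(ballMeasure d R) ∂(ballMeasure d R)

/-- `D ∈ L²` is the weak velocity gradient `∇_v h` on `ℝ × ℝ^{d₁} × B_R`. -/
structure IsWeakVelocityGradient {d₁ d₂ : ℕ} (R : ℝ) (h : Phase d₁ d₂ → ℝ)
    (D : Phase d₁ d₂ → E d₂) : Prop where
  memLp : MemLp D 2 (cylMeasure d₁ d₂ R)
  weak : ∀ φ : Phase d₁ d₂ → ℝ, IsTest (cyl d₁ d₂ R) φ → ∀ e : E d₂,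
    ∫ z, h z * fderiv ℝ φ z (0, 0, e) ∂(cylMeasure d₁ d₂ R)
      = - ∫ z, φ z * inner ℝ (D z) e ∂(cylMeasure d₁ d₂ R)

/-- The squared seminorm of `L²_{t,x}(H^δ_v(B_R))`, for `δ ∈ (0,1]`. If `δ < 1` it is
`∫ [h(t,x,·)]²_{H^δ(B_R)} dt dx` with the Gagliardo seminorm; if `δ = 1` it is `‖∇_v h‖²_{L²}`,
which is `∞` if there is no weak velocity gradient in `L²`. -/
def velocitySeminormSq {d₁ d₂ : ℕ} (δ R : ℝ) (h : Phase d₁ d₂ → ℝ) : ℝ≥0∞ :=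
  if δ < 1 then
    ∫⁻ p : ℝ × E d₁, ballGagliardoSq δ R (fun v => h (p.1, p.2, v))
  else
    ⨅ (D : Phase d₁ d₂ → E d₂) (_ : IsWeakVelocityGradient R h D),
      eLpNorm D 2 (cylMeasure d₁ d₂ R) ^ 2

/-- The norm of `L²_{t,x}(H^δ_v(B_R))`. -/
def velocityNorm {d₁ d₂ : ℕ} (δ R : ℝ) (h : Phase d₁ d₂ → ℝ) : ℝ≥0∞ :=
  (eLpNorm h 2 (cylMeasure d₁ d₂ R) ^ 2 + velocitySeminormSq δ R h) ^ (1 / 2 : ℝ)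

/-- `h ∈ L²_{t,x}(H^δ_v(B_R))`. -/
def MemVelocitySobolev {d₁ d₂ : ℕ} (δ R : ℝ) (h : Phase d₁ d₂ → ℝ) : Prop :=
  AEStronglyMeasurable h (cylMeasure d₁ d₂ R) ∧ velocityNorm δ R h < ⊤

/-- The Euclidean distance on `ℝ × ℝ^{d₁} × ℝ^{d₂}` (the product type carries the sup distance). -/
def euclDist {d₁ d₂ : ℕ} (y z : Phase d₁ d₂) : ℝ :=
  Real.sqrt (|y.1 - z.1| ^ 2 + ‖y.2.1 - z.2.1‖ ^ 2 + ‖y.2.2 - z.2.2‖ ^ 2)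

/-- The norm of `H^s(ℝ × ℝ^{d₁} × B_r)`, for `s ∈ (0,1)`:
`(‖h‖²_{L²} + ∬ |h(y) - h(z)|² / |y - z|^{(1+d₁+d₂) + 2s} dy dz)^{1/2}`. -/
def sobolevNorm {d₁ d₂ : ℕ} (s r : ℝ) (h : Phase d₁ d₂ → ℝ) : ℝ≥0∞ :=
  (eLpNorm h 2 (cylMeasure d₁ d₂ r) ^ 2
    + ∫⁻ y, ∫⁻ z, ENNReal.ofReal
        (|h y - h z| ^ 2 / euclDist y z ^ ((1 + d₁ + d₂ : ℝ) + 2 * s))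
        ∂(cylMeasure d₁ d₂ r) ∂(cylMeasure d₁ d₂ r)) ^ (1 / 2 : ℝ)

/-- `h ∈ H^s(ℝ × ℝ^{d₁} × B_r)`, for `s ∈ (0,1)`. -/
def MemSobolev {d₁ d₂ : ℕ} (s r : ℝ) (h : Phase d₁ d₂ → ℝ) : Prop :=
  AEStronglyMeasurable h (cylMeasure d₁ d₂ r) ∧ sobolevNorm s r h < ⊤

end Kinetic

end

/-! Taking the Fourier transform in p = (t, x) leaves, at each frequency ζ, a problem in v alone: m
u is a v-divergence plus a source, with symbol m(v) = 2π a(v)·ζ and a = (1, b). Where |m| is large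
the equation controls u; nondegeneracy says that |m| is small only on a small set.

Consider an average ∫ k u and split 1 = β²/(m² + β²) + m · m/(m² + β²). The first part is estimated
by Cauchy–Schwarz and a layer cake argument; its square has size (β/|ζ|)^α. For the second the
equation is tested with k m/(m² + β²); this costs β⁻² or, when the derivative falls on m, β⁻⁴ |ζ|²
‖Db‖². With β = |ζ| η, the choice η = |ζ|^(-2/(4+α)) balances η^α against |ζ|⁻² η⁻⁴, and the squared
average gains |ζ|^(-2α/(4+α)) (`sq_enorm_average_le`).

To recover u from its averages, k is a mollifier of width ε centred at v. Its gradient costs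
ε^(-(d₂+2)), while replacing u by its average costs ε^(2δ) by the velocity regularity
(`lintegral_sub_average_sq_le`). Balancing with ε proportional to |ζ|^(-γ/δ) produces exactly the
stated γ: this is `exists_frequency_estimate`.

Integrating in ζ and using Plancherel gives order γ in (t, x). In v, order δ > γ is already assumed.
The triangle inequality through the point that shares p with one argument and v with the other
combines both (`exists_product_gagliardo_le`). The velocity hypothesis enters only through
`IncrementBound`, which follows from the Gagliardo seminorm if δ < 1 and from a weak gradient if δ =
1.

Two points remain. Since h is merely square integrable in p, it is first cut off in p; the
commutator is an additional source, bounded uniformly in the cutoff, and Fatou's lemma removes the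
cutoff (`exists_cylinder_estimate`). And R enters the constant only through R - r, because
nondegeneracy at a level above sup |b| already bounds the volume of B_R
(`volume_ball_le_of_nondegenerate`). -/

namespace Kinetic
open Filter Topology Metric

/-! ### Cauchy–Schwarz and elementary square bounds. -/

section Lintegral
variable {X : Type*} [MeasurableSpace X] {μ : Measure X}

theorem sq_lintegral_mul_le {f g : X → ℝ≥0∞} (hf : AEMeasurable f μ) (hg : AEMeasurable g μ) :
    (∫⁻ x, f x * g x ∂μ) ^ 2 ≤ (∫⁻ x, f x ^ 2 ∂μ) * ∫⁻ x, g x ^ 2 ∂μ := by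
  have h := ENNReal.lintegral_mul_le_Lp_mul_Lq μ Real.HolderConjugate.two_two hf hg
  simp only [Pi.mul_apply, ENNReal.rpow_two] at h
  calc _ ≤ ((∫⁻ x, f x ^ 2 ∂μ) ^ (1 / 2 : ℝ) * (∫⁻ x, g x ^ 2 ∂μ) ^ (1 / 2 : ℝ)) ^ 2 := by
        gcongr
    _ = _ := by
        rw [← ENNReal.mul_rpow_of_nonneg _ _ (by norm_num), ← ENNReal.rpow_two,
          ← ENNReal.rpow_mul]
        norm_num

/-- Jensen's inequality for the weight f, from Cauchy–Schwarz applied to √f · (√f g). With f a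
mollifier of mass one it gives the L² contraction of convolution. -/
theorem sq_lintegral_mul_le_lintegral_mul_sq {f g : X → ℝ≥0∞} (hf : AEMeasurable f μ)
    (hg : AEMeasurable g μ) :
    (∫⁻ x, f x * g x ∂μ) ^ 2 ≤ (∫⁻ x, f x ∂μ) * ∫⁻ x, f x * g x ^ 2 ∂μ := by
  have hs : ∀ a : ℝ≥0∞, (a ^ (1 / 2 : ℝ)) ^ 2 = a := fun a => by
    rw [← ENNReal.rpow_two, ← ENNReal.rpow_mul]; norm_num
  have h := sq_lintegral_mul_le (μ := μ) (f := fun x => f x ^ (1 / 2 : ℝ))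
    (g := fun x => f x ^ (1 / 2 : ℝ) * g x) (hf.pow_const _) ((hf.pow_const _).mul hg)
  simp only [← mul_assoc, mul_pow, ← pow_two, hs] at h
  exact h

theorem sq_enorm_integral_smul_le {F : Type*} [NormedAddCommGroup F] [NormedSpace ℝ F]
    {f : X → ℝ} {g : X → F} (hf : AEStronglyMeasurable f μ) (hg : AEStronglyMeasurable g μ) :
    ‖∫ x, f x • g x ∂μ‖ₑ ^ 2 ≤ (∫⁻ x, ‖f x‖ₑ ^ 2 ∂μ) * ∫⁻ x, ‖g x‖ₑ ^ 2 ∂μ := by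
  refine le_trans ?_ (sq_lintegral_mul_le hf.enorm hg.enorm)
  gcongr
  refine (enorm_integral_le_lintegral_enorm _).trans (le_of_eq ?_)
  simp [enorm_smul]

theorem eLpNorm_two_sq {F : Type*} [NormedAddCommGroup F] (f : X → F) :
    eLpNorm f 2 μ ^ 2 = ∫⁻ x, ‖f x‖ₑ ^ 2 ∂μ := by
  have := eLpNorm_nnreal_pow_eq_lintegral (μ := μ) (f := f) (p := 2) two_ne_zero
  simpa using this

theorem memLp_two_iff {F : Type*} [NormedAddCommGroup F] {f : X → F}
    (hf : AEStronglyMeasurable f μ) : MemLp f 2 μ ↔ ∫⁻ x, ‖f x‖ₑ ^ 2 ∂μ < ⊤ := by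
  rw [MemLp, ← eLpNorm_two_sq, ENNReal.pow_lt_top_iff]
  simp [hf]

theorem enorm_add_sq_le {F : Type*} [NormedAddCommGroup F] (x y : F) :
    ‖x + y‖ₑ ^ 2 ≤ 2 * (‖x‖ₑ ^ 2 + ‖y‖ₑ ^ 2) := by
  have h : ‖x + y‖ ^ 2 ≤ 2 * (‖x‖ ^ 2 + ‖y‖ ^ 2) := by
    have := norm_add_le x y
    nlinarith [sq_nonneg (‖x‖ - ‖y‖), norm_nonneg (x + y), norm_nonneg x, norm_nonneg y]
  simp only [← ofReal_norm, ← ENNReal.ofReal_pow (norm_nonneg _)]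
  rw [← ENNReal.ofReal_add (by positivity) (by positivity), ← ENNReal.ofReal_ofNat 2,
    ← ENNReal.ofReal_mul (by norm_num)]
  exact ENNReal.ofReal_le_ofReal h

theorem enorm_sub_sq_le {F : Type*} [NormedAddCommGroup F] (x y : F) :
    ‖x - y‖ₑ ^ 2 ≤ 2 * (‖x‖ₑ ^ 2 + ‖y‖ₑ ^ 2) := by
  simpa [sub_eq_add_neg] using enorm_add_sq_le x (-y)

end Lintegral

/-! ### Mollification of weakly differentiable functions. -/

section Mollify
variable {V : Type*} [NormedAddCommGroup V] [InnerProductSpace ℝ V] [FiniteDimensional ℝ V]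
  [MeasurableSpace V] [BorelSpace V]

/-- `Dm` is the weak derivative of the scalar function `m` on the ball of radius `R`. -/
def HasWeakDeriv (R : ℝ) (m : V → ℝ) (Dm : V → V →L[ℝ] ℝ) : Prop :=
  ∀ φ : V → ℝ, IsTest (ball 0 R) φ → ∀ e : V,
    ∫ v in ball 0 R, fderiv ℝ φ v e * m v = - ∫ v in ball 0 R, φ v * Dm v e

theorem isTest_of_support {X : Type*} [NormedAddCommGroup X] [NormedSpace ℝ X]
    [FiniteDimensional ℝ X] {x : X} {s : ℝ} {Ω : Set X} {φ : X → ℝ} (h : ContDiff ℝ ∞ φ)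
    (hs : Function.support φ ⊆ closedBall x s) (hΩ : closedBall x s ⊆ Ω) : IsTest Ω φ := by
  have ht : tsupport φ ⊆ closedBall x s := closure_minimal hs isClosed_closedBall
  exact ⟨h, HasCompactSupport.of_support_subset_isCompact (isCompact_closedBall x s) hs,
    ht.trans hΩ⟩

theorem fderiv_comp_const_sub {φ : V → ℝ} (hφ : ContDiff ℝ ∞ φ) (v w : V) :
    fderiv ℝ (fun w => φ (v - w)) w = - fderiv ℝ φ (v - w) := by
  have h1 : HasFDerivAt (fun w : V => v - w) (-ContinuousLinearMap.id ℝ V) w := by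
    simpa using (hasFDerivAt_id w).const_sub v
  have h2 : HasFDerivAt φ (fderiv ℝ φ (v - w)) (v - w) :=
    (hφ.differentiable (by simp) _).hasFDerivAt
  have h3 : HasFDerivAt (fun w : V => φ (v - w)) _ w := h2.comp w h1
  rw [h3.fderiv]
  ext e
  simp

/-- Interior mollification of a function with a square integrable weak derivative. -/
theorem exists_smooth_approx {R R' : ℝ} (hR : R' < R) {m : V → ℝ} {Dm : V → V →L[ℝ] ℝ}
    (hm : IntegrableOn m (ball 0 R)) (hD : StronglyMeasurable Dm)
    (hD2 : MemLp Dm 2 (volume.restrict (ball 0 R))) (hw : HasWeakDeriv R m Dm) :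
    ∃ f : ℕ → V → ℝ, (∀ j, ContDiff ℝ ∞ (f j)) ∧
      (∀ᵐ v, v ∈ ball (0 : V) R → Tendsto (fun j => f j v) atTop (𝓝 (m v))) ∧
      ∀ j, ∫⁻ v in ball 0 R', ‖fderiv ℝ (f j) v‖ₑ ^ 2 ≤ ∫⁻ v in ball 0 R, ‖Dm v‖ₑ ^ 2 := by
  -- Radii of at most (R - R')/2 keep the kernel centred at a point of B_R' inside B_R, so that it
  -- is an admissible test function.
  set ρ : ℕ → ℝ := fun j => (R - R') / 2 / (j + 1) with hρ
  have hρ0 : ∀ j, 0 < ρ j := fun j => by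
    have : 0 < R - R' := by linarith
    positivity
  have hρR : ∀ j, ρ j ≤ (R - R') / 2 := fun j =>
    div_le_self (by linarith) (by linarith [(Nat.cast_nonneg j : (0 : ℝ) ≤ j)])
  -- The ratio of outer to inner radius stays equal to 2; a bounded ratio is what almost everywhere
  -- convergence of the convolutions requires.
  let φ : ℕ → ContDiffBump (0 : V) := fun j => ⟨ρ j / 2, ρ j, by linarith [hρ0 j],
    by linarith [hρ0 j]⟩
  set mt : V → ℝ := (ball 0 R).indicator m with hmt
  have hmi : Integrable mt := (integrable_indicator_iff measurableSet_ball).2 hm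
  have hml : LocallyIntegrable mt := hmi.locallyIntegrable
  set g : ℕ → V → ℝ := fun j => (φ j).normed volume with hg
  have hgs : ∀ j, ContDiff ℝ ∞ (g j) := fun j => (φ j).contDiff_normed
  have hgc : ∀ j, HasCompactSupport (g j) := fun j => (φ j).hasCompactSupport_normed
  refine ⟨fun j => convolution (g j) mt (ContinuousLinearMap.lsmul ℝ ℝ) volume, fun j => ?_, ?_,
    fun j => ?_⟩
  · exact (hgc j).contDiff_convolution_left _ (hgs j) hml
  · have ht : Tendsto (fun j => (φ j).rOut) atTop (𝓝 0) := by
      have := (tendsto_one_div_add_atTop_nhds_zero_nat (𝕜 := ℝ)).const_mul ((R - R') / 2)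
      simpa [φ, hρ, div_eq_mul_inv] using this
    have := ContDiffBump.ae_convolution_tendsto_right_of_locallyIntegrable (K := 2) ht
      (Eventually.of_forall fun j => by simp [φ]; linarith) hml
    filter_upwards [this] with v hv hvR
    simpa [hmt, hvR] using hv
  · set ν := volume.restrict (ball (0 : V) R) with hν
    have : IsFiniteMeasure ν := ⟨by simpa [hν] using measure_ball_lt_top⟩
    have hDi : Integrable Dm ν := hD2.integrable (by norm_num)
    have hgcont : ∀ x : V, Continuous fun w => g j (x - w) := fun x =>
      (hgs j).continuous.comp (by fun_prop)
    obtain ⟨B, hB⟩ := (hgc j).exists_bound_of_continuous (hgs j).continuous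
    have hint : ∀ x, Integrable (fun w => g j (x - w) • Dm w) ν := fun x =>
      Integrable.bdd_smul hDi B (hgcont x).aestronglyMeasurable (Eventually.of_forall fun w => hB _)
    -- The derivative is put on the kernel and the weak derivative is tested with w ↦ g(v - w); the
    -- sign from the chain rule cancels that of the integration by parts. The extension by zero is
    -- not seen, as the kernel stays inside B_R.
    have hderiv : ∀ v ∈ ball (0 : V) R',
        fderiv ℝ (convolution (g j) mt (ContinuousLinearMap.lsmul ℝ ℝ) volume) v
          = ∫ w, g j (v - w) • Dm w ∂ν := by
      intro v hv
      rw [((hgc j).hasFDerivAt_convolution_left _ ((hgs j).of_le (by simp)) hml v).fderiv]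
      ext e
      have hce := ((hgc j).fderiv ℝ).convolutionExists_left
        ((ContinuousLinearMap.lsmul ℝ ℝ (E := ℝ)).precompL V) ((hgs j).continuous_fderiv (by simp))
        hml v
      rw [convolution_def, ContinuousLinearMap.integral_apply hce.integrable, 
        ContinuousLinearMap.integral_apply (hint v)]
      have ht : IsTest (ball (0 : V) R) fun w => g j (v - w) := by
        refine isTest_of_support (x := v) (s := ρ j) ((hgs j).comp (by fun_prop)) ?_ ?_
        · intro w hw
          have : v - w ∈ Function.support (g j) := hw
          rw [(φ j).support_normed_eq] at this
          have h2 := (mem_ball.1 this).le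
          rw [dist_zero_right] at h2
          rw [mem_closedBall, dist_eq_norm, norm_sub_rev]
          exact h2
        · refine closedBall_subset_ball' ?_
          have := mem_ball.1 hv
          linarith [hρR j]
      have h1 := hw _ ht e
      simp only [fderiv_comp_const_sub (hgs j)] at h1
      simp only [ContinuousLinearMap.precompL_apply, ContinuousLinearMap.lsmul_apply,
        _root_.smul_apply, smul_eq_mul]
      rw [← integral_sub_left_eq_self _ _ v]
      simp only [sub_sub_cancel]
      have h2 : ∀ w, fderiv ℝ (g j) (v - w) e * mt w
          = (ball (0 : V) R).indicator (fun w => fderiv ℝ (g j) (v - w) e * m w) w := by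
        intro w; by_cases h : w ∈ ball (0 : V) R <;> simp [hmt, h]
      simp only [h2]
      rw [integral_indicator measurableSet_ball]
      simp only [_root_.neg_apply, neg_mul, integral_neg, neg_inj] at h1
      exact h1
    have hgn : ∀ x, g j x = ‖g j x‖ := fun x => by
      rw [Real.norm_of_nonneg ((φ j).nonneg_normed x)]
    have hmass : ∀ c : V, ∫⁻ w, ‖g j (w - c)‖ₑ = 1 := fun c => by
      rw [lintegral_sub_right_eq_self (fun w => ‖g j w‖ₑ) c,
        ← ofReal_integral_norm_eq_lintegral_enorm ((φ j).integrable_normed),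
        ← ENNReal.ofReal_one, ← (φ j).integral_normed (μ := volume)]
      exact congrArg _ (integral_congr_ae (Eventually.of_forall fun x => (hgn x).symm))
    have hmass' : ∀ c : V, ∫⁻ w, ‖g j (c - w)‖ₑ = 1 := fun c => by
      rw [lintegral_sub_left_eq_self (fun w => ‖g j w‖ₑ) c]
      simpa using hmass 0
    have hgm : Measurable fun p : V × V => ‖g j (p.1 - p.2)‖ₑ :=
      ((hgs j).continuous.comp (by fun_prop)).measurable.enorm
    calc ∫⁻ v in ball 0 R', ‖fderiv ℝ (convolution (g j) mt
            (ContinuousLinearMap.lsmul ℝ ℝ) volume) v‖ₑ ^ 2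
        ≤ ∫⁻ v in ball 0 R', ∫⁻ w, ‖g j (v - w)‖ₑ * ‖Dm w‖ₑ ^ 2 ∂ν := by
          refine setLIntegral_mono' measurableSet_ball fun v hv => ?_
          rw [hderiv v hv]
          have h1 : ‖∫ w, g j (v - w) • Dm w ∂ν‖ₑ ≤ ∫⁻ w, ‖g j (v - w)‖ₑ * ‖Dm w‖ₑ ∂ν :=
            (enorm_integral_le_lintegral_enorm _).trans (by simp [enorm_smul])
          calc _ ≤ (∫⁻ w, ‖g j (v - w)‖ₑ * ‖Dm w‖ₑ ∂ν) ^ 2 := by gcongr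
            _ ≤ (∫⁻ w, ‖g j (v - w)‖ₑ ∂ν) * ∫⁻ w, ‖g j (v - w)‖ₑ * ‖Dm w‖ₑ ^ 2 ∂ν :=
                sq_lintegral_mul_le_lintegral_mul_sq (hgcont v).measurable.enorm.aemeasurable
                  hD.enorm.aemeasurable
            _ ≤ 1 * ∫⁻ w, ‖g j (v - w)‖ₑ * ‖Dm w‖ₑ ^ 2 ∂ν := by
                gcongr
                rw [← hmass' v]
                exact lintegral_mono' Measure.restrict_le_self le_rfl
            _ = _ := one_mul _
      _ ≤ ∫⁻ v, ∫⁻ w, ‖g j (v - w)‖ₑ * ‖Dm w‖ₑ ^ 2 ∂ν :=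
          lintegral_mono' Measure.restrict_le_self le_rfl
      _ = ∫⁻ w, ∫⁻ v, ‖g j (v - w)‖ₑ * ‖Dm w‖ₑ ^ 2 ∂volume ∂ν := by
          refine lintegral_lintegral_swap (Measurable.aemeasurable ?_)
          exact hgm.mul ((hD.enorm.comp measurable_snd).pow_const 2)
      _ = ∫⁻ w in ball 0 R, ‖Dm w‖ₑ ^ 2 := by
          refine lintegral_congr fun w => ?_
          rw [lintegral_mul_const _ (by
            exact ((hgs j).continuous.comp (by fun_prop)).measurable.enorm), hmass, one_mul]

end Mollify
end Kinetic

namespace Kinetic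
open Filter Topology Metric

/-! ### Mean square increments from either kind of velocity regularity. -/

section Increments
variable {V : Type*} [NormedAddCommGroup V] [InnerProductSpace ℝ V] [FiniteDimensional ℝ V]
  [MeasurableSpace V] [BorelSpace V]

theorem setLIntegral_translate_le (F : V → ℝ≥0∞) {r R' : ℝ} {k : V} (hk : r + ‖k‖ ≤ R') :
    ∫⁻ v in ball 0 r, F (v + k) ≤ ∫⁻ v in ball 0 R', F v := by
  rw [← lintegral_indicator measurableSet_ball, ← lintegral_indicator measurableSet_ball,
    ← lintegral_add_right_eq_self ((ball (0 : V) R').indicator F) k]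
  refine lintegral_mono fun v => ?_
  by_cases hv : v ∈ ball (0 : V) r
  · have : v + k ∈ ball (0 : V) R' := by
      rw [mem_ball_zero_iff] at hv ⊢
      linarith [norm_add_le v k]
    simp [hv, this]
  · simp [hv]

theorem sq_enorm_sub_le_lintegral_fderiv {f : V → ℝ} (hf : ContDiff ℝ ∞ f) (v k : V) :
    ‖f (v + k) - f v‖ₑ ^ 2
      ≤ ‖k‖ₑ ^ 2 * ∫⁻ t in Ioc (0 : ℝ) 1, ‖fderiv ℝ f (v + t • k)‖ₑ ^ 2 := by
  have hd : ∀ t : ℝ, HasDerivAt (fun t : ℝ => f (v + t • k)) (fderiv ℝ f (v + t • k) k) t := by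
    intro t
    have h1 : HasDerivAt (fun t : ℝ => v + t • k) k t := by
      simpa using ((hasDerivAt_id t).smul_const k).const_add v
    exact ((hf.differentiable (by simp) _).hasFDerivAt).comp_hasDerivAt t h1
  have hc : Continuous fun t : ℝ => fderiv ℝ f (v + t • k) :=
    (hf.continuous_fderiv (by simp)).comp (by fun_prop)
  have hc' : Continuous fun t : ℝ => fderiv ℝ f (v + t • k) k := hc.clm_apply continuous_const
  have h := intervalIntegral.integral_eq_sub_of_hasDerivAt (fun t _ => hd t)
    (hc'.intervalIntegrable 0 1)
  simp only [one_smul, zero_smul, add_zero] at h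
  rw [← h, intervalIntegral.integral_of_le zero_le_one]
  calc ‖∫ t in Ioc (0 : ℝ) 1, fderiv ℝ f (v + t • k) k‖ₑ ^ 2
      ≤ (∫⁻ t in Ioc (0 : ℝ) 1, ‖k‖ₑ * ‖fderiv ℝ f (v + t • k)‖ₑ) ^ 2 := by
        gcongr
        refine (enorm_integral_le_lintegral_enorm _).trans (lintegral_mono fun t => ?_)
        rw [mul_comm]
        exact ContinuousLinearMap.le_opENorm _ _
    _ ≤ (∫⁻ t in Ioc (0 : ℝ) 1, ‖k‖ₑ ^ 2) *
          ∫⁻ t in Ioc (0 : ℝ) 1, ‖fderiv ℝ f (v + t • k)‖ₑ ^ 2 :=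
        sq_lintegral_mul_le aemeasurable_const hc.measurable.enorm.aemeasurable
    _ = _ := by simp

/-- For mollifications this is the fundamental theorem of calculus along the segment from v to v +
k, which stays in the ball of radius r + ‖k‖. Almost everywhere convergence and Fatou's lemma carry
the bound to u. -/
theorem lintegral_increment_le {R r : ℝ} {u : V → ℝ} {D : V → V →L[ℝ] ℝ} {k : V}
    (hk : r + ‖k‖ < R) (hu : IntegrableOn u (ball 0 R)) (hD : StronglyMeasurable D)
    (hD2 : MemLp D 2 (volume.restrict (ball 0 R))) (hw : HasWeakDeriv R u D) :
    ∫⁻ v in ball 0 r, ‖u (v + k) - u v‖ₑ ^ 2 ≤ ‖k‖ₑ ^ 2 * ∫⁻ v in ball 0 R, ‖D v‖ₑ ^ 2 := by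
  obtain ⟨f, hfs, hfa, hfD⟩ := exists_smooth_approx hk hu hD hD2 hw
  have hfa' := (measurePreserving_add_right volume k).quasiMeasurePreserving.ae hfa
  have hlim : ∀ᵐ v ∂volume.restrict (ball (0 : V) r), ‖u (v + k) - u v‖ₑ ^ 2
      = liminf (fun j => ‖f j (v + k) - f j v‖ₑ ^ 2) atTop := by
    rw [ae_restrict_iff' measurableSet_ball]
    filter_upwards [hfa, hfa'] with v h1 h2 hv
    rw [mem_ball_zero_iff] at hv
    have hvR : v ∈ ball (0 : V) R := by
      rw [mem_ball_zero_iff]; linarith [norm_nonneg k]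
    have hvk : v + k ∈ ball (0 : V) R := by
      rw [mem_ball_zero_iff]; linarith [norm_add_le v k]
    have := ((h2 hvk).sub (h1 hvR)).enorm
    exact ((ENNReal.continuous_pow 2).tendsto _ |>.comp this).liminf_eq.symm
  rw [lintegral_congr_ae hlim]
  refine (lintegral_liminf_le fun j => ?_).trans ?_
  · have := (hfs j).continuous
    exact Continuous.measurable (by fun_prop)
  refine liminf_le_of_frequently_le' (Frequently.of_forall fun j => ?_)
  have hc : Continuous (fderiv ℝ (f j)) := (hfs j).continuous_fderiv (by simp)
  calc ∫⁻ v in ball 0 r, ‖f j (v + k) - f j v‖ₑ ^ 2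
      ≤ ∫⁻ v in ball 0 r, ‖k‖ₑ ^ 2 *
          ∫⁻ t in Ioc (0 : ℝ) 1, ‖fderiv ℝ (f j) (v + t • k)‖ₑ ^ 2 :=
        lintegral_mono fun v => sq_enorm_sub_le_lintegral_fderiv (hfs j) v k
    _ = ‖k‖ₑ ^ 2 * ∫⁻ v in ball 0 r, 
          ∫⁻ t in Ioc (0 : ℝ) 1, ‖fderiv ℝ (f j) (v + t • k)‖ₑ ^ 2 := by
        rw [lintegral_const_mul' _ _ (by simp)]
    _ = ‖k‖ₑ ^ 2 * ∫⁻ t in Ioc (0 : ℝ) 1, ∫⁻ v in ball 0 r,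
          ‖fderiv ℝ (f j) (v + t • k)‖ₑ ^ 2 := by
        rw [lintegral_lintegral_swap]
        exact (Continuous.measurable (by fun_prop)).aemeasurable
    _ ≤ ‖k‖ₑ ^ 2 * ∫⁻ t in Ioc (0 : ℝ) 1, ∫⁻ v in ball 0 R, ‖D v‖ₑ ^ 2 := by
        refine mul_le_mul_right (setLIntegral_mono' measurableSet_Ioc fun t ht => ?_) _
        refine le_trans ?_ (hfD j)
        refine setLIntegral_translate_le (fun v => ‖fderiv ℝ (f j) v‖ₑ ^ 2) ?_
        rw [norm_smul, Real.norm_of_nonneg ht.1.le]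
        have := mul_le_mul_of_nonneg_right ht.2 (norm_nonneg k)
        linarith
    _ = _ := by simp

/-- The increments of `u` at scale `ε ≤ ε₀` are of order `ε ^ δ` in mean square. -/
def IncrementBound (δ r ε₀ : ℝ) (u : V → ℝ) (N : ℝ≥0∞) : Prop :=
  ∀ ε : ℝ, 0 < ε → ε ≤ ε₀ → ∫⁻ v in ball 0 r, ∫⁻ w in ball v ε, ‖u v - u w‖ₑ ^ 2
    ≤ ENNReal.ofReal (ε ^ (Module.finrank ℝ V + 2 * δ)) * N

theorem setLIntegral_ball_eq_translate (F : V → ℝ≥0∞) (v : V) (ε : ℝ) :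
    ∫⁻ w in ball v ε, F w = ∫⁻ k in ball 0 ε, F (v + k) := by
  rw [← lintegral_indicator measurableSet_ball, ← lintegral_indicator measurableSet_ball,
    ← lintegral_add_left_eq_self _ v]
  refine lintegral_congr fun k => ?_
  by_cases hk : k ∈ ball (0 : V) ε
  · have : v + k ∈ ball v ε := by simpa using hk
    rw [indicator_of_mem this, indicator_of_mem hk]
  · have : v + k ∉ ball v ε := by simpa using hk
    rw [indicator_of_notMem this, indicator_of_notMem hk]

/-- Translation by each k with ‖k‖ < ε costs ε² in mean square; integrating over these k adds the
volume ε^d |B_1|. -/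
theorem incrementBound_of_hasWeakDeriv {R r ε₀ : ℝ} (hε₀ : r + ε₀ ≤ R) {u : V → ℝ}
    {D : V → V →L[ℝ] ℝ} (hum : Measurable u) (hu : IntegrableOn u (ball 0 R))
    (hD : StronglyMeasurable D)
    (hD2 : MemLp D 2 (volume.restrict (ball 0 R))) (hw : HasWeakDeriv R u D) :
    IncrementBound 1 r ε₀ u (volume (ball (0 : V) 1) * ∫⁻ v in ball 0 R, ‖D v‖ₑ ^ 2) := by
  intro ε hε hεε
  rw [lintegral_congr fun v => setLIntegral_ball_eq_translate (fun w => ‖u v - u w‖ₑ ^ 2) v ε]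
  rw [lintegral_lintegral_swap (by
    apply Measurable.aemeasurable
    apply Measurable.pow_const
    apply Measurable.enorm
    exact (hum.comp measurable_fst).sub (hum.comp (by fun_prop)))]
  calc ∫⁻ k in ball 0 ε, ∫⁻ v in ball 0 r, ‖u v - u (v + k)‖ₑ ^ 2
      ≤ ∫⁻ k in ball (0 : V) ε, ENNReal.ofReal (ε ^ 2) * ∫⁻ v in ball 0 R, ‖D v‖ₑ ^ 2 := by
        refine setLIntegral_mono' measurableSet_ball fun k hk => ?_
        rw [mem_ball_zero_iff] at hk
        simp only [enorm_sub_rev (u _) (u (_ + k))]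
        refine (lintegral_increment_le (by linarith) hu hD hD2 hw).trans ?_
        gcongr
        rw [← ofReal_norm, ← ENNReal.ofReal_pow (norm_nonneg _)]
        exact ENNReal.ofReal_le_ofReal (by gcongr)
    _ = _ := by
        rw [lintegral_const, Measure.restrict_apply_univ, Measure.addHaar_ball_of_pos _ _ hε]
        have : ε ^ ((Module.finrank ℝ V : ℝ) + 2 * 1) = ε ^ 2 * ε ^ Module.finrank ℝ V := by
          rw [Real.rpow_add hε, mul_comm]; norm_num
        rw [this, ENNReal.ofReal_mul (by positivity)]
        ring

/-- For |v - w| < ε the Gagliardo kernel is at least ε^(-(d + 2δ)), and the ball of radius ε about a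
point of B_r lies in B_R. -/
theorem incrementBound_of_gagliardo {R r ε₀ δ : ℝ} (hε₀ : r + ε₀ ≤ R) (hδ : 0 < δ) (hr : r ≤ R)
    {u : V → ℝ} {N : ℝ≥0∞}
    (hN : ∫⁻ v in ball 0 R, ∫⁻ w in ball 0 R, ENNReal.ofReal
      ((‖v - w‖ ^ (Module.finrank ℝ V + 2 * δ))⁻¹) * ‖u v - u w‖ₑ ^ 2 ≤ N) :
    IncrementBound δ r ε₀ u N := by
  intro ε hε hεε
  refine le_trans ?_ (mul_le_mul_right hN _)
  rw [← lintegral_const_mul' _ _ (by simp)]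
  refine le_trans ?_ (lintegral_mono_set (ball_subset_ball hr))
  refine setLIntegral_mono' measurableSet_ball fun v hv => ?_
  rw [← lintegral_const_mul' _ _ (by simp)]
  have hsub : ball v ε ⊆ ball (0 : V) R := by
    refine ball_subset_ball' ?_
    have := mem_ball.1 hv
    linarith
  refine le_trans ?_ (lintegral_mono_set hsub)
  refine setLIntegral_mono' measurableSet_ball fun w hw => ?_
  rcases eq_or_ne v w with rfl | hne
  · simp
  have h0 : 0 < ‖v - w‖ := norm_sub_pos_iff.2 hne
  rw [← mul_assoc, ← ENNReal.ofReal_mul (by positivity)]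
  refine le_mul_of_one_le_left zero_le ?_
  rw [ENNReal.one_le_ofReal, ← div_eq_mul_inv, one_le_div (by positivity)]
  have : ‖v - w‖ ≤ ε := by
    rw [← dist_eq_norm, dist_comm]; exact (mem_ball.1 hw).le
  gcongr

end Increments

/-! ### Smoothing kernels at scale ε. -/

section Kernel
variable (V : Type*) [NormedAddCommGroup V] [InnerProductSpace ℝ V] [FiniteDimensional ℝ V]
  [MeasurableSpace V] [BorelSpace V]

variable {V} in
theorem lintegral_comp_inv_smul {F : V → ℝ≥0∞} (hF : Measurable F) {c : ℝ} (hc : 0 < c) :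
    ∫⁻ v, F (c⁻¹ • v) = ENNReal.ofReal (c ^ (Module.finrank ℝ V : ℝ)) * ∫⁻ v, F v := by
  rw [← lintegral_map (μ := volume) hF (measurable_const_smul (c⁻¹ : ℝ)),
    Measure.map_addHaar_smul _ (inv_ne_zero hc.ne'), lintegral_smul_measure, smul_eq_mul,
    abs_of_pos (by positivity), inv_pow, inv_inv, Real.rpow_natCast]

/-- Rescaling one fixed bump by ε^(-d) g(·/ε) makes C independent of ε; each derivative costs a
factor ε⁻² in the squared norm. -/
theorem exists_smoothing_kernel : ∃ C : ℝ≥0, ∀ ε : ℝ, 0 < ε → ∃ ρ : V → ℝ,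
    ContDiff ℝ ∞ ρ ∧ Function.support ρ ⊆ ball 0 ε ∧ ∫ v, ρ v = 1 ∧
    ∫⁻ v, ‖ρ v‖ₑ ^ 2 ≤ C * ENNReal.ofReal (ε ^ (-(Module.finrank ℝ V : ℝ))) ∧
    ∫⁻ v, ‖fderiv ℝ ρ v‖ₑ ^ 2 ≤ C * ENNReal.ofReal (ε ^ (-(Module.finrank ℝ V + 2 : ℝ))) := by
  set d := Module.finrank ℝ V with hd
  let φ : ContDiffBump (0 : V) := ⟨1 / 2, 1, by norm_num, by norm_num⟩
  set g := φ.normed volume with hg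
  have hgs : ContDiff ℝ ∞ g := φ.contDiff_normed
  have hgc : HasCompactSupport g := φ.hasCompactSupport_normed
  have hsupp : Function.support g = ball 0 1 := φ.support_normed_eq
  have h1 : ∫⁻ v, ‖g v‖ₑ ^ 2 < ⊤ :=
    (memLp_two_iff hgs.continuous.aestronglyMeasurable).1
      (hgs.continuous.memLp_of_hasCompactSupport hgc)
  have hgd : Continuous (fderiv ℝ g) := hgs.continuous_fderiv (by simp)
  have h2 : ∫⁻ v, ‖fderiv ℝ g v‖ₑ ^ 2 < ⊤ :=
    (memLp_two_iff hgd.aestronglyMeasurable).1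
      (hgd.memLp_of_hasCompactSupport (hgc.fderiv ℝ))
  set C₁ := (∫⁻ v, ‖g v‖ₑ ^ 2).toNNReal with hC₁
  set C₂ := (∫⁻ v, ‖fderiv ℝ g v‖ₑ ^ 2).toNNReal with hC₂
  refine ⟨max C₁ C₂, fun ε hε => ⟨fun v => (ε ^ d)⁻¹ * g (ε⁻¹ • v), ?_, ?_, ?_, ?_, ?_⟩⟩
  · exact contDiff_const.mul (hgs.comp (by fun_prop))
  · intro v hv
    have h : ε⁻¹ • v ∈ Function.support g := by
      intro h0
      apply hv
      simp [h0]
    rw [hsupp, mem_ball_zero_iff, norm_smul, norm_inv, Real.norm_of_nonneg hε.le,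
      inv_mul_lt_iff₀ hε] at h
    rw [mem_ball_zero_iff]; linarith
  · rw [integral_const_mul, Measure.integral_comp_inv_smul, ← hd, φ.integral_normed,
      abs_of_pos (by positivity)]
    simp
    field_simp
  · have h3 : ∀ v, ‖(ε ^ d)⁻¹ * g (ε⁻¹ • v)‖ₑ ^ 2
        = ENNReal.ofReal ((ε ^ d)⁻¹ ^ 2) * ‖g (ε⁻¹ • v)‖ₑ ^ 2 := fun v => by
      rw [enorm_mul, mul_pow, Real.enorm_of_nonneg (by positivity),
        ENNReal.ofReal_pow (by positivity)]
    simp only [h3]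
    rw [lintegral_const_mul' _ _ (by simp),
      lintegral_comp_inv_smul (F := fun v => ‖g v‖ₑ ^ 2)
        (hgs.continuous.measurable.enorm.pow_const 2) hε, ← mul_assoc,
      ← ENNReal.ofReal_mul (by positivity), mul_comm]
    gcongr
    · rw [← ENNReal.coe_toNNReal h1.ne]
      exact_mod_cast le_max_left _ _
    · rw [Real.rpow_neg hε.le, Real.rpow_natCast]
      apply le_of_eq
      field_simp
      rw [hd]
  · have hfd : ∀ v, fderiv ℝ (fun v => (ε ^ d)⁻¹ * g (ε⁻¹ • v)) v
        = ((ε ^ d)⁻¹ * ε⁻¹) • fderiv ℝ g (ε⁻¹ • v) := fun v => by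
      have h4 : DifferentiableAt ℝ (fun v => g (ε⁻¹ • v)) v :=
        ((hgs.comp (by fun_prop : ContDiff ℝ ∞ fun v : V => ε⁻¹ • v)).differentiable (by simp)) v
      rw [fderiv_const_mul h4, fderiv_comp_smul, smul_smul]
    have h3 : ∀ v, ‖fderiv ℝ (fun v => (ε ^ d)⁻¹ * g (ε⁻¹ • v)) v‖ₑ ^ 2
        = ENNReal.ofReal (((ε ^ d)⁻¹ * ε⁻¹) ^ 2) * ‖fderiv ℝ g (ε⁻¹ • v)‖ₑ ^ 2 := fun v => by
      rw [hfd, enorm_smul, mul_pow, Real.enorm_of_nonneg (by positivity),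
        ENNReal.ofReal_pow (by positivity)]
    simp only [h3]
    rw [lintegral_const_mul' _ _ (by simp),
      lintegral_comp_inv_smul (F := fun v => ‖fderiv ℝ g v‖ₑ ^ 2)
        (hgd.measurable.enorm.pow_const 2) hε, ← mul_assoc,
      ← ENNReal.ofReal_mul (by positivity), mul_comm]
    gcongr
    · rw [← ENNReal.coe_toNNReal h2.ne]
      exact_mod_cast le_max_right _ _
    · rw [Real.rpow_neg hε.le, Real.rpow_add hε, Real.rpow_natCast, Real.rpow_two]
      apply le_of_eq
      field_simp
      rw [hd]
end Kernel
end Kinetic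

namespace Kinetic
open Filter Topology Metric

/-! ### The regularised inverse s/(s² + β²) of the symbol. -/

section Resolvent

theorem abs_div_sq_add_sq_le {β : ℝ} (hβ : 0 < β) (s : ℝ) : |s / (s ^ 2 + β ^ 2)| ≤ β⁻¹ := by
  rw [abs_div, abs_of_pos (by positivity : 0 < s ^ 2 + β ^ 2), div_le_iff₀ (by positivity),
    ← sq_abs s]
  have h : β⁻¹ * (|s| ^ 2 + β ^ 2) = |s| ^ 2 / β + β := by field_simp
  rw [h, ← sub_nonneg]
  have : |s| ^ 2 / β + β - |s| = (|s| ^ 2 + β ^ 2 - |s| * β) / β := by field_simp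
  rw [this]
  apply div_nonneg _ hβ.le
  nlinarith [sq_nonneg (|s| - β), abs_nonneg s, mul_nonneg (abs_nonneg s) hβ.le]

theorem hasDerivAt_div_sq_add_sq {β : ℝ} (hβ : 0 < β) (s : ℝ) :
    HasDerivAt (fun s : ℝ => s / (s ^ 2 + β ^ 2)) ((β ^ 2 - s ^ 2) / (s ^ 2 + β ^ 2) ^ 2) s := by
  have h1 : HasDerivAt (fun s : ℝ => s ^ 2 + β ^ 2) (2 * s) s := by
    simpa using (hasDerivAt_pow 2 s).add_const (β ^ 2)
  have h := (hasDerivAt_id' s).div h1 (by positivity)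
  have he : (β ^ 2 - s ^ 2) / (s ^ 2 + β ^ 2) ^ 2
      = (1 * (s ^ 2 + β ^ 2) - s * (2 * s)) / (s ^ 2 + β ^ 2) ^ 2 := by ring
  rw [he]
  exact h

theorem abs_deriv_div_sq_add_sq_le {β : ℝ} (hβ : 0 < β) (s : ℝ) :
    |(β ^ 2 - s ^ 2) / (s ^ 2 + β ^ 2) ^ 2| ≤ (β ^ 2)⁻¹ := by
  have h0 : 0 < s ^ 2 + β ^ 2 := by positivity
  rw [abs_div, abs_of_pos (by positivity : 0 < (s ^ 2 + β ^ 2) ^ 2), div_le_iff₀ (by positivity)]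
  have h1 : |β ^ 2 - s ^ 2| ≤ s ^ 2 + β ^ 2 := by
    rw [abs_le]; constructor <;> nlinarith [sq_nonneg s, sq_nonneg β]
  have h2 : 1 ≤ (β ^ 2)⁻¹ * (s ^ 2 + β ^ 2) := by
    rw [mul_add, inv_mul_cancel₀ (by positivity)]
    have : 0 ≤ (β ^ 2)⁻¹ * s ^ 2 := by positivity
    linarith
  calc _ ≤ 1 * (s ^ 2 + β ^ 2) := by linarith
    _ ≤ ((β ^ 2)⁻¹ * (s ^ 2 + β ^ 2)) * (s ^ 2 + β ^ 2) := by gcongr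
    _ = _ := by ring

theorem contDiff_div_sq_add_sq {β : ℝ} (hβ : 0 < β) :
    ContDiff ℝ ∞ (fun s : ℝ => s / (s ^ 2 + β ^ 2)) :=
  contDiff_id.div (by fun_prop) fun s => by positivity

/-- Dyadic layer cake bound for `β² / (m² + β²)` from the measure of the sublevel sets of `|m|`. -/
theorem lintegral_resolvent_le {X : Type*} [MeasurableSpace X] {ν : Measure X} {m : X → ℝ}
    (hm : Measurable m) {β : ℝ} (hβ : 0 < β) {B : ℝ≥0∞}
    (hB : ∀ j : ℕ, ν {v | |m v| ≤ 2 ^ j * β} ≤ 2 ^ j * B) :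
    ∫⁻ v, ‖β ^ 2 / (m v ^ 2 + β ^ 2)‖ₑ ^ 2 ∂ν ≤ 8 * B := by
  -- If j is the least index with |m| ≤ 2^j β, then β²/(m² + β²) ≤ 4 · 4^(-j), and squaring only
  -- helps since this quotient is at most 1. The decay 4^(-j) beats the growth 2^j of the measures,
  -- so the series sums to 8B.
  have hpt : ∀ v, ‖β ^ 2 / (m v ^ 2 + β ^ 2)‖ₑ ^ 2 ≤ ∑' j : ℕ, (4 * (4⁻¹ : ℝ≥0∞) ^ j) *
      {v | |m v| ≤ 2 ^ j * β}.indicator 1 v := by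
    intro v
    have hex : ∃ j : ℕ, |m v| ≤ 2 ^ j * β := by
      obtain ⟨j, hj⟩ := pow_unbounded_of_one_lt (|m v| / β) (one_lt_two)
      exact ⟨j, by rw [div_lt_iff₀ hβ] at hj; exact hj.le⟩
    classical
    set j := Nat.find hex with hj
    refine le_trans ?_ (ENNReal.le_tsum j)
    have hmem : v ∈ {v | |m v| ≤ 2 ^ j * β} := Nat.find_spec hex
    rw [indicator_of_mem hmem, Pi.one_apply, mul_one, Real.enorm_of_nonneg (by positivity),
      ← ENNReal.ofReal_pow (by positivity)]
    have hle1 : β ^ 2 / (m v ^ 2 + β ^ 2) ≤ 1 := by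
      rw [div_le_one (by positivity)]; nlinarith [sq_nonneg (m v)]
    have hsq : (β ^ 2 / (m v ^ 2 + β ^ 2)) ^ 2 ≤ β ^ 2 / (m v ^ 2 + β ^ 2) :=
      pow_le_of_le_one (by positivity) hle1 two_ne_zero
    have h4 : (4 * (4⁻¹ : ℝ≥0∞) ^ j) = ENNReal.ofReal (4 * (4⁻¹) ^ j) := by
      rw [ENNReal.ofReal_mul (by norm_num), ENNReal.ofReal_pow (by norm_num),
        ENNReal.ofReal_inv_of_pos (by norm_num)]
      norm_num
    rw [h4]
    refine ENNReal.ofReal_le_ofReal (hsq.trans ?_)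
    rcases hj' : j with _ | i
    · simp; linarith
    · have hi : ¬ |m v| ≤ 2 ^ i * β := Nat.find_min hex (by omega)
      push Not at hi
      have h2 : (2 ^ i * β) ^ 2 ≤ m v ^ 2 := by
        rw [← sq_abs (m v)]; gcongr
      rw [div_le_iff₀ (by positivity)]
      have h5 : (4 : ℝ) * 4⁻¹ ^ (i + 1) = (2 ^ i * 2 ^ i)⁻¹ := by
        rw [pow_succ, ← mul_pow, ← inv_pow]; norm_num
        ring
      rw [h5, inv_mul_eq_div, le_div_iff₀ (by positivity)]
      nlinarith [sq_nonneg β]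
  have hms : ∀ j : ℕ, MeasurableSet {v | |m v| ≤ 2 ^ j * β} := fun j =>
    measurableSet_le hm.abs measurable_const
  calc _ ≤ ∫⁻ v, ∑' j : ℕ, (4 * (4⁻¹ : ℝ≥0∞) ^ j) *
        {v | |m v| ≤ 2 ^ j * β}.indicator 1 v ∂ν := lintegral_mono hpt
    _ = ∑' j : ℕ, (4 * (4⁻¹ : ℝ≥0∞) ^ j) * ν {v | |m v| ≤ 2 ^ j * β} := by
        rw [lintegral_tsum fun j => 
          ((measurable_one.indicator (hms j)).const_mul _).aemeasurable]
        refine tsum_congr fun j => ?_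
        rw [lintegral_const_mul _ (measurable_one.indicator (hms j)), lintegral_indicator_one (hms j)]
    _ ≤ ∑' j : ℕ, (4 * B) * (2⁻¹ : ℝ≥0∞) ^ j := by
        refine ENNReal.tsum_le_tsum fun j => ?_
        calc _ ≤ (4 * (4⁻¹ : ℝ≥0∞) ^ j) * (2 ^ j * B) := by gcongr; exact hB j
          _ = (4 * B) * (4⁻¹ * 2) ^ j := by rw [mul_pow]; ring
          _ = _ := by
            congr 2
            rw [show (4 : ℝ≥0∞) = 2 * 2 by norm_num, ENNReal.mul_inv (by simp) (by simp), mul_assoc,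
              ENNReal.inv_mul_cancel (by simp) (by simp), mul_one]
    _ = 8 * B := by
        rw [ENNReal.tsum_mul_left, ENNReal.tsum_geometric, ENNReal.one_sub_inv_two, inv_inv]
        ring

end Resolvent

/-! ### The averaging estimate for one kernel at one frequency. -/

section Averaging
variable {V : Type*} [NormedAddCommGroup V] [InnerProductSpace ℝ V] [FiniteDimensional ℝ V]
  [MeasurableSpace V] [BorelSpace V]

theorem aestronglyMeasurable_clm_apply {X F H : Type*} [MeasurableSpace X] {μ : Measure X}
    [NormedAddCommGroup F] [NormedSpace ℝ F] [NormedAddCommGroup H] [NormedSpace ℝ H]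
    {A : X → F →L[ℝ] H} {g : X → F} (hA : AEStronglyMeasurable A μ)
    (hg : AEStronglyMeasurable g μ) : AEStronglyMeasurable (fun x => A x (g x)) μ :=
  isBoundedBilinearMap_apply.continuous.comp_aestronglyMeasurable (hA.prodMk hg)

theorem integrable_clm_apply_of_hasCompactSupport {ν : Measure V} {A : V → V →L[ℝ] ℝ}
    (hA : Continuous A) (hAc : HasCompactSupport A) {G : V → V} (hG : Integrable G ν) :
    Integrable (fun v => A v (G v)) ν := by
  obtain ⟨c, hc⟩ := hAc.exists_bound_of_continuous hA
  refine (hG.norm.const_mul c).mono' (aestronglyMeasurable_clm_apply hA.aestronglyMeasurable hG.1)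
    (Eventually.of_forall fun v => ?_)
  exact (ContinuousLinearMap.le_opNorm _ _).trans (by gcongr; exact hc v)

-- The equation is tested with k F(m), F(s) = s/(s² + β²), where |F| ≤ β⁻¹ and |F'| ≤ β⁻². As m is
-- only weakly differentiable, mollifications f_j replace it inside F: the right side is bounded
-- uniformly in j, and the left side converges by dominated convergence. The three terms come from
-- the derivative of k, the derivative of m, and the source. In each, k stays next to G₁ or G₀, so
-- that a later integration over the centre of k is a convolution.
set_option maxHeartbeats 800000 in
theorem sq_enorm_integral_mul_test_le {R R' : ℝ} (hR : R' < R) {m : V → ℝ} {Dm : V → V →L[ℝ] ℝ}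
    (hm : StronglyMeasurable m) {M : ℝ} (hM : ∀ v, |m v| ≤ M) (hD : StronglyMeasurable Dm)
    (hD2 : MemLp Dm 2 (volume.restrict (ball 0 R))) (hw : HasWeakDeriv R m Dm)
    {u G₀ : V → ℝ} {G₁ : V → V} (hu : MemLp u 2 (volume.restrict (ball 0 R)))
    (hG₀ : MemLp G₀ 2 (volume.restrict (ball 0 R)))
    (hG₁ : MemLp G₁ 2 (volume.restrict (ball 0 R)))
    (heq : ∀ ψ : V → ℝ, IsTest (ball 0 R) ψ → ∫ v in ball 0 R, m v * ψ v * u v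
      = (∫ v in ball 0 R, fderiv ℝ ψ v (G₁ v)) + ∫ v in ball 0 R, ψ v * G₀ v)
    {k : V → ℝ} (hk : IsTest (ball 0 R') k) {β : ℝ} (hβ : 0 < β) :
    ‖∫ v in ball 0 R, m v * (k v * (m v / (m v ^ 2 + β ^ 2))) * u v‖ₑ ^ 2 ≤
      2 * (2 * (ENNReal.ofReal (β⁻¹ ^ 2) * volume (ball (0 : V) R) *
            (∫⁻ v in ball 0 R, ‖fderiv ℝ k v‖ₑ ^ 2 * ‖G₁ v‖ₑ ^ 2)
          + ENNReal.ofReal (((β ^ 2)⁻¹) ^ 2) * (∫⁻ v in ball 0 R, ‖Dm v‖ₑ ^ 2) *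
            ∫⁻ v in ball 0 R, ‖k v‖ₑ ^ 2 * ‖G₁ v‖ₑ ^ 2)
        + ENNReal.ofReal (β⁻¹ ^ 2) * volume (ball (0 : V) R) *
          ∫⁻ v in ball 0 R, ‖k v‖ₑ ^ 2 * ‖G₀ v‖ₑ ^ 2) := by
  set ν := volume.restrict (ball (0 : V) R) with hν
  have hfin : IsFiniteMeasure ν := ⟨by simpa [hν] using measure_ball_lt_top⟩
  have hmi : Integrable m ν := Integrable.of_bound hm.aestronglyMeasurable M
    (Eventually.of_forall hM)
  obtain ⟨f, hfs, hfa, hfD⟩ := exists_smooth_approx hR hmi hD hD2 hw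
  set F : ℝ → ℝ := fun s => s / (s ^ 2 + β ^ 2) with hF
  set F' : ℝ → ℝ := fun s => (β ^ 2 - s ^ 2) / (s ^ 2 + β ^ 2) ^ 2 with hF'
  have hFs : ContDiff ℝ ∞ F := contDiff_div_sq_add_sq hβ
  have hkfs := hk.smooth
  have hkc : Continuous k := hk.smooth.continuous
  have hkd : Continuous (fderiv ℝ k) := hk.smooth.continuous_fderiv (by simp)
  have hfd : ∀ j, Continuous (fderiv ℝ (f j)) := fun j => (hfs j).continuous_fderiv (by simp)
  have hF'c : Continuous F' := by
    refine Continuous.div (by fun_prop) (by fun_prop) fun s => ?_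
    positivity
  obtain ⟨Bk, hBk⟩ := hk.compact.exists_bound_of_continuous hkc
  -- Only the m inside F is mollified; the factor m coming from the equation is left untouched.
  set ψ : ℕ → V → ℝ := fun j v => k v * F (f j v) with hψ
  have hψt : ∀ j, IsTest (ball 0 R) (ψ j) := fun j =>
    ⟨hkfs.mul (hFs.comp (hfs j)), hk.compact.mul_right,
      (tsupport_mul_subset_left.trans hk.subset).trans (ball_subset_ball hR.le)⟩
  have hψd : ∀ j v, fderiv ℝ (ψ j) v
      = F (f j v) • fderiv ℝ k v + (k v * F' (f j v)) • fderiv ℝ (f j) v := by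
    intro j v
    have h1 : HasFDerivAt (f j) (fderiv ℝ (f j) v) v :=
      ((hfs j).differentiable (by simp) v).hasFDerivAt
    have h2 : HasFDerivAt (fun v => F (f j v)) (F' (f j v) • fderiv ℝ (f j) v) v :=
      (hasDerivAt_div_sq_add_sq hβ (f j v)).comp_hasFDerivAt v h1
    have h3 : HasFDerivAt k (fderiv ℝ k v) v := (hkfs.differentiable (by simp) v).hasFDerivAt
    have h4 : HasFDerivAt (ψ j) _ v := h3.mul h2
    rw [h4.fderiv]
    simp only [smul_smul]
    abel
  have hlim : Tendsto (fun j => ∫ v, m v * ψ j v * u v ∂ν) atTop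
      (𝓝 (∫ v, m v * (k v * F (m v)) * u v ∂ν)) := by
    refine tendsto_integral_of_dominated_convergence (fun v => M * (Bk * β⁻¹) * ‖u v‖) ?_ ?_ ?_ ?_
    · intro j
      exact (hm.aestronglyMeasurable.mul (hψt j).smooth.continuous.aestronglyMeasurable).mul hu.1
    · exact (hu.integrable (by norm_num)).norm.const_mul _
    · intro j
      refine Eventually.of_forall fun v => ?_
      rw [norm_mul, norm_mul, norm_mul]
      have h1 : ‖F (f j v)‖ ≤ β⁻¹ := abs_div_sq_add_sq_le hβ _
      have h2 : ‖m v‖ ≤ M := hM v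
      have := hBk v
      have hM0 : 0 ≤ M := (norm_nonneg _).trans h2
      have hB0 : 0 ≤ Bk := (norm_nonneg _).trans this
      gcongr
    · rw [hν, ae_restrict_iff' measurableSet_ball]
      filter_upwards [hfa] with v hv hvR
      have := (hFs.continuous.tendsto (m v)).comp (hv hvR)
      exact ((this.const_mul (k v)).const_mul (m v)).mul_const (u v)
  refine le_of_tendsto ((ENNReal.continuous_pow 2).tendsto _ |>.comp hlim.enorm)
    (Eventually.of_forall fun j => ?_)
  simp only [Function.comp_apply]
  rw [heq _ (hψt j)]
  have hFb : ∀ v, ‖F (f j v)‖ₑ ^ 2 ≤ ENNReal.ofReal (β⁻¹ ^ 2) := fun v => by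
    rw [ENNReal.ofReal_pow (by positivity)]
    gcongr
    rw [← ofReal_norm]
    exact ENNReal.ofReal_le_ofReal (abs_div_sq_add_sq_le hβ _)
  have hF'b : ∀ v, ‖F' (f j v)‖ₑ ≤ ENNReal.ofReal ((β ^ 2)⁻¹) := fun v => by
    rw [← ofReal_norm]
    exact ENNReal.ofReal_le_ofReal (abs_deriv_div_sq_add_sq_le hβ _)
  have hFint : ∫⁻ v, ‖F (f j v)‖ₑ ^ 2 ∂ν ≤ ENNReal.ofReal (β⁻¹ ^ 2) * volume (ball (0 : V) R) := by
    refine (lintegral_mono hFb).trans (le_of_eq ?_)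
    rw [lintegral_const, hν, Measure.restrict_apply_univ]
  have hFm : Continuous fun v => F (f j v) := hFs.continuous.comp (hfs j).continuous
  have e1 : ‖∫ v, F (f j v) • fderiv ℝ k v (G₁ v) ∂ν‖ₑ ^ 2 ≤
      ENNReal.ofReal (β⁻¹ ^ 2) * volume (ball (0 : V) R) *
        ∫⁻ v, ‖fderiv ℝ k v‖ₑ ^ 2 * ‖G₁ v‖ₑ ^ 2 ∂ν := by
    refine (sq_enorm_integral_smul_le hFm.aestronglyMeasurable ?_).trans ?_
    · exact aestronglyMeasurable_clm_apply hkd.aestronglyMeasurable hG₁.1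
    · refine mul_le_mul' hFint (lintegral_mono fun v => ?_)
      rw [← mul_pow]
      gcongr
      exact ContinuousLinearMap.le_opENorm _ _
  have e3 : ‖∫ v, ψ j v * G₀ v ∂ν‖ₑ ^ 2 ≤
      ENNReal.ofReal (β⁻¹ ^ 2) * volume (ball (0 : V) R) *
        ∫⁻ v, ‖k v‖ₑ ^ 2 * ‖G₀ v‖ₑ ^ 2 ∂ν := by
    have : ∀ v, ψ j v * G₀ v = F (f j v) • (k v * G₀ v) := fun v => by
      simp only [hψ, smul_eq_mul]; ring
    simp only [this]
    refine (sq_enorm_integral_smul_le hFm.aestronglyMeasurable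
      (hkc.aestronglyMeasurable.mul hG₀.1)).trans ?_
    refine mul_le_mul' hFint (lintegral_mono fun v => ?_)
    rw [Pi.mul_apply, enorm_mul, mul_pow]
  have e2 : ‖∫ v, (k v * F' (f j v)) • fderiv ℝ (f j) v (G₁ v) ∂ν‖ₑ ^ 2 ≤
      ENNReal.ofReal (((β ^ 2)⁻¹) ^ 2) * (∫⁻ v, ‖Dm v‖ₑ ^ 2 ∂ν) *
        ∫⁻ v, ‖k v‖ₑ ^ 2 * ‖G₁ v‖ₑ ^ 2 ∂ν := by
    -- The gradient of f_j is controlled on B_R' only. Since k is supported there, the indicator can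
    -- be inserted at no cost.
    have h1 : ‖∫ v, (k v * F' (f j v)) • fderiv ℝ (f j) v (G₁ v) ∂ν‖ₑ ≤
        ENNReal.ofReal ((β ^ 2)⁻¹) * ∫⁻ v, (ball (0 : V) R').indicator
          (fun v => ‖fderiv ℝ (f j) v‖ₑ) v * (‖k v‖ₑ * ‖G₁ v‖ₑ) ∂ν := by
      rw [← lintegral_const_mul' _ _ (by simp)]
      refine (enorm_integral_le_lintegral_enorm _).trans (lintegral_mono fun v => ?_)
      by_cases hv : v ∈ ball (0 : V) R'
      · rw [indicator_of_mem hv, enorm_smul, enorm_mul]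
        calc _ ≤ ‖k v‖ₑ * ENNReal.ofReal ((β ^ 2)⁻¹) * (‖fderiv ℝ (f j) v‖ₑ * ‖G₁ v‖ₑ) := by
              gcongr
              · exact hF'b v
              · exact ContinuousLinearMap.le_opENorm _ _
          _ = _ := by ring
      · have : k v = 0 := image_eq_zero_of_notMem_tsupport fun h => hv (hk.subset h)
        simp [this]
    have h2 : ∫⁻ v, (ball (0 : V) R').indicator (fun v => ‖fderiv ℝ (f j) v‖ₑ) v ^ 2 ∂ν
        ≤ ∫⁻ v, ‖Dm v‖ₑ ^ 2 ∂ν := by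
      refine le_trans ?_ (hfD j)
      rw [← lintegral_indicator (s := ball (0 : V) R') measurableSet_ball]
      refine (lintegral_mono' (Measure.restrict_le_self : ν ≤ volume) le_rfl).trans
        (lintegral_mono fun v => le_of_eq ?_)
      by_cases hv : v ∈ ball (0 : V) R' <;> simp [hv]
    calc _ ≤ (ENNReal.ofReal ((β ^ 2)⁻¹) * ∫⁻ v, (ball (0 : V) R').indicator
          (fun v => ‖fderiv ℝ (f j) v‖ₑ) v * (‖k v‖ₑ * ‖G₁ v‖ₑ) ∂ν) ^ 2 := by gcongr
      _ ≤ ENNReal.ofReal ((β ^ 2)⁻¹) ^ 2 * ((∫⁻ v, (ball (0 : V) R').indicator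
          (fun v => ‖fderiv ℝ (f j) v‖ₑ) v ^ 2 ∂ν) * ∫⁻ v, (‖k v‖ₑ * ‖G₁ v‖ₑ) ^ 2 ∂ν) := by
          rw [mul_pow]
          gcongr
          exact sq_lintegral_mul_le
            (((hfd j).measurable.enorm.indicator measurableSet_ball).aemeasurable)
            (hkc.measurable.enorm.aemeasurable.mul hG₁.1.enorm)
      _ ≤ _ := by
          rw [ENNReal.ofReal_pow (by positivity), mul_assoc]
          simp only [mul_pow]
          gcongr
  have hsplit : ∫ v, fderiv ℝ (ψ j) v (G₁ v) ∂ν = (∫ v, F (f j v) • fderiv ℝ k v (G₁ v) ∂ν)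
      + ∫ v, (k v * F' (f j v)) • fderiv ℝ (f j) v (G₁ v) ∂ν := by
    have hG₁i : Integrable G₁ ν := hG₁.integrable (by norm_num)
    have hA : Continuous fun v => F (f j v) • fderiv ℝ k v := hFm.smul hkd
    have hAc : HasCompactSupport fun v => F (f j v) • fderiv ℝ k v := 
      HasCompactSupport.smul_left (f := fun v => F (f j v)) (f' := fderiv ℝ k)
        (hk.compact.fderiv ℝ)
    have hB : Continuous fun v => (k v * F' (f j v)) • fderiv ℝ (f j) v :=
      (hkc.mul (hF'c.comp (hfs j).continuous)).smul (hfd j)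
    have hBc : HasCompactSupport fun v => (k v * F' (f j v)) • fderiv ℝ (f j) v :=
      HasCompactSupport.smul_right (f := fun v => k v * F' (f j v))
        (f' := fderiv ℝ (f j)) hk.compact.mul_right
    rw [← integral_add]
    · refine integral_congr_ae (Eventually.of_forall fun v => ?_)
      simp [hψd]
    · exact integrable_clm_apply_of_hasCompactSupport hA hAc hG₁i
    · exact integrable_clm_apply_of_hasCompactSupport hB hBc hG₁i
  rw [hsplit]
  refine (enorm_add_sq_le _ _).trans ?_
  gcongr
  refine (enorm_add_sq_le _ _).trans ?_
  gcongr

/-- From 1 = β²/(m² + β²) + m · m/(m² + β²): the first summand has a small L² norm because |m| is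
rarely small (`lintegral_resolvent_le`), and the second contains the factor m on which the equation
acts. -/
theorem sq_enorm_average_le {R R' : ℝ} (hR : R' < R) {m : V → ℝ} {Dm : V → V →L[ℝ] ℝ}
    (hm : StronglyMeasurable m) {M : ℝ} (hM : ∀ v, |m v| ≤ M) (hD : StronglyMeasurable Dm)
    (hD2 : MemLp Dm 2 (volume.restrict (ball 0 R))) (hw : HasWeakDeriv R m Dm)
    {u G₀ : V → ℝ} {G₁ : V → V} (hu : MemLp u 2 (volume.restrict (ball 0 R)))
    (hG₀ : MemLp G₀ 2 (volume.restrict (ball 0 R)))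
    (hG₁ : MemLp G₁ 2 (volume.restrict (ball 0 R)))
    (heq : ∀ ψ : V → ℝ, IsTest (ball 0 R) ψ → ∫ v in ball 0 R, m v * ψ v * u v
      = (∫ v in ball 0 R, fderiv ℝ ψ v (G₁ v)) + ∫ v in ball 0 R, ψ v * G₀ v)
    {k : V → ℝ} (hk : IsTest (ball 0 R') k) {β : ℝ} (hβ : 0 < β) {B : ℝ≥0∞}
    (hB : ∀ j : ℕ, volume {v | v ∈ ball (0 : V) R ∧ |m v| ≤ 2 ^ j * β} ≤ 2 ^ j * B) :
    ‖∫ v in ball 0 R, k v * u v‖ₑ ^ 2 ≤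
      2 * (8 * B * (∫⁻ v in ball 0 R, ‖k v‖ₑ ^ 2 * ‖u v‖ₑ ^ 2)) +
      2 * (2 * (2 * (ENNReal.ofReal (β⁻¹ ^ 2) * volume (ball (0 : V) R) *
            (∫⁻ v in ball 0 R, ‖fderiv ℝ k v‖ₑ ^ 2 * ‖G₁ v‖ₑ ^ 2)
          + ENNReal.ofReal (((β ^ 2)⁻¹) ^ 2) * (∫⁻ v in ball 0 R, ‖Dm v‖ₑ ^ 2) *
            ∫⁻ v in ball 0 R, ‖k v‖ₑ ^ 2 * ‖G₁ v‖ₑ ^ 2)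
        + ENNReal.ofReal (β⁻¹ ^ 2) * volume (ball (0 : V) R) *
          ∫⁻ v in ball 0 R, ‖k v‖ₑ ^ 2 * ‖G₀ v‖ₑ ^ 2)) := by
  have h1 := sq_enorm_integral_mul_test_le hR hm hM hD hD2 hw hu hG₀ hG₁ heq hk hβ
  set ν := volume.restrict (ball (0 : V) R) with hν
  have hfin : IsFiniteMeasure ν := ⟨by simpa [hν] using measure_ball_lt_top⟩
  have hkc : Continuous k := hk.smooth.continuous
  obtain ⟨Bk, hBk⟩ := hk.compact.exists_bound_of_continuous hkc
  have hui : Integrable u ν := hu.integrable (by norm_num)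
  have hBm : ∀ j : ℕ, ν {v | |m v| ≤ 2 ^ j * β} ≤ 2 ^ j * B := fun j => by
    rw [hν, Measure.restrict_apply (measurableSet_le hm.measurable.abs measurable_const)]
    refine le_trans (measure_mono ?_) (hB j)
    exact fun v hv => ⟨hv.2, hv.1⟩
  have h2 : ‖∫ v, (β ^ 2 / (m v ^ 2 + β ^ 2)) • (k v * u v) ∂ν‖ₑ ^ 2
      ≤ 8 * B * ∫⁻ v, ‖k v‖ₑ ^ 2 * ‖u v‖ₑ ^ 2 ∂ν := by
    refine (sq_enorm_integral_smul_le ?_ (hkc.aestronglyMeasurable.mul hu.1)).trans ?_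
    · have := hm.measurable
      exact Measurable.aestronglyMeasurable (by fun_prop)
    · refine mul_le_mul' (lintegral_resolvent_le hm.measurable hβ hBm) (lintegral_mono fun v => ?_)
      rw [Pi.mul_apply, enorm_mul, mul_pow]
  have hsum : ∫ v, k v * u v ∂ν = (∫ v, (β ^ 2 / (m v ^ 2 + β ^ 2)) • (k v * u v) ∂ν)
      + ∫ v, m v * (k v * (m v / (m v ^ 2 + β ^ 2))) * u v ∂ν := by
    have hku : Integrable (fun v => k v * u v) ν :=
      hui.bdd_mul hkc.aestronglyMeasurable (Eventually.of_forall hBk)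
    have hi : Integrable (fun v => (β ^ 2 / (m v ^ 2 + β ^ 2)) • (k v * u v)) ν := by
      refine Integrable.bdd_smul (φ := fun v => β ^ 2 / (m v ^ 2 + β ^ 2)) hku 1 ?_
        (Eventually.of_forall fun v => ?_)
      · have := hm.measurable
        exact Measurable.aestronglyMeasurable (by fun_prop)
      · rw [Real.norm_of_nonneg (by positivity), div_le_one (by positivity)]
        nlinarith [sq_nonneg (m v)]
    have he : ∀ v, m v * (k v * (m v / (m v ^ 2 + β ^ 2))) * u v
        = k v * u v - (β ^ 2 / (m v ^ 2 + β ^ 2)) • (k v * u v) := fun v => by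
      have : m v ^ 2 + β ^ 2 ≠ 0 := by positivity
      simp only [smul_eq_mul]
      field_simp
      ring
    simp only [he]
    rw [integral_sub hku hi]
    ring
  rw [hsum]
  refine (enorm_add_sq_le _ _).trans ?_
  rw [mul_add]
  gcongr

end Averaging
end Kinetic

namespace Kinetic
open Filter Topology Metric

/-! ### From averages to the function itself, at a fixed frequency. -/

section LocalEstimate
variable {V : Type*} [NormedAddCommGroup V] [InnerProductSpace ℝ V] [FiniteDimensional ℝ V]
  [MeasurableSpace V] [BorelSpace V]

theorem lintegral_lintegral_kernel_le {κ f : V → ℝ≥0∞} (hκ : Measurable κ) (hf : Measurable f)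
    (S T : Set V) :
    ∫⁻ v in S, ∫⁻ w in T, κ (v - w) * f w ≤ (∫⁻ v, κ v) * ∫⁻ w in T, f w := by
  calc ∫⁻ v in S, ∫⁻ w in T, κ (v - w) * f w
      ≤ ∫⁻ v, ∫⁻ w in T, κ (v - w) * f w := lintegral_mono' Measure.restrict_le_self le_rfl
    _ = ∫⁻ w in T, ∫⁻ v, κ (v - w) * f w :=
        lintegral_lintegral_swap (Measurable.aemeasurable
          ((hκ.comp (measurable_fst.sub measurable_snd)).mul (hf.comp measurable_snd)))
    _ = ∫⁻ w in T, (∫⁻ v, κ v) * f w := by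
        refine lintegral_congr fun w => ?_
        rw [lintegral_mul_const _ (by fun_prop : Measurable fun v => κ (v - w)),
          lintegral_sub_right_eq_self κ w]
    _ = _ := lintegral_const_mul _ hf

/-- `sq_enorm_average_le` is applied with k = ρ(v - ·) and integrated over v; by Tonelli each term
becomes the squared norm of ρ or of its gradient times an energy. E dominates both norms of ρ, and T
is the common size of the three losses, so that the parameters can be balanced afterwards. -/
theorem lintegral_average_sq_le {R R' r ε : ℝ} (hR : R' < R) (hr : r + ε ≤ R')
    {m : V → ℝ} {Dm : V → V →L[ℝ] ℝ}
    (hm : StronglyMeasurable m) {M : ℝ} (hM : ∀ v, |m v| ≤ M) (hD : StronglyMeasurable Dm)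
    (hD2 : MemLp Dm 2 (volume.restrict (ball 0 R))) (hw : HasWeakDeriv R m Dm)
    {u G₀ : V → ℝ} {G₁ : V → V} (hum : StronglyMeasurable u) (hG₀m : StronglyMeasurable G₀)
    (hG₁m : StronglyMeasurable G₁) (hu : MemLp u 2 (volume.restrict (ball 0 R)))
    (hG₀ : MemLp G₀ 2 (volume.restrict (ball 0 R)))
    (hG₁ : MemLp G₁ 2 (volume.restrict (ball 0 R)))
    (heq : ∀ ψ : V → ℝ, IsTest (ball 0 R) ψ → ∫ v in ball 0 R, m v * ψ v * u v
      = (∫ v in ball 0 R, fderiv ℝ ψ v (G₁ v)) + ∫ v in ball 0 R, ψ v * G₀ v)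
    {ρ : V → ℝ} (hρ : ContDiff ℝ ∞ ρ) (hρs : Function.support ρ ⊆ ball 0 ε)
    {β : ℝ} (hβ : 0 < β) {E T K Mq Bv : ℝ≥0∞} (hE : ∫⁻ v, ‖ρ v‖ₑ ^ 2 ≤ E)
    (hE' : ∫⁻ v, ‖fderiv ℝ ρ v‖ₑ ^ 2 ≤ E)
    (hB : ∀ j : ℕ, volume {v | v ∈ ball (0 : V) R ∧ |m v| ≤ 2 ^ j * β} ≤ 2 ^ j * (K * T))
    (hBv : volume (ball (0 : V) R) ≤ Bv) (hT : ENNReal.ofReal (β⁻¹ ^ 2) ≤ T)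
    (hT' : ENNReal.ofReal (((β ^ 2)⁻¹) ^ 2) * (∫⁻ v in ball 0 R, ‖Dm v‖ₑ ^ 2) ≤ Mq * T) :
    ∫⁻ v in ball 0 r, ‖∫ w in ball 0 R, ρ (v - w) * u w‖ₑ ^ 2 ≤
      (16 * K + 12 * Bv + 8 * Mq) * T * E * ((∫⁻ v in ball 0 R, ‖u v‖ₑ ^ 2)
        + (∫⁻ v in ball 0 R, ‖G₁ v‖ₑ ^ 2) + ∫⁻ v in ball 0 R, ‖G₀ v‖ₑ ^ 2) := by
  have hρm : Measurable fun v => ‖ρ v‖ₑ ^ 2 := hρ.continuous.measurable.enorm.pow_const 2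
  have hρdm : Measurable fun v => ‖fderiv ℝ ρ v‖ₑ ^ 2 :=
    (hρ.continuous_fderiv (by simp)).measurable.enorm.pow_const 2
  have hum' : Measurable fun v => ‖u v‖ₑ ^ 2 := hum.measurable.enorm.pow_const 2
  have hG₀m' : Measurable fun v => ‖G₀ v‖ₑ ^ 2 := hG₀m.measurable.enorm.pow_const 2
  have hG₁m' : Measurable fun v => ‖G₁ v‖ₑ ^ 2 := hG₁m.measurable.enorm.pow_const 2
  have hprod : ∀ κ f : V → ℝ≥0∞, Measurable κ → Measurable f →
      Measurable fun v => ∫⁻ w in ball (0 : V) R, κ (v - w) * f w := fun κ f hκ hf => by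
    refine Measurable.lintegral_prod_right' (f := fun p : V × V => κ (p.1 - p.2) * f p.2) ?_
    exact (hκ.comp (measurable_fst.sub measurable_snd)).mul (hf.comp measurable_snd)
  set I1 := fun v => ∫⁻ w in ball (0 : V) R, ‖ρ (v - w)‖ₑ ^ 2 * ‖u w‖ₑ ^ 2 with hI1
  set I2 := fun v => ∫⁻ w in ball (0 : V) R, ‖fderiv ℝ ρ (v - w)‖ₑ ^ 2 * ‖G₁ w‖ₑ ^ 2 with hI2
  set I3 := fun v => ∫⁻ w in ball (0 : V) R, ‖ρ (v - w)‖ₑ ^ 2 * ‖G₁ w‖ₑ ^ 2 with hI3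
  set I4 := fun v => ∫⁻ w in ball (0 : V) R, ‖ρ (v - w)‖ₑ ^ 2 * ‖G₀ w‖ₑ ^ 2 with hI4
  have hm1 : Measurable I1 := hprod _ _ hρm hum'
  have hm2 : Measurable I2 := hprod _ _ hρdm hG₁m'
  have hm3 : Measurable I3 := hprod _ _ hρm hG₁m'
  have hm4 : Measurable I4 := hprod _ _ hρm hG₀m'
  have hpt : ∀ v ∈ ball (0 : V) r, ‖∫ w in ball 0 R, ρ (v - w) * u w‖ₑ ^ 2 ≤
      T * (16 * K * I1 v + 8 * Bv * I2 v + 8 * Mq * I3 v + 4 * Bv * I4 v) := by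
    intro v hv
    have hk : IsTest (ball 0 R') fun w => ρ (v - w) := by
      refine isTest_of_support (x := v) (s := ε) (hρ.comp (by fun_prop)) ?_ ?_
      · intro w hw
        have h1 : v - w ∈ ball (0 : V) ε := hρs hw
        rw [mem_ball_zero_iff, norm_sub_rev] at h1
        rw [mem_closedBall, dist_eq_norm]
        exact h1.le
      · refine closedBall_subset_ball' ?_
        have := mem_ball.1 hv
        linarith
    have h := sq_enorm_average_le hR hm hM hD hD2 hw hu hG₀ hG₁ heq hk hβ hB
    simp only [fderiv_comp_const_sub hρ, enorm_neg] at h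
    refine h.trans ?_
    calc _ ≤ 2 * (8 * (K * T) * I1 v) + 2 * (2 * (2 * (T * Bv * I2 v + Mq * T * I3 v)
          + T * Bv * I4 v)) := by gcongr
      _ = _ := by ring
  refine (setLIntegral_mono' measurableSet_ball hpt).trans ?_
  rw [lintegral_const_mul _ (by fun_prop), lintegral_add_left (by fun_prop),
    lintegral_add_left (by fun_prop), lintegral_add_left (by fun_prop),
    lintegral_const_mul _ hm1, lintegral_const_mul _ hm2, lintegral_const_mul _ hm3,
    lintegral_const_mul _ hm4]
  have b1 : ∫⁻ v in ball 0 r, I1 v ≤ E * ∫⁻ v in ball 0 R, ‖u v‖ₑ ^ 2 :=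
    (lintegral_lintegral_kernel_le hρm hum' _ _).trans (by gcongr)
  have b2 : ∫⁻ v in ball 0 r, I2 v ≤ E * ∫⁻ v in ball 0 R, ‖G₁ v‖ₑ ^ 2 :=
    (lintegral_lintegral_kernel_le hρdm hG₁m' _ _).trans (by gcongr)
  have b3 : ∫⁻ v in ball 0 r, I3 v ≤ E * ∫⁻ v in ball 0 R, ‖G₁ v‖ₑ ^ 2 :=
    (lintegral_lintegral_kernel_le hρm hG₁m' _ _).trans (by gcongr)
  have b4 : ∫⁻ v in ball 0 r, I4 v ≤ E * ∫⁻ v in ball 0 R, ‖G₀ v‖ₑ ^ 2 :=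
    (lintegral_lintegral_kernel_le hρm hG₀m' _ _).trans (by gcongr)
  set a := ∫⁻ v in ball 0 R, ‖u v‖ₑ ^ 2
  set b := ∫⁻ v in ball 0 R, ‖G₁ v‖ₑ ^ 2
  set c := ∫⁻ v in ball 0 R, ‖G₀ v‖ₑ ^ 2
  calc _ ≤ T * (16 * K * (E * a) + 8 * Bv * (E * b) + 8 * Mq * (E * b) + 4 * Bv * (E * c)) := by
        gcongr
    _ ≤ T * (16 * K * (E * (a + b + c)) + 8 * Bv * (E * (a + b + c)) + 8 * Mq * (E * (a + b + c))
          + 4 * Bv * (E * (a + b + c))) := by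
        have ha : a ≤ a + b + c := by rw [add_assoc]; exact le_self_add
        have hb : b ≤ a + b + c := le_add_right le_add_self
        have hc : c ≤ a + b + c := le_add_self
        gcongr
    _ = _ := by ring

/-- Since ρ has mass one, u(v) minus its average is ∫ ρ(v - w)(u(v) - u(w)) dw. Cauchy–Schwarz gives
ε^(-d) from ρ against ε^(d + 2δ) from the increments. -/
theorem lintegral_sub_average_sq_le {R r ε ε₀ δ : ℝ} (hr : r + ε ≤ R) (hε : 0 < ε)
    (hε₀ : ε ≤ ε₀) {u : V → ℝ} (hu : Integrable u (volume.restrict (ball 0 R)))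
    (hum : StronglyMeasurable u)
    {N : ℝ≥0∞} (hN : IncrementBound δ r ε₀ u N)
    {ρ : V → ℝ} (hρ : ContDiff ℝ ∞ ρ) (hρs : Function.support ρ ⊆ ball 0 ε)
    (hρ1 : ∫ v, ρ v = 1) {C : ℝ≥0}
    (hC : ∫⁻ v, ‖ρ v‖ₑ ^ 2 ≤ C * ENNReal.ofReal (ε ^ (-(Module.finrank ℝ V : ℝ)))) :
    ∫⁻ v in ball 0 r, ‖u v - ∫ w in ball 0 R, ρ (v - w) * u w‖ₑ ^ 2
      ≤ C * ENNReal.ofReal (ε ^ (2 * δ)) * N := by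
  have hρc : HasCompactSupport ρ := HasCompactSupport.of_support_subset_isCompact
    (isCompact_closedBall 0 ε) (hρs.trans ball_subset_closedBall)
  have hρi : Integrable ρ := hρ.continuous.integrable_of_hasCompactSupport hρc
  obtain ⟨Bk, hBk⟩ := hρc.exists_bound_of_continuous hρ.continuous
  have hpt : ∀ v ∈ ball (0 : V) r, ‖u v - ∫ w in ball 0 R, ρ (v - w) * u w‖ₑ ^ 2 ≤
      (C * ENNReal.ofReal (ε ^ (-(Module.finrank ℝ V : ℝ)))) *
        ∫⁻ w in ball v ε, ‖u v - u w‖ₑ ^ 2 := by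
    intro v hv
    have hcont : Continuous fun w => ρ (v - w) := hρ.continuous.comp (by fun_prop)
    have hsub : ball v ε ⊆ ball (0 : V) R := by
      refine ball_subset_ball' ?_
      have := mem_ball.1 hv
      linarith
    have hz : ∀ w, w ∉ ball v ε → ρ (v - w) = 0 := fun w hw => by
      by_contra hne
      have := hρs hne
      rw [mem_ball_zero_iff, ← dist_eq_norm, dist_comm] at this
      exact hw this
    have h1 : ∫ w in ball v ε, ρ (v - w) = 1 := by
      rw [setIntegral_eq_integral_of_forall_compl_eq_zero fun w hw => hz w hw,
        integral_sub_left_eq_self ρ volume v, hρ1]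
    have h2 : ∫ w in ball 0 R, ρ (v - w) * u w = ∫ w in ball v ε, ρ (v - w) * u w :=
      setIntegral_eq_of_subset_of_forall_sdiff_eq_zero measurableSet_ball hsub
        fun w hw => by rw [hz w hw.2, zero_mul]
    have hi : IntegrableOn (fun w => ρ (v - w) * u w) (ball v ε) :=
      Integrable.bdd_mul (hu.mono_measure (Measure.restrict_mono hsub le_rfl))
        hcont.aestronglyMeasurable (Eventually.of_forall fun w => hBk _)
    have hi' : IntegrableOn (fun w => ρ (v - w)) (ball v ε) := (hρi.comp_sub_left v).integrableOn
    have h3 : u v - ∫ w in ball 0 R, ρ (v - w) * u w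
        = ∫ w in ball v ε, ρ (v - w) • (u v - u w) := by
      rw [h2]
      simp only [smul_eq_mul, mul_sub]
      rw [integral_sub (hi'.mul_const _) hi, integral_mul_const, h1, one_mul]
    rw [h3]
    refine (sq_enorm_integral_smul_le hcont.aestronglyMeasurable
      (aestronglyMeasurable_const.sub hum.aestronglyMeasurable)).trans ?_
    refine mul_le_mul' ?_ le_rfl
    refine (lintegral_mono' Measure.restrict_le_self le_rfl).trans (le_trans (le_of_eq ?_) hC)
    exact lintegral_sub_left_eq_self (fun w => ‖ρ w‖ₑ ^ 2) v
  refine (setLIntegral_mono' measurableSet_ball hpt).trans ?_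
  rw [lintegral_const_mul' _ _ (ENNReal.mul_ne_top (by simp) (by simp))]
  refine (mul_le_mul_right (hN ε hε hε₀) _).trans (le_of_eq ?_)
  rw [mul_assoc, mul_assoc]
  congr 1
  rw [← mul_assoc, ← ENNReal.ofReal_mul (by positivity), ← Real.rpow_add hε]
  ring_nf

/-- The averaging estimate at a fixed frequency of size `lam ≥ 1`. -/
theorem exists_frequency_estimate (V : Type*) [NormedAddCommGroup V] [InnerProductSpace ℝ V]
    [FiniteDimensional ℝ V] [MeasurableSpace V] [BorelSpace V]
    {α δ γ ε₀ : ℝ} (hα : 0 < α) (hα1 : α ≤ 1) (hδ : 0 < δ) (hε₀ : 0 < ε₀) (hε₀1 : ε₀ ≤ 1)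
    (hγ : γ = 2 * α * δ / ((4 + α) * (2 + 2 * δ + Module.finrank ℝ V))) (K Mq Bv : ℝ≥0) :
    ∃ C : ℝ≥0, ∀ R r : ℝ, r + ε₀ < R → volume (ball (0 : V) R) ≤ Bv →
    ∀ lam : ℝ, 1 ≤ lam → ∀ (m : V → ℝ) (Dm : V → V →L[ℝ] ℝ) (M : ℝ),
    StronglyMeasurable m → (∀ v, |m v| ≤ M) → StronglyMeasurable Dm → 
    MemLp Dm 2 (volume.restrict (ball 0 R)) → HasWeakDeriv R m Dm →
    (∫⁻ v in ball 0 R, ‖Dm v‖ₑ ^ 2 ≤ Mq * ENNReal.ofReal (lam ^ 2)) →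
    (∀ t : ℝ, 0 < t → volume {v | v ∈ ball (0 : V) R ∧ |m v| ≤ t * lam}
      ≤ K * ENNReal.ofReal (t ^ α)) →
    ∀ (u G₀ : V → ℝ) (G₁ : V → V) (N : ℝ≥0∞), StronglyMeasurable u → StronglyMeasurable G₀ →
    StronglyMeasurable G₁ → MemLp u 2 (volume.restrict (ball 0 R)) →
    MemLp G₀ 2 (volume.restrict (ball 0 R)) → MemLp G₁ 2 (volume.restrict (ball 0 R)) →
    (∀ ψ : V → ℝ, IsTest (ball 0 R) ψ → ∫ v in ball 0 R, m v * ψ v * u v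
      = (∫ v in ball 0 R, fderiv ℝ ψ v (G₁ v)) + ∫ v in ball 0 R, ψ v * G₀ v) →
    IncrementBound δ r ε₀ u N →
    ENNReal.ofReal (lam ^ (2 * γ)) * ∫⁻ v in ball 0 r, ‖u v‖ₑ ^ 2 ≤
      C * (N + ((∫⁻ v in ball 0 R, ‖u v‖ₑ ^ 2) + (∫⁻ v in ball 0 R, ‖G₁ v‖ₑ ^ 2)
        + ∫⁻ v in ball 0 R, ‖G₀ v‖ₑ ^ 2)) := by
  obtain ⟨C₀, hC₀⟩ := exists_smoothing_kernel V
  set d : ℝ := (Module.finrank ℝ V : ℝ) with hd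
  have hd0 : 0 ≤ d := Nat.cast_nonneg _
  have hγ0 : 0 < γ := by rw [hγ]; positivity
  set A : ℝ≥0 := (16 * K + 12 * Bv + 8 * Mq) * C₀ * (ε₀ ^ (-(d + 2))).toNNReal with hA
  refine ⟨2 * A + 2 * C₀, fun R r hr hBv lam hlam m Dm M hm hM hD hD2 hw hDq hK u G₀ G₁ N hum hG₀m
    hG₁m hu hG₀ hG₁ heq hN => ?_⟩
  have hl0 : 0 < lam := by linarith
  have hfin : IsFiniteMeasure (volume.restrict (ball (0 : V) R)) :=
    ⟨by simpa using measure_ball_lt_top⟩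
  -- With β = lam · η, this η solves η^α = lam⁻² η⁻⁴: the sublevel sets of m balance the term in
  -- which the derivative falls on m.
  set η : ℝ := lam ^ (-2 / (4 + α)) with hη
  have hη0 : 0 < η := by positivity
  -- This ε makes lam^(2γ) ε^(2δ) bounded; the factor ε₀ and lam ≥ 1 keep ε at most ε₀.
  set ε : ℝ := ε₀ * lam ^ (-γ / δ) with hε
  have hε0 : 0 < ε := by positivity
  have hεε : ε ≤ ε₀ := by
    rw [hε]
    refine mul_le_of_le_one_right hε₀.le (Real.rpow_le_one_of_one_le_of_nonpos hlam ?_)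
    rw [neg_div]
    have : 0 < γ / δ := by positivity
    linarith
  have hε1 : ε ≤ 1 := hεε.trans hε₀1
  obtain ⟨ρ, hρ, hρs, hρ1, hρE, hρE'⟩ := hC₀ ε hε0
  set q : ℝ := lam ^ (-2 * α / (4 + α)) with hq
  have hq0 : 0 < q := by positivity
  have hηα : η ^ α = q := by
    rw [hη, hq, ← Real.rpow_mul hl0.le]; congr 1; ring
  have hβη : ((lam * η) ^ 2)⁻¹ ^ 2 * lam ^ 2 = q := by
    rw [hη, hq, ← Real.rpow_natCast, ← Real.rpow_natCast, ← Real.rpow_natCast]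
    nth_rewrite 1 [← Real.rpow_one lam]
    rw [← Real.rpow_add hl0, ← Real.rpow_mul hl0.le, ← Real.rpow_neg hl0.le, 
      ← Real.rpow_mul hl0.le, ← Real.rpow_add hl0]
    congr 1
    push_cast
    field_simp
    ring
  -- The remaining loss β⁻² is of lower order: its exponent is below that of q by 4/(4 + α), and lam
  -- ≥ 1.
  have hβη' : (lam * η)⁻¹ ^ 2 ≤ q := by
    rw [hη, hq, ← Real.rpow_natCast]
    nth_rewrite 1 [← Real.rpow_one lam]
    rw [← Real.rpow_add hl0, ← Real.rpow_neg hl0.le, ← Real.rpow_mul hl0.le]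
    refine Real.rpow_le_rpow_of_exponent_le hlam ?_
    rw [← sub_nonneg]
    have : -2 * α / (4 + α) - -(1 + -2 / (4 + α)) * ((2 : ℕ) : ℝ) = 4 / (4 + α) := by
      push_cast; field_simp; ring
    rw [this]
    positivity
  -- Here α ≤ 1 weakens the factor 2^(jα) to 2^j, the form needed in the layer cake sum.
  have hB : ∀ j : ℕ, volume {v | v ∈ ball (0 : V) R ∧ |m v| ≤ 2 ^ j * (lam * η)}
      ≤ 2 ^ j * (K * ENNReal.ofReal q) := by
    intro j
    have h1 := hK (2 ^ j * η) (by positivity)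
    rw [show 2 ^ j * η * lam = 2 ^ j * (lam * η) by ring] at h1
    refine h1.trans ?_
    rw [Real.mul_rpow (by positivity) hη0.le, hηα, ENNReal.ofReal_mul (by positivity),
      mul_left_comm]
    gcongr
    calc ENNReal.ofReal (((2 : ℝ) ^ j) ^ α) ≤ ENNReal.ofReal ((2 : ℝ) ^ j) := by
          refine ENNReal.ofReal_le_ofReal ?_
          conv_rhs => rw [← Real.rpow_one ((2 : ℝ) ^ j)]
          exact Real.rpow_le_rpow_of_exponent_le (one_le_pow₀ (by norm_num)) hα1
      _ = 2 ^ j := by rw [ENNReal.ofReal_pow (by norm_num)]; norm_num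
  -- The gradient bound also dominates that of ρ itself, as ε ≤ 1.
  set E : ℝ≥0∞ := C₀ * ENNReal.ofReal (ε ^ (-(d + 2))) with hE
  have hEρ : ∫⁻ v, ‖ρ v‖ₑ ^ 2 ≤ E := by
    exact hρE.trans (mul_le_mul_right (ENNReal.ofReal_le_ofReal
      (Real.rpow_le_rpow_of_exponent_ge hε0 hε1 (by linarith))) _)
  have hT' : ENNReal.ofReal ((((lam * η) ^ 2)⁻¹) ^ 2) * (∫⁻ v in ball 0 R, ‖Dm v‖ₑ ^ 2)
      ≤ Mq * ENNReal.ofReal q := by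
    refine (mul_le_mul_right hDq _).trans (le_of_eq ?_)
    rw [mul_left_comm, ← ENNReal.ofReal_mul (by positivity), hβη]
  have h1 := lintegral_average_sq_le (R' := r + ε₀) (r := r) hr (by linarith) hm hM hD hD2 hw hum hG₀m hG₁m
    hu hG₀ hG₁ heq hρ hρs (by positivity : 0 < lam * η) hEρ hρE' hB hBv
    (ENNReal.ofReal_le_ofReal hβη') hT'
  have h2 := lintegral_sub_average_sq_le (by linarith : r + ε ≤ R) hε0 hεε
    (hu.integrable (by norm_num)) hum hN hρ hρs hρ1 hρE
  set S := (∫⁻ v in ball 0 R, ‖u v‖ₑ ^ 2) + (∫⁻ v in ball 0 R, ‖G₁ v‖ₑ ^ 2)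
        + ∫⁻ v in ball 0 R, ‖G₀ v‖ₑ ^ 2 with hS
  have h3 : ∫⁻ v in ball 0 r, ‖u v‖ₑ ^ 2 ≤
      2 * (C₀ * ENNReal.ofReal (ε ^ (2 * δ)) * N) +
      2 * ((16 * K + 12 * Bv + 8 * Mq) * ENNReal.ofReal q * E * S) := by
    have hUm : Measurable fun v => ∫ w in ball 0 R, ρ (v - w) * u w := by
      refine StronglyMeasurable.measurable (StronglyMeasurable.integral_prod_right' 
        (f := fun p : V × V => ρ (p.1 - p.2) * u p.2) ?_)
      exact (hρ.continuous.comp (by fun_prop : Continuous fun p : V × V => p.1 - p.2)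
        |>.stronglyMeasurable).mul (hum.comp_measurable measurable_snd)
    calc ∫⁻ v in ball 0 r, ‖u v‖ₑ ^ 2
        ≤ ∫⁻ v in ball 0 r, (2 * ‖u v - ∫ w in ball 0 R, ρ (v - w) * u w‖ₑ ^ 2
          + 2 * ‖∫ w in ball 0 R, ρ (v - w) * u w‖ₑ ^ 2) := by
          refine lintegral_mono fun v => ?_
          rw [← mul_add]
          simpa using enorm_add_sq_le (u v - ∫ w in ball 0 R, ρ (v - w) * u w)
            (∫ w in ball 0 R, ρ (v - w) * u w)
      _ ≤ _ := by
          have hum' := hum.measurable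
          rw [lintegral_add_left (by fun_prop), lintegral_const_mul _ (by fun_prop),
            lintegral_const_mul _ (by fun_prop)]
          gcongr
  have e1 : ENNReal.ofReal (lam ^ (2 * γ)) * ENNReal.ofReal (ε ^ (2 * δ)) ≤ 1 := by
    rw [← ENNReal.ofReal_mul (by positivity), ENNReal.ofReal_le_one, hε,
      Real.mul_rpow hε₀.le (by positivity), ← Real.rpow_mul hl0.le, mul_left_comm,
      ← Real.rpow_add hl0]
    have : 2 * γ + -γ / δ * (2 * δ) = 0 := by field_simp; ring
    rw [this, Real.rpow_zero, mul_one]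
    exact Real.rpow_le_one hε₀.le hε₀1 (by positivity)
  -- The powers of lam cancel exactly: 2γ - 2α/(4 + α) + γ(d + 2)/δ = 0 is the equation that defines
  -- γ.
  have e2 : ENNReal.ofReal (lam ^ (2 * γ)) * (ENNReal.ofReal q * ENNReal.ofReal (ε ^ (-(d + 2))))
      = ENNReal.ofReal (ε₀ ^ (-(d + 2))) := by
    rw [← ENNReal.ofReal_mul (by positivity), ← ENNReal.ofReal_mul (by positivity), hε, hq,
      Real.mul_rpow hε₀.le (by positivity), ← Real.rpow_mul hl0.le]
    congr 1
    have : 2 * γ + (-2 * α / (4 + α) + -γ / δ * (-(d + 2))) = 0 := by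
      rw [hγ]; field_simp; ring
    calc _ = ε₀ ^ (-(d + 2)) * (lam ^ (2 * γ) * (lam ^ (-2 * α / (4 + α))
          * lam ^ (-γ / δ * (-(d + 2))))) := by ring
      _ = _ := by rw [← Real.rpow_add hl0, ← Real.rpow_add hl0, this, Real.rpow_zero, mul_one]
  have e3 : ENNReal.ofReal (lam ^ (2 * γ)) *
      ((16 * K + 12 * Bv + 8 * Mq) * ENNReal.ofReal q * E * S) = A * S := by
    rw [hA, hE]
    push_cast
    rw [← ENNReal.ofReal, ← e2]
    ring
  calc _ ≤ ENNReal.ofReal (lam ^ (2 * γ)) * (2 * (C₀ * ENNReal.ofReal (ε ^ (2 * δ)) * N) +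
      2 * ((16 * K + 12 * Bv + 8 * Mq) * ENNReal.ofReal q * E * S)) := by gcongr
    _ = 2 * C₀ * (ENNReal.ofReal (lam ^ (2 * γ)) * ENNReal.ofReal (ε ^ (2 * δ))) * N
        + 2 * (ENNReal.ofReal (lam ^ (2 * γ)) *
          ((16 * K + 12 * Bv + 8 * Mq) * ENNReal.ofReal q * E * S)) := by ring
    _ ≤ 2 * C₀ * 1 * N + 2 * (A * S) := by rw [e3]; gcongr
    _ ≤ 2 * C₀ * (N + S) + 2 * A * (N + S) := by
        rw [mul_one, ← mul_assoc]
        gcongr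
        · exact le_self_add
        · exact le_add_self
    _ = _ := by push_cast; ring

end LocalEstimate
end Kinetic

namespace Kinetic
open Filter Topology Metric

/-! ### Plancherel's theorem and the real cosine and sine transforms. -/

section Plancherel
open FourierTransform SchwartzMap
variable {W : Type*} [NormedAddCommGroup W] [InnerProductSpace ℝ W] [FiniteDimensional ℝ W]
  [MeasurableSpace W] [BorelSpace W]

theorem continuous_fourier_of_integrable {f : W → ℂ} (hf : Integrable f) : Continuous (𝓕 f) :=
  VectorFourier.fourierIntegral_continuous Real.continuous_fourierChar (L := innerₗ W)
    continuous_inner hf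

/-- Plancherel's theorem for the Fourier integral on `L¹ ∩ L²`. -/
theorem lintegral_sq_enorm_fourier {f : W → ℂ} (hf : Integrable f) (hf2 : MemLp f 2) :
    ∫⁻ ζ, ‖𝓕 f ζ‖ₑ ^ 2 = ∫⁻ p, ‖f p‖ₑ ^ 2 := by
  set F : Lp ℂ 2 (volume : Measure W) := hf2.toLp f with hF
  have hcont := continuous_fourier_of_integrable hf
  -- The L² transform and the Fourier integral agree as distributions: against a test function both
  -- reduce, by moving the transform onto it, to the same integral of f.
  have hae : ((𝓕 F : Lp ℂ 2 (volume : Measure W)) : W → ℂ) =ᵐ[volume] 𝓕 f := by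
    refine ae_eq_of_integral_contDiff_smul_eq
      ((Lp.memLp (𝓕 F)).locallyIntegrable (by norm_num)) hcont.locallyIntegrable ?_
    intro g hg hgc
    have hgs : HasCompactSupport fun x => (g x : ℂ) := hgc.comp_left Complex.ofReal_zero
    set φ : 𝓢(W, ℂ) := hgs.toSchwartzMap (Complex.ofRealCLM.contDiff.comp hg) with hφ
    have hφg : ∀ x, φ x = (g x : ℂ) := fun x => rfl
    have h1 := congrArg (fun T : 𝓢'(W, ℂ) => T φ) (Lp.fourier_toTemperedDistribution_eq F)
    simp only [TemperedDistribution.fourier_apply, Lp.toTemperedDistribution_apply] at h1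
    have h2 : ∫ x, (𝓕 φ) x • F x = ∫ x, (𝓕 φ) x • f x := by
      refine integral_congr_ae ?_
      filter_upwards [hf2.coeFn_toLp] with x hx
      rw [hx]
    have h3 : ∫ x, (𝓕 φ) x • f x = ∫ x, φ x • 𝓕 f x := by
      have := VectorFourier.integral_fourierIntegral_smul_eq_flip (μ := (volume : Measure W))
        (ν := (volume : Measure W)) (L := innerₗ W) Real.continuous_fourierChar continuous_inner
        (φ.integrable) hf
      rw [flip_innerₗ] at this
      exact this
    rw [h2, h3] at h1
    exact h1.symm
  have h4 : eLpNorm (𝓕 f) 2 volume = eLpNorm f 2 volume := by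
    rw [← eLpNorm_congr_ae hae, ← eLpNorm_congr_ae hf2.coeFn_toLp]
    have := Lp.norm_fourier_eq F
    rw [Lp.norm_def, Lp.norm_def] at this
    exact (ENNReal.toReal_eq_toReal_iff' (Lp.eLpNorm_ne_top _) (Lp.eLpNorm_ne_top _)).1 this
  rw [← eLpNorm_two_sq, ← eLpNorm_two_sq, h4]

variable {F : Type*} [NormedAddCommGroup F] [NormedSpace ℝ F]

/-- The cosine transform. -/
noncomputable def cosT (f : W → F) (ζ : W) : F :=
  ∫ p, Real.cos (2 * Real.pi * inner ℝ p ζ) • f p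

/-- The sine transform. -/
noncomputable def sinT (f : W → F) (ζ : W) : F :=
  ∫ p, Real.sin (2 * Real.pi * inner ℝ p ζ) • f p

theorem integrable_cos_smul {f : W → F} (hf : Integrable f) (ζ : W) :
    Integrable fun p => Real.cos (2 * Real.pi * inner ℝ p ζ) • f p :=
  Integrable.bdd_smul (φ := fun p => Real.cos (2 * Real.pi * inner ℝ p ζ)) hf 1
    (Continuous.aestronglyMeasurable (by fun_prop))
    (Eventually.of_forall fun p => Real.abs_cos_le_one _)

theorem integrable_sin_smul {f : W → F} (hf : Integrable f) (ζ : W) :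
    Integrable fun p => Real.sin (2 * Real.pi * inner ℝ p ζ) • f p :=
  Integrable.bdd_smul (φ := fun p => Real.sin (2 * Real.pi * inner ℝ p ζ)) hf 1
    (Continuous.aestronglyMeasurable (by fun_prop))
    (Eventually.of_forall fun p => Real.abs_sin_le_one _)

theorem fourier_ofReal_eq {f : W → ℝ} (hf : Integrable f) (ζ : W) :
    𝓕 (fun p => (f p : ℂ)) ζ = ((cosT f ζ : ℝ) : ℂ) - ((sinT f ζ : ℝ) : ℂ) * Complex.I := by
  have hc : Integrable fun p => ((Real.cos (2 * Real.pi * inner ℝ p ζ) • f p : ℝ) : ℂ) :=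
    (integrable_cos_smul hf ζ).ofReal
  have hs : Integrable fun p =>
      ((Real.sin (2 * Real.pi * inner ℝ p ζ) • f p : ℝ) : ℂ) * Complex.I :=
    Integrable.mul_const (integrable_sin_smul hf ζ).ofReal Complex.I
  rw [Real.fourier_eq, cosT, sinT, ← integral_complex_ofReal, ← integral_complex_ofReal,
    ← integral_mul_const, ← integral_sub hc hs]
  refine integral_congr_ae (Eventually.of_forall fun p => ?_)
  simp only [Circle.smul_def, Real.fourierChar_apply, smul_eq_mul]
  push_cast
  rw [Complex.exp_mul_I]
  simp only [mul_neg, Complex.cos_neg, Complex.sin_neg]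
  ring

/-- The two real transforms carry the whole modulus of the complex one. Working with this pair keeps
the problem in v real, as are the equation, its test functions and the weak derivatives. -/
theorem sq_enorm_fourier_ofReal {f : W → ℝ} (hf : Integrable f) (ζ : W) :
    ‖𝓕 (fun p => (f p : ℂ)) ζ‖ₑ ^ 2 = ‖cosT f ζ‖ₑ ^ 2 + ‖sinT f ζ‖ₑ ^ 2 := by
  have h : ‖𝓕 (fun p => (f p : ℂ)) ζ‖ ^ 2 = ‖cosT f ζ‖ ^ 2 + ‖sinT f ζ‖ ^ 2 := by
    rw [fourier_ofReal_eq hf, Complex.sq_norm, Complex.normSq_apply]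
    simp
    ring
  simp only [← ofReal_norm, ← ENNReal.ofReal_pow (norm_nonneg _)]
  rw [h, ENNReal.ofReal_add (by positivity) (by positivity)]

theorem lintegral_cosT_sinT_real {f : W → ℝ} (hf : Integrable f) (hf2 : MemLp f 2) :
    ∫⁻ ζ, (‖cosT f ζ‖ₑ ^ 2 + ‖sinT f ζ‖ₑ ^ 2) = ∫⁻ p, ‖f p‖ₑ ^ 2 := by
  have h := lintegral_sq_enorm_fourier (f := fun p => (f p : ℂ)) hf.ofReal hf2.ofReal
  simp only [sq_enorm_fourier_ofReal hf] at h
  rw [h]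
  refine lintegral_congr fun p => ?_
  simp [← ofReal_norm]

/-- A translation multiplies the complex transform by a character. It mixes cosine and sine parts,
so only the sum of their squares transforms simply. -/
theorem sq_enorm_cosT_add_sinT_translate {f : W → ℝ} (hf : Integrable f) (k ζ : W) :
    ‖cosT (fun p => f (p + k) - f p) ζ‖ₑ ^ 2 + ‖sinT (fun p => f (p + k) - f p) ζ‖ₑ ^ 2
      = ‖(Real.fourierChar (inner ℝ k ζ) : ℂ) - 1‖ₑ ^ 2 *
        (‖cosT f ζ‖ₑ ^ 2 + ‖sinT f ζ‖ₑ ^ 2) := by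
  have hk : Integrable fun p => f (p + k) := hf.comp_add_right k
  have hd : Integrable fun p => f (p + k) - f p := hk.sub hf
  rw [← sq_enorm_fourier_ofReal hf, ← sq_enorm_fourier_ofReal hd, ← mul_pow, ← enorm_mul]
  congr 2
  have h1 := congrFun (VectorFourier.fourierIntegral_comp_add_right Real.fourierChar
    (volume : Measure W) (innerₗ W) (fun p => (f p : ℂ)) k) ζ
  have h2 : 𝓕 (fun p => (f (p + k) : ℂ)) ζ
      = (Real.fourierChar (inner ℝ k ζ) : ℂ) * 𝓕 (fun p => (f p : ℂ)) ζ := by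
    simp only [Circle.smul_def, smul_eq_mul] at h1
    exact h1
  rw [sub_mul, one_mul, ← h2, fourier_ofReal_eq hd, fourier_ofReal_eq hk,
    fourier_ofReal_eq hf]
  have hc : cosT (fun p => f (p + k) - f p) ζ = cosT (fun p => f (p + k)) ζ - cosT f ζ := by
    simp only [cosT, smul_sub]
    exact integral_sub (integrable_cos_smul hk ζ) (integrable_cos_smul hf ζ)
  have hs : sinT (fun p => f (p + k) - f p) ζ = sinT (fun p => f (p + k)) ζ - sinT f ζ := by
    simp only [sinT, smul_sub]
    exact integral_sub (integrable_sin_smul hk ζ) (integrable_sin_smul hf ζ)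
  rw [hc, hs]
  push_cast
  ring

end Plancherel

/-! ### Plancherel for vector-valued functions, by coordinates in an orthonormal basis. -/

section PlancherelVector
variable {W : Type*} [NormedAddCommGroup W] [InnerProductSpace ℝ W] [FiniteDimensional ℝ W]
  [MeasurableSpace W] [BorelSpace W]
variable {F : Type*} [NormedAddCommGroup F] [InnerProductSpace ℝ F] [FiniteDimensional ℝ F]

theorem sq_enorm_eq_sum_inner {ι : Type*} [Fintype ι] (b : OrthonormalBasis ι ℝ F) (x : F) :
    ‖x‖ₑ ^ 2 = ∑ i, ‖inner ℝ (b i) x‖ₑ ^ 2 := by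
  have h : ‖x‖ ^ 2 = ∑ i, ‖inner ℝ (b i) x‖ ^ 2 := (b.sum_sq_norm_inner_right x).symm
  simp only [← ofReal_norm, ← ENNReal.ofReal_pow (norm_nonneg _)]
  rw [h, ENNReal.ofReal_sum_of_nonneg fun i _ => by positivity]

theorem inner_cosT {f : W → F} (hf : Integrable f) (e : F) (ζ : W) :
    inner ℝ e (cosT f ζ) = cosT (fun p => inner ℝ e (f p)) ζ := by
  rw [cosT, ← integral_inner (integrable_cos_smul hf ζ)]
  simp [cosT, inner_smul_right]

theorem inner_sinT {f : W → F} (hf : Integrable f) (e : F) (ζ : W) :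
    inner ℝ e (sinT f ζ) = sinT (fun p => inner ℝ e (f p)) ζ := by
  rw [sinT, ← integral_inner (integrable_sin_smul hf ζ)]
  simp [sinT, inner_smul_right]

theorem continuous_cosT {f : W → F} (hf : Integrable f) : Continuous (cosT f) := by
  refine continuous_of_dominated (bound := fun p => ‖f p‖) (fun ζ =>
    (integrable_cos_smul hf ζ).1) (fun ζ => Eventually.of_forall fun p => ?_) hf.norm
    (Eventually.of_forall fun p => by fun_prop)
  rw [norm_smul]
  exact mul_le_of_le_one_left (norm_nonneg _) (Real.abs_cos_le_one _)

theorem continuous_sinT {f : W → F} (hf : Integrable f) : Continuous (sinT f) := by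
  refine continuous_of_dominated (bound := fun p => ‖f p‖) (fun ζ =>
    (integrable_sin_smul hf ζ).1) (fun ζ => Eventually.of_forall fun p => ?_) hf.norm
    (Eventually.of_forall fun p => by fun_prop)
  rw [norm_smul]
  exact mul_le_of_le_one_left (norm_nonneg _) (Real.abs_sin_le_one _)

theorem lintegral_cosT_sinT {f : W → F} (hf : Integrable f) (hf2 : MemLp f 2) :
    ∫⁻ ζ, (‖cosT f ζ‖ₑ ^ 2 + ‖sinT f ζ‖ₑ ^ 2) = ∫⁻ p, ‖f p‖ₑ ^ 2 := by
  set b := stdOrthonormalBasis ℝ F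
  have hi : ∀ i, Integrable fun p => inner ℝ (b i) (f p) := fun i => hf.const_inner (b i)
  have hi2 : ∀ i, MemLp (fun p => inner ℝ (b i) (f p)) 2 := fun i => hf2.const_inner (b i)
  have hm : ∀ i, Measurable fun ζ => ‖cosT (fun p => inner ℝ (b i) (f p)) ζ‖ₑ ^ 2
      + ‖sinT (fun p => inner ℝ (b i) (f p)) ζ‖ₑ ^ 2 := fun i =>
    ((continuous_cosT (hi i)).measurable.enorm.pow_const 2).add
      ((continuous_sinT (hi i)).measurable.enorm.pow_const 2)
  calc ∫⁻ ζ, (‖cosT f ζ‖ₑ ^ 2 + ‖sinT f ζ‖ₑ ^ 2)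
      = ∫⁻ ζ, ∑ i, (‖cosT (fun p => inner ℝ (b i) (f p)) ζ‖ₑ ^ 2
        + ‖sinT (fun p => inner ℝ (b i) (f p)) ζ‖ₑ ^ 2) := by
        refine lintegral_congr fun ζ => ?_
        rw [sq_enorm_eq_sum_inner b (cosT f ζ), sq_enorm_eq_sum_inner b (sinT f ζ),
          ← Finset.sum_add_distrib]
        simp only [inner_cosT hf, inner_sinT hf]
    _ = ∑ i, ∫⁻ p, ‖inner ℝ (b i) (f p)‖ₑ ^ 2 := by
        rw [lintegral_finsetSum _ fun i _ => hm i]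
        exact Finset.sum_congr rfl fun i _ => lintegral_cosT_sinT_real (hi i) (hi2 i)
    _ = ∫⁻ p, ‖f p‖ₑ ^ 2 := by
        rw [← lintegral_finsetSum' _ fun i _ => (hi i).1.enorm.pow_const 2]
        exact lintegral_congr fun p => (sq_enorm_eq_sum_inner b (f p)).symm

end PlancherelVector
end Kinetic

namespace Kinetic
open Filter Topology Metric

/-! ### Integrals of Gagliardo kernels. -/

section Kernels
variable {V : Type*} [NormedAddCommGroup V] [InnerProductSpace ℝ V] [FiniteDimensional ℝ V]
  [MeasurableSpace V] [BorelSpace V]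

theorem lintegral_sqrt_kernel_one_lt_top {s : ℝ} (hs : (Module.finrank ℝ V : ℝ) < s) :
    ∫⁻ w : V, ENNReal.ofReal ((√(1 + ‖w‖ ^ 2) ^ s)⁻¹) < ⊤ := by
  have h := (integrable_rpow_neg_one_add_norm_sq (E := V) (μ := volume) hs).lintegral_lt_top
  refine lt_of_le_of_lt (lintegral_mono fun w => ENNReal.ofReal_le_ofReal (le_of_eq ?_)) h
  rw [Real.sqrt_eq_rpow, ← Real.rpow_mul (by positivity), ← Real.rpow_neg (by positivity)]
  congr 1; ring

/-- By the scaling w = A w'. It integrates one group of variables out of a Gagliardo kernel and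
leaves the kernel of the same order in the other group. -/
theorem exists_lintegral_sqrt_kernel_le (V : Type*) [NormedAddCommGroup V] [InnerProductSpace ℝ V]
    [FiniteDimensional ℝ V] [MeasurableSpace V] [BorelSpace V] {s : ℝ}
    (hs : (Module.finrank ℝ V : ℝ) < s) :
    ∃ C : ℝ≥0, ∀ A : ℝ, 0 < A → ∫⁻ w : V, ENNReal.ofReal ((√(A ^ 2 + ‖w‖ ^ 2) ^ s)⁻¹)
      ≤ C * ENNReal.ofReal ((A ^ (s - Module.finrank ℝ V))⁻¹) := by
  have hfin := lintegral_sqrt_kernel_one_lt_top hs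
  refine ⟨(∫⁻ w : V, ENNReal.ofReal ((√(1 + ‖w‖ ^ 2) ^ s)⁻¹)).toNNReal, fun A hA => ?_⟩
  rw [ENNReal.coe_toNNReal hfin.ne]
  have hpt : ∀ w : V, ENNReal.ofReal ((√(A ^ 2 + ‖w‖ ^ 2) ^ s)⁻¹)
      = ENNReal.ofReal ((A ^ s)⁻¹) * ENNReal.ofReal ((√(1 + ‖A⁻¹ • w‖ ^ 2) ^ s)⁻¹) := by
    intro w
    rw [← ENNReal.ofReal_mul (by positivity), ← mul_inv, ← Real.mul_rpow hA.le (by positivity)]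
    congr 4
    rw [norm_smul, norm_inv, Real.norm_of_nonneg hA.le]
    nth_rewrite 2 [← Real.sqrt_sq hA.le]
    rw [← Real.sqrt_mul (by positivity)]
    congr 1
    field_simp
  simp only [hpt]
  rw [lintegral_const_mul' _ _ (by simp), lintegral_comp_inv_smul
    (F := fun w : V => ENNReal.ofReal ((√(1 + ‖w‖ ^ 2) ^ s)⁻¹)) (by fun_prop) hA, ← mul_assoc,
    ← ENNReal.ofReal_mul (by positivity), mul_comm]
  apply le_of_eq
  congr 2
  rw [Real.rpow_sub hA]
  field_simp

theorem lintegral_compl_ball_rpow_lt_top {s a : ℝ} (hs : (Module.finrank ℝ V : ℝ) < s)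
    (ha : 0 < a) : ∫⁻ w in (ball (0 : V) a)ᶜ, ENNReal.ofReal ((‖w‖ ^ s)⁻¹) < ⊤ := by
  have hs0 : 0 < s := lt_of_le_of_lt (Nat.cast_nonneg _) hs
  set c : ℝ := √(1 + (a ^ 2)⁻¹) with hc
  have hc0 : 0 < c := by positivity
  have hpt : ∀ w ∈ (ball (0 : V) a)ᶜ, ENNReal.ofReal ((‖w‖ ^ s)⁻¹) ≤
      ENNReal.ofReal (c ^ s) * ENNReal.ofReal ((√(1 + ‖w‖ ^ 2) ^ s)⁻¹) := by
    intro w hw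
    have hwa : a ≤ ‖w‖ := by simpa using hw
    have hw0 : 0 < ‖w‖ := ha.trans_le hwa
    rw [← ENNReal.ofReal_mul (by positivity)]
    refine ENNReal.ofReal_le_ofReal ?_
    rw [← div_eq_mul_inv, ← Real.div_rpow hc0.le (by positivity),
      ← Real.inv_rpow hw0.le]
    refine Real.rpow_le_rpow (by positivity) ?_ hs0.le
    rw [inv_eq_one_div, div_le_div_iff₀ hw0 (by positivity), one_mul, hc]
    nth_rewrite 2 [← Real.sqrt_sq hw0.le]
    rw [← Real.sqrt_mul (by positivity)]
    refine Real.sqrt_le_sqrt ?_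
    have h1 : 1 ≤ (a ^ 2)⁻¹ * ‖w‖ ^ 2 := by
      rw [inv_mul_eq_div, one_le_div (by positivity)]
      gcongr
    linarith
  refine lt_of_le_of_lt (setLIntegral_mono' measurableSet_ball.compl hpt) ?_
  rw [lintegral_const_mul' _ _ (by simp)]
  refine ENNReal.mul_lt_top (by simp) ?_
  exact lt_of_le_of_lt (lintegral_mono' Measure.restrict_le_self le_rfl)
    (lintegral_sqrt_kernel_one_lt_top hs)

theorem lintegral_ball_rpow_lt_top {s : ℝ} (hn : 1 ≤ Module.finrank ℝ V)
    (hs : s < Module.finrank ℝ V) :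
    ∫⁻ w in ball (0 : V) 1, ENNReal.ofReal (‖w‖ ^ (-s)) < ⊤ := by
  have h : IntegrableOn (fun w : V => ‖w‖ ^ (-s)) (ball 0 1) := by
    refine integrableOn_ball_of_norm_le_rpow hn (C := 1) hs (Eventually.of_forall fun w => ?_) ?_
    · rw [one_mul, Real.norm_of_nonneg (by positivity)]
    · exact Measurable.aestronglyMeasurable (by fun_prop)
  exact h.lintegral_lt_top

theorem norm_fourierChar_sub_one_le (s : ℝ) :
    ‖(Real.fourierChar s : ℂ) - 1‖ ≤ min 2 (2 * Real.pi * |s|) := by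
  refine le_min ?_ ?_
  · refine (norm_sub_le _ _).trans ?_
    rw [Circle.norm_coe, norm_one]; norm_num
  · rw [Real.fourierChar_apply]
    have := Real.norm_exp_I_mul_ofReal_sub_one_le (x := 2 * Real.pi * s)
    rw [mul_comm Complex.I] at this
    refine this.trans (le_of_eq ?_)
    rw [norm_mul, norm_mul]
    simp [abs_of_pos Real.pi_pos]

/-- By scaling k with |ζ|, the integral is at most |ζ|^(2γ) times that of a fixed radial function.
Its convergence at the origin uses γ < 1, where the character differs from 1 by O(|k|), and its
convergence at infinity uses γ > 0. -/
theorem exists_lintegral_fourierChar_kernel_le (V : Type*) [NormedAddCommGroup V]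
    [InnerProductSpace ℝ V] [FiniteDimensional ℝ V] [MeasurableSpace V] [BorelSpace V] {γ : ℝ}
    (hn : 1 ≤ Module.finrank ℝ V) (hγ : 0 < γ) (hγ1 : γ < 1) :
    ∃ C : ℝ≥0, ∀ ζ : V, ∫⁻ k : V, ENNReal.ofReal ((‖k‖ ^ (Module.finrank ℝ V + 2 * γ))⁻¹) *
      ‖(Real.fourierChar (inner ℝ k ζ) : ℂ) - 1‖ₑ ^ 2 ≤ C * ENNReal.ofReal (‖ζ‖ ^ (2 * γ)) := by
  set n : ℝ := (Module.finrank ℝ V : ℝ) with hnd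
  set G : V → ℝ≥0∞ := fun z => ENNReal.ofReal ((‖z‖ ^ (n + 2 * γ))⁻¹) *
    ENNReal.ofReal ((min 2 (2 * Real.pi * ‖z‖)) ^ 2) with hG
  have hGm : Measurable G := by fun_prop
  have hfin : ∫⁻ z, G z < ⊤ := by
    rw [← lintegral_add_compl G (measurableSet_ball (x := (0 : V)) (ε := 1))]
    refine ENNReal.add_lt_top.2 ⟨?_, ?_⟩
    · have h1 : ∀ z, G z ≤ ENNReal.ofReal ((2 * Real.pi) ^ 2) *
          ENNReal.ofReal (‖z‖ ^ (-(n - 2 + 2 * γ))) := by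
        intro z
        simp only [hG]
        rw [← ENNReal.ofReal_mul (by positivity), ← ENNReal.ofReal_mul (by positivity)]
        refine ENNReal.ofReal_le_ofReal ?_
        rcases eq_or_ne z 0 with rfl | hz
        · simp; positivity
        have hz0 : 0 < ‖z‖ := norm_pos_iff.2 hz
        calc (‖z‖ ^ (n + 2 * γ))⁻¹ * min 2 (2 * Real.pi * ‖z‖) ^ 2
            ≤ (‖z‖ ^ (n + 2 * γ))⁻¹ * (2 * Real.pi * ‖z‖) ^ 2 := by
              gcongr
              exact min_le_right _ _
          _ = _ := by
              rw [← Real.rpow_neg hz0.le, mul_pow, mul_left_comm, ← Real.rpow_natCast ‖z‖ 2,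
                ← Real.rpow_add hz0]
              congr 2
              push_cast
              ring
      refine lt_of_le_of_lt (lintegral_mono h1) ?_
      rw [lintegral_const_mul' _ _ (by simp)]
      exact ENNReal.mul_lt_top (by simp) (lintegral_ball_rpow_lt_top hn (by linarith))
    · have h1 : ∀ z, G z ≤ ENNReal.ofReal (2 ^ 2) * ENNReal.ofReal ((‖z‖ ^ (n + 2 * γ))⁻¹) := by
        intro z
        simp only [hG]
        rw [mul_comm]
        gcongr
        exact min_le_left _ _
      refine lt_of_le_of_lt (lintegral_mono h1) ?_
      rw [lintegral_const_mul' _ _ (by simp)]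
      exact ENNReal.mul_lt_top (by simp)
        (lintegral_compl_ball_rpow_lt_top (by linarith) one_pos)
  refine ⟨(∫⁻ z, G z).toNNReal, fun ζ => ?_⟩
  rw [ENNReal.coe_toNNReal hfin.ne]
  rcases eq_or_ne ζ 0 with rfl | hζ
  · simp
  have hζ0 : 0 < ‖ζ‖ := norm_pos_iff.2 hζ
  have hpt : ∀ k : V, ENNReal.ofReal ((‖k‖ ^ (n + 2 * γ))⁻¹) *
      ‖(Real.fourierChar (inner ℝ k ζ) : ℂ) - 1‖ₑ ^ 2
      ≤ ENNReal.ofReal (‖ζ‖ ^ (n + 2 * γ)) * G ((‖ζ‖⁻¹)⁻¹ • k) := by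
    intro k
    rw [hG, ← mul_assoc, ← ENNReal.ofReal_mul (by positivity), inv_inv]
    refine mul_le_mul' (le_of_eq ?_) ?_
    · rw [norm_smul, norm_norm, Real.mul_rpow hζ0.le (norm_nonneg _)]
      congr 1
      field_simp
    · rw [← ofReal_norm, ← ENNReal.ofReal_pow (norm_nonneg _)]
      refine ENNReal.ofReal_le_ofReal ?_
      gcongr
      refine (norm_fourierChar_sub_one_le _).trans ?_
      gcongr
      rw [norm_smul, norm_norm, mul_comm]
      exact abs_real_inner_le_norm k ζ
  refine (lintegral_mono hpt).trans ?_
  rw [lintegral_const_mul' _ _ (by simp), lintegral_comp_inv_smul hGm (inv_pos.2 hζ0), ← mul_assoc,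
    ← ENNReal.ofReal_mul (by positivity), mul_comm]
  apply le_of_eq
  congr 2
  rw [Real.inv_rpow hζ0.le, Real.rpow_add hζ0, ← hnd]
  field_simp

/-- On the dyadic shell |v - w| ≈ ε₀ 2^(-j) the kernel of order γ times the increment bound of order
δ is a constant times 2^(-2(δ-γ)j) N, which is summable as γ < δ. Pairs at distance at least ε₀ are
controlled by the L² norm alone. -/
theorem exists_gagliardo_le_of_incrementBound (V : Type*) [NormedAddCommGroup V]
    [InnerProductSpace ℝ V] [FiniteDimensional ℝ V] [MeasurableSpace V] [BorelSpace V]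
    {γ δ ε₀ : ℝ} (hγ : 0 < γ) (hγδ : γ < δ) (hε₀ : 0 < ε₀) :
    ∃ C : ℝ≥0, ∀ (r : ℝ) (u : V → ℝ) (N : ℝ≥0∞), Measurable u → IncrementBound δ r ε₀ u N →
      ∫⁻ v in ball 0 r, ∫⁻ w in ball 0 r,
        ENNReal.ofReal ((‖v - w‖ ^ (Module.finrank ℝ V + 2 * γ))⁻¹) * ‖u v - u w‖ₑ ^ 2
        ≤ C * (N + ∫⁻ v in ball 0 r, ‖u v‖ₑ ^ 2) := by
  set n : ℝ := (Module.finrank ℝ V : ℝ) with hnd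
  have hn0 : 0 ≤ n := Nat.cast_nonneg _
  set c₁ : ℝ≥0∞ := ∫⁻ w in (ball (0 : V) ε₀)ᶜ, ENNReal.ofReal ((‖w‖ ^ (n + 2 * γ))⁻¹) with hc₁
  have hc₁fin : c₁ < ⊤ := lintegral_compl_ball_rpow_lt_top (by linarith) hε₀
  set e : ℕ → ℝ := fun j => ε₀ * (2⁻¹) ^ j with he
  have he0 : ∀ j, 0 < e j := fun j => by positivity
  -- The kernel on the shell e (j+1) ≤ |v - w| < e j is largest at the inner radius, hence the index
  -- j + 1.
  set a : ℕ → ℝ≥0∞ := fun j => ENNReal.ofReal ((e (j + 1) ^ (n + 2 * γ))⁻¹) with ha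
  set c₂ : ℝ≥0∞ := ∑' j, a j * ENNReal.ofReal (e j ^ (n + 2 * δ)) with hc₂
  have hc₂fin : c₂ < ⊤ := by
    set b : ℝ := 2⁻¹ ^ (2 * (δ - γ)) with hb
    have hb0 : 0 ≤ b := by positivity
    have hb1 : b < 1 := Real.rpow_lt_one (by norm_num) (by norm_num) (by linarith)
    have hterm : ∀ j, a j * ENNReal.ofReal (e j ^ (n + 2 * δ))
        = ENNReal.ofReal (2 ^ (n + 2 * γ) * ε₀ ^ (2 * (δ - γ)) * b ^ j) := by
      intro j
      rw [ha, ← ENNReal.ofReal_mul (by positivity)]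
      congr 1
      have h1 : e (j + 1) = 2⁻¹ * e j := by simp only [he, pow_succ]; ring
      have h2 : b ^ j = (2⁻¹ ^ j) ^ (2 * (δ - γ)) := by
        rw [hb, ← Real.rpow_natCast, ← Real.rpow_natCast, ← Real.rpow_mul (by norm_num),
          ← Real.rpow_mul (by norm_num)]
        ring_nf
      rw [h1, Real.mul_rpow (by norm_num) (he0 j).le, mul_inv, ← Real.rpow_neg (by norm_num),
        Real.inv_rpow (by norm_num), Real.rpow_neg (by norm_num), inv_inv, mul_assoc,
        ← Real.rpow_neg (he0 j).le, ← Real.rpow_add (he0 j), h2, mul_assoc,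
        ← Real.mul_rpow hε₀.le (by positivity)]
      congr 2
      ring
    rw [hc₂]
    simp only [hterm]
    rw [← ENNReal.ofReal_tsum_of_nonneg (fun j => by positivity)
      ((summable_geometric_of_lt_one hb0 hb1).mul_left _)]
    simp
  refine ⟨c₂.toNNReal + 4 * c₁.toNNReal, fun r u N hu hN => ?_⟩
  set κ : V → ℝ≥0∞ := (ball (0 : V) ε₀)ᶜ.indicator fun w =>
    ENNReal.ofReal ((‖w‖ ^ (n + 2 * γ))⁻¹) with hκ
  have hκm : Measurable κ := Measurable.indicator (by fun_prop) measurableSet_ball.compl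
  have hκi : ∫⁻ w, κ w = c₁ := lintegral_indicator measurableSet_ball.compl _
  have hpt : ∀ v w, ENNReal.ofReal ((‖v - w‖ ^ (n + 2 * γ))⁻¹) * ‖u v - u w‖ₑ ^ 2
      ≤ (∑' j, a j * (ball v (e j)).indicator (fun w => ‖u v - u w‖ₑ ^ 2) w)
        + κ (v - w) * (2 * ‖u v‖ₑ ^ 2 + 2 * ‖u w‖ₑ ^ 2) := by
    intro v w
    rcases eq_or_ne v w with rfl | hne
    · simp
    have h0 : 0 < ‖v - w‖ := norm_sub_pos_iff.2 hne
    by_cases hd : ‖v - w‖ < ε₀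
    · refine le_add_right ?_
      have hex : ∃ j, e j ≤ ‖v - w‖ := by
        obtain ⟨j, hj⟩ := exists_pow_lt_of_lt_one (div_pos h0 hε₀) (by norm_num : (2⁻¹ : ℝ) < 1)
        exact ⟨j, by rw [lt_div_iff₀ hε₀] at hj; simp only [he]; linarith⟩
      classical
      -- The least index is not 0, because e 0 = ε₀ exceeds |v - w|.
      obtain ⟨i, hi⟩ : ∃ i, Nat.find hex = i + 1 := by
        refine Nat.exists_eq_succ_of_ne_zero fun h => ?_
        have := Nat.find_spec hex
        rw [h] at this
        simp only [he, pow_zero, mul_one] at this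
        linarith
      have h1 : e (i + 1) ≤ ‖v - w‖ := hi ▸ Nat.find_spec hex
      have h2 : ‖v - w‖ < e i := not_le.1 (Nat.find_min hex (by omega : i < Nat.find hex))
      refine le_trans ?_ (ENNReal.le_tsum i)
      have hmem : w ∈ ball v (e i) := by rwa [mem_ball, dist_comm, dist_eq_norm]
      rw [indicator_of_mem hmem]
      gcongr
      refine ENNReal.ofReal_le_ofReal ?_
      have := he0 (i + 1)
      gcongr
    · refine le_add_left ?_
      have hmem : v - w ∈ (ball (0 : V) ε₀)ᶜ := by simpa using hd
      rw [hκ, indicator_of_mem hmem]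
      gcongr
      simpa [mul_add] using enorm_sub_sq_le (u v) (u w)
  have hus : Measurable fun v => ‖u v‖ₑ ^ 2 := by fun_prop
  have humv : ∀ v, Measurable fun w => ‖u v - u w‖ₑ ^ 2 := fun v => by fun_prop
  have hI : ∀ j, Measurable fun v => ∫⁻ w in ball 0 r,
      (ball v (e j)).indicator (fun w => ‖u v - u w‖ₑ ^ 2) w := by
    intro j
    refine Measurable.lintegral_prod_right' (f := fun p : V × V =>
      (ball p.1 (e j)).indicator (fun w => ‖u p.1 - u w‖ₑ ^ 2) p.2) ?_
    have : (fun p : V × V => (ball p.1 (e j)).indicator (fun w => ‖u p.1 - u w‖ₑ ^ 2) p.2)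
        = {p : V × V | dist p.2 p.1 < e j}.indicator fun p => ‖u p.1 - u p.2‖ₑ ^ 2 := by
      ext p
      by_cases h : dist p.2 p.1 < e j <;> simp [indicator, h]
    rw [this]
    exact Measurable.indicator (by fun_prop) (measurableSet_lt (by fun_prop) measurable_const)
  have hA : ∫⁻ v in ball 0 r, ∫⁻ w in ball 0 r,
      (∑' j, a j * (ball v (e j)).indicator (fun w => ‖u v - u w‖ₑ ^ 2) w) ≤ c₂ * N := by
    calc _ = ∑' j, a j * ∫⁻ v in ball 0 r, ∫⁻ w in ball 0 r,
          (ball v (e j)).indicator (fun w => ‖u v - u w‖ₑ ^ 2) w := by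
          have h1 : ∀ v, ∫⁻ w in ball 0 r,
              (∑' j, a j * (ball v (e j)).indicator (fun w => ‖u v - u w‖ₑ ^ 2) w)
              = ∑' j, a j * ∫⁻ w in ball 0 r,
                (ball v (e j)).indicator (fun w => ‖u v - u w‖ₑ ^ 2) w := by
            intro v
            rw [lintegral_tsum fun j =>
              (((humv v).indicator measurableSet_ball).const_mul _).aemeasurable]
            exact tsum_congr fun j => lintegral_const_mul _ ((humv v).indicator measurableSet_ball)
          simp only [h1]
          rw [lintegral_tsum fun j => ((hI j).const_mul _).aemeasurable]
          exact tsum_congr fun j => lintegral_const_mul _ (hI j)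
      _ ≤ ∑' j, a j * (ENNReal.ofReal (e j ^ (n + 2 * δ)) * N) := by
          refine ENNReal.tsum_le_tsum fun j => mul_le_mul_right (le_trans ?_ (hN (e j) (he0 j) ?_)) _
          · refine lintegral_mono fun v => ?_
            rw [← lintegral_indicator (s := ball v (e j)) measurableSet_ball]
            exact lintegral_mono' Measure.restrict_le_self le_rfl
          · exact mul_le_of_le_one_right hε₀.le (pow_le_one₀ (by norm_num) (by norm_num))
      _ = c₂ * N := by
          simp only [← mul_assoc]
          rw [ENNReal.tsum_mul_right]
  set S := ∫⁻ v in ball 0 r, ‖u v‖ₑ ^ 2 with hS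
  have hB1 : ∫⁻ v in ball 0 r, ∫⁻ w in ball 0 r, κ (v - w) * ‖u w‖ₑ ^ 2 ≤ c₁ * S :=
    (lintegral_lintegral_kernel_le hκm hus _ _).trans_eq (by rw [hκi])
  have hB2 : ∫⁻ v in ball 0 r, ∫⁻ w in ball 0 r, κ (v - w) * ‖u v‖ₑ ^ 2 ≤ c₁ * S := by
    rw [hS, ← lintegral_const_mul _ hus]
    refine lintegral_mono fun v => ?_
    rw [lintegral_mul_const _ (by fun_prop)]
    gcongr
    rw [← hκi, ← lintegral_sub_left_eq_self κ v]
    exact lintegral_mono' Measure.restrict_le_self le_rfl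
  have hB : ∫⁻ v in ball 0 r, ∫⁻ w in ball 0 r,
      κ (v - w) * (2 * ‖u v‖ₑ ^ 2 + 2 * ‖u w‖ₑ ^ 2) ≤ 4 * c₁ * S := by
    have h1 : ∀ v, ∫⁻ w in ball 0 r, κ (v - w) * (2 * ‖u v‖ₑ ^ 2 + 2 * ‖u w‖ₑ ^ 2)
        = 2 * (∫⁻ w in ball 0 r, κ (v - w) * ‖u v‖ₑ ^ 2)
          + 2 * ∫⁻ w in ball 0 r, κ (v - w) * ‖u w‖ₑ ^ 2 := by
      intro v
      rw [← lintegral_const_mul _ (by fun_prop), ← lintegral_const_mul _ (by fun_prop),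
        ← lintegral_add_left (by fun_prop)]
      exact lintegral_congr fun w => by ring
    simp only [h1]
    have hm : Measurable fun v => ∫⁻ w in ball 0 r, κ (v - w) * ‖u v‖ₑ ^ 2 :=
      Measurable.lintegral_prod_right' (f := fun p : V × V => κ (p.1 - p.2) * ‖u p.1‖ₑ ^ 2)
        (by fun_prop)
    have hm' : Measurable fun v => ∫⁻ w in ball 0 r, κ (v - w) * ‖u w‖ₑ ^ 2 :=
      Measurable.lintegral_prod_right' (f := fun p : V × V => κ (p.1 - p.2) * ‖u p.2‖ₑ ^ 2)
        (by fun_prop)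
    rw [lintegral_add_left (hm.const_mul 2), lintegral_const_mul _ hm, lintegral_const_mul _ hm']
    calc _ ≤ 2 * (c₁ * S) + 2 * (c₁ * S) := by gcongr
      _ = _ := by ring
  have hmA : ∀ v, Measurable fun w =>
      ∑' j, a j * (ball v (e j)).indicator (fun w => ‖u v - u w‖ₑ ^ 2) w := fun v =>
    Measurable.tsum fun j => ((humv v).indicator measurableSet_ball).const_mul _
  calc _ ≤ ∫⁻ v in ball 0 r, ∫⁻ w in ball 0 r,
      ((∑' j, a j * (ball v (e j)).indicator (fun w => ‖u v - u w‖ₑ ^ 2) w)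
        + κ (v - w) * (2 * ‖u v‖ₑ ^ 2 + 2 * ‖u w‖ₑ ^ 2)) :=
        lintegral_mono fun v => lintegral_mono fun w => hpt v w
    _ = (∫⁻ v in ball 0 r, ∫⁻ w in ball 0 r,
        (∑' j, a j * (ball v (e j)).indicator (fun w => ‖u v - u w‖ₑ ^ 2) w))
        + ∫⁻ v in ball 0 r, ∫⁻ w in ball 0 r,
          κ (v - w) * (2 * ‖u v‖ₑ ^ 2 + 2 * ‖u w‖ₑ ^ 2) := by
        rw [← lintegral_add_right _ (Measurable.lintegral_prod_right' (f := fun p : V × V =>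
          κ (p.1 - p.2) * (2 * ‖u p.1‖ₑ ^ 2 + 2 * ‖u p.2‖ₑ ^ 2)) (by fun_prop))]
        exact lintegral_congr fun v => lintegral_add_left (hmA v) _
    _ ≤ c₂ * N + 4 * c₁ * S := add_le_add hA hB
    _ ≤ c₂ * (N + S) + 4 * c₁ * (N + S) := by
        gcongr
        · exact le_self_add
        · exact le_add_self
    _ = _ := by
        push_cast
        rw [ENNReal.coe_toNNReal hc₁fin.ne, ENNReal.coe_toNNReal hc₂fin.ne]
        ring

end Kernels
end Kinetic

namespace Kinetic
open Filter Topology Metric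

/-! ### Gagliardo seminorms on the Fourier side and on products. -/

section ProductGagliardo

/-- With q = p + k and k fixed, Plancherel turns the increment into a factor |character - 1|²;
integrating that factor against the kernel in k yields |ζ|^(2γ). -/
theorem exists_gagliardo_le_fourier (W : Type*) [NormedAddCommGroup W]
    [InnerProductSpace ℝ W] [FiniteDimensional ℝ W] [MeasurableSpace W] [BorelSpace W] {γ : ℝ}
    (hn : 1 ≤ Module.finrank ℝ W) (hγ : 0 < γ) (hγ1 : γ < 1) :
    ∃ C : ℝ≥0, ∀ f : W → ℝ, Measurable f → Integrable f → MemLp f 2 →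
      ∫⁻ p, ∫⁻ q, ENNReal.ofReal ((‖p - q‖ ^ (Module.finrank ℝ W + 2 * γ))⁻¹) * ‖f p - f q‖ₑ ^ 2
      ≤ C * ∫⁻ ζ, ENNReal.ofReal (‖ζ‖ ^ (2 * γ)) * (‖cosT f ζ‖ₑ ^ 2 + ‖sinT f ζ‖ₑ ^ 2) := by
  obtain ⟨C, hC⟩ := exists_lintegral_fourierChar_kernel_le W hn hγ hγ1
  refine ⟨C, fun f hfm hf hf2 => ?_⟩
  set κ : W → ℝ≥0∞ := fun k => ENNReal.ofReal ((‖k‖ ^ (Module.finrank ℝ W + 2 * γ))⁻¹) with hκ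
  have hκm : Measurable κ := by fun_prop
  set U : W → ℝ≥0∞ := fun ζ => ‖cosT f ζ‖ₑ ^ 2 + ‖sinT f ζ‖ₑ ^ 2 with hU
  have hUm : Measurable U := ((continuous_cosT hf).measurable.enorm.pow_const 2).add
    ((continuous_sinT hf).measurable.enorm.pow_const 2)
  calc ∫⁻ p, ∫⁻ q, κ (p - q) * ‖f p - f q‖ₑ ^ 2
      = ∫⁻ p, ∫⁻ k, κ k * ‖f (p + k) - f p‖ₑ ^ 2 := by
        refine lintegral_congr fun p => ?_
        rw [← lintegral_add_left_eq_self _ p]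
        refine lintegral_congr fun k => ?_
        rw [enorm_sub_rev, hκ]
        simp
    _ = ∫⁻ k, ∫⁻ p, κ k * ‖f (p + k) - f p‖ₑ ^ 2 :=
        lintegral_lintegral_swap (Measurable.aemeasurable (by fun_prop))
    _ = ∫⁻ k, ∫⁻ ζ, κ k * (‖(Real.fourierChar (inner ℝ k ζ) : ℂ) - 1‖ₑ ^ 2 * U ζ) := by
        refine lintegral_congr fun k => ?_
        have hk : Integrable fun p => f (p + k) := hf.comp_add_right k
        have hk2 : MemLp (fun p => f (p + k)) 2 :=
          hf2.comp_measurePreserving (measurePreserving_add_right volume k)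
        have hi : Integrable fun p => f (p + k) - f p := hk.sub hf
        have hi2 : MemLp (fun p => f (p + k) - f p) 2 := hk2.sub hf2
        rw [lintegral_const_mul' _ _ (by simp [hκ]), lintegral_const_mul' _ _ (by simp [hκ]),
          ← lintegral_cosT_sinT_real hi hi2]
        simp only [sq_enorm_cosT_add_sinT_translate hf, hU]
    _ = ∫⁻ ζ, ∫⁻ k, κ k * (‖(Real.fourierChar (inner ℝ k ζ) : ℂ) - 1‖ₑ ^ 2 * U ζ) := by
        refine lintegral_lintegral_swap (Measurable.aemeasurable ?_)
        refine (hκm.comp measurable_fst).mul (Measurable.mul ?_ (hUm.comp measurable_snd))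
        refine Measurable.pow_const (Measurable.enorm (Continuous.measurable ?_)) 2
        have := Real.continuous_fourierChar
        fun_prop
    _ ≤ ∫⁻ ζ, C * (ENNReal.ofReal (‖ζ‖ ^ (2 * γ)) * U ζ) := by
        refine lintegral_mono fun ζ => ?_
        have hm : Measurable fun k => κ k * ‖(Real.fourierChar (inner ℝ k ζ) : ℂ) - 1‖ₑ ^ 2 :=
          hκm.mul (Measurable.pow_const (Measurable.enorm
            (Continuous.measurable (by have := Real.continuous_fourierChar; fun_prop))) 2)
        have h1 := lintegral_mul_const (μ := volume) (U ζ) hm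
        simp only [mul_assoc] at h1
        rw [h1, ← mul_assoc]
        gcongr
        exact hC ζ
    _ = _ := lintegral_const_mul' _ _ (by simp)

/-- Between y and z one inserts (z.1, y.2), which stays in W × B. Each resulting difference involves
one variable only, and the coordinate that does not enter it is integrated out of the kernel by
`exists_lintegral_sqrt_kernel_le`. -/
theorem exists_product_gagliardo_le (W V : Type*) [NormedAddCommGroup W]
    [InnerProductSpace ℝ W] [FiniteDimensional ℝ W] [MeasurableSpace W] [BorelSpace W]
    [NormedAddCommGroup V] [InnerProductSpace ℝ V] [FiniteDimensional ℝ V] [MeasurableSpace V]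
    [BorelSpace V] {γ : ℝ} (hγ : 0 < γ) :
    ∃ C : ℝ≥0, ∀ (H : W × V → ℝ) (B : Set V), Measurable H →
      ∫⁻ y, ∫⁻ z, ENNReal.ofReal ((√(‖y.1 - z.1‖ ^ 2 + ‖y.2 - z.2‖ ^ 2)
          ^ ((Module.finrank ℝ W + Module.finrank ℝ V : ℝ) + 2 * γ))⁻¹) * ‖H y - H z‖ₑ ^ 2
          ∂(volume.prod (volume.restrict B)) ∂((volume : Measure W).prod (volume.restrict B)) ≤
      C * ((∫⁻ v in B, ∫⁻ p, ∫⁻ q,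
          ENNReal.ofReal ((‖p - q‖ ^ (Module.finrank ℝ W + 2 * γ))⁻¹) * ‖H (p, v) - H (q, v)‖ₑ ^ 2)
        + ∫⁻ v in B, ∫⁻ w in B, ENNReal.ofReal ((‖v - w‖ ^ (Module.finrank ℝ V + 2 * γ))⁻¹) *
          ∫⁻ q, ‖H (q, v) - H (q, w)‖ₑ ^ 2) := by
  set n : ℝ := (Module.finrank ℝ W : ℝ) with hn
  set d : ℝ := (Module.finrank ℝ V : ℝ) with hd
  have hn0 : 0 ≤ n := Nat.cast_nonneg _
  have hd0 : 0 ≤ d := Nat.cast_nonneg _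
  obtain ⟨C₁, hC₁⟩ := exists_lintegral_sqrt_kernel_le V (s := n + d + 2 * γ) (by linarith)
  obtain ⟨C₂, hC₂⟩ := exists_lintegral_sqrt_kernel_le W (s := n + d + 2 * γ) (by linarith)
  refine ⟨2 * C₁ + 2 * C₂, fun H B hH => ?_⟩
  set ν : Measure V := volume.restrict B with hν
  set κ : W × V → W × V → ℝ≥0∞ := fun y z => ENNReal.ofReal
    ((√(‖y.1 - z.1‖ ^ 2 + ‖y.2 - z.2‖ ^ 2) ^ (n + d + 2 * γ))⁻¹) with hκ
  have hκm : Measurable fun x : (W × V) × (W × V) => κ x.1 x.2 := by fun_prop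
  set I₁ := ∫⁻ v in B, ∫⁻ p, ∫⁻ q,
    ENNReal.ofReal ((‖p - q‖ ^ (n + 2 * γ))⁻¹) * ‖H (p, v) - H (q, v)‖ₑ ^ 2 with hI₁
  set I₂ := ∫⁻ v in B, ∫⁻ w in B, ENNReal.ofReal ((‖v - w‖ ^ (d + 2 * γ))⁻¹) *
    ∫⁻ q, ‖H (q, v) - H (q, w)‖ₑ ^ 2 with hI₂
  have hA : ∫⁻ y, ∫⁻ z, κ y z * ‖H y - H (z.1, y.2)‖ₑ ^ 2 ∂(volume.prod ν)
      ∂((volume : Measure W).prod ν) ≤ C₁ * I₁ := by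
    calc _ ≤ ∫⁻ y, ∫⁻ q, C₁ * (ENNReal.ofReal ((‖y.1 - q‖ ^ (n + 2 * γ))⁻¹) *
          ‖H y - H (q, y.2)‖ₑ ^ 2) ∂volume ∂((volume : Measure W).prod ν) := by
          refine lintegral_mono fun y => ?_
          rw [lintegral_prod _ (Measurable.aemeasurable (by fun_prop))]
          refine lintegral_mono fun q => ?_
          rcases eq_or_ne y.1 q with rfl | hne
          · simp
          simp only
          rw [lintegral_mul_const _ (by fun_prop), ← mul_assoc]
          gcongr
          have h := hC₁ ‖y.1 - q‖ (norm_sub_pos_iff.2 hne)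
          rw [show n + d + 2 * γ - d = n + 2 * γ by ring] at h
          refine le_trans ?_ h
          rw [← lintegral_sub_left_eq_self (fun w : V =>
            ENNReal.ofReal ((√(‖y.1 - q‖ ^ 2 + ‖w‖ ^ 2) ^ (n + d + 2 * γ))⁻¹)) y.2]
          exact lintegral_mono' Measure.restrict_le_self le_rfl
      _ = ∫⁻ v in B, ∫⁻ p, C₁ * ∫⁻ q, (ENNReal.ofReal ((‖p - q‖ ^ (n + 2 * γ))⁻¹) *
          ‖H (p, v) - H (q, v)‖ₑ ^ 2) := by
          rw [lintegral_prod_symm _ (Measurable.aemeasurable (by fun_prop))]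
          refine lintegral_congr fun v => lintegral_congr fun p => ?_
          rw [lintegral_const_mul' _ _ (by simp)]
      _ = _ := by
          rw [hI₁, ← lintegral_const_mul' _ _ (by simp)]
          exact lintegral_congr fun v => lintegral_const_mul' _ _ (by simp)
  have hB : ∫⁻ y, ∫⁻ z, κ y z * ‖H (z.1, y.2) - H z‖ₑ ^ 2 ∂(volume.prod ν)
      ∂((volume : Measure W).prod ν) ≤ C₂ * I₂ := by
    rw [lintegral_prod_symm _ (Measurable.aemeasurable (by fun_prop)), hI₂,
      ← lintegral_const_mul' _ _ (by simp)]
    refine lintegral_mono fun v => ?_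
    simp only
    rw [lintegral_lintegral_swap (Measurable.aemeasurable (by fun_prop))]
    calc _ ≤ ∫⁻ z, C₂ * (ENNReal.ofReal ((‖v - z.2‖ ^ (d + 2 * γ))⁻¹) *
          ‖H (z.1, v) - H z‖ₑ ^ 2) ∂((volume : Measure W).prod ν) := by
          refine lintegral_mono fun z => ?_
          rcases eq_or_ne v z.2 with rfl | hne
          · simp
          simp only
          rw [lintegral_mul_const _ (by fun_prop), ← mul_assoc]
          gcongr
          have h := hC₂ ‖v - z.2‖ (norm_sub_pos_iff.2 hne)
          rw [show n + d + 2 * γ - n = d + 2 * γ by ring] at h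
          refine le_trans (le_of_eq ?_) h
          rw [← lintegral_sub_right_eq_self (fun w : W =>
            ENNReal.ofReal ((√(‖v - z.2‖ ^ 2 + ‖w‖ ^ 2) ^ (n + d + 2 * γ))⁻¹)) z.1]
          refine lintegral_congr fun p => ?_
          simp only [hκ]
          rw [add_comm]
      _ = _ := by
          rw [lintegral_prod_symm _ (Measurable.aemeasurable (by fun_prop)),
            ← lintegral_const_mul' _ _ (by simp)]
          refine lintegral_congr fun w => ?_
          simp only
          rw [lintegral_const_mul' _ _ (by simp), lintegral_const_mul' _ _ (by simp)]
  calc _ ≤ ∫⁻ y, ∫⁻ z, (2 * (κ y z * ‖H y - H (z.1, y.2)‖ₑ ^ 2)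
        + 2 * (κ y z * ‖H (z.1, y.2) - H z‖ₑ ^ 2)) ∂(volume.prod ν)
        ∂((volume : Measure W).prod ν) := by
        refine lintegral_mono fun y => lintegral_mono fun z => ?_
        simp only
        have h := enorm_add_sq_le (H y - H (z.1, y.2)) (H (z.1, y.2) - H z)
        rw [sub_add_sub_cancel] at h
        calc _ ≤ κ y z * (2 * (‖H y - H (z.1, y.2)‖ₑ ^ 2 + ‖H (z.1, y.2) - H z‖ₑ ^ 2)) := by
              gcongr
          _ = _ := by ring
    _ ≤ 2 * (C₁ * I₁) + 2 * (C₂ * I₂) := by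
        have h1 : ∀ y : W × V, ∫⁻ z, (2 * (κ y z * ‖H y - H (z.1, y.2)‖ₑ ^ 2)
            + 2 * (κ y z * ‖H (z.1, y.2) - H z‖ₑ ^ 2)) ∂(volume.prod ν)
            = 2 * (∫⁻ z, κ y z * ‖H y - H (z.1, y.2)‖ₑ ^ 2 ∂(volume.prod ν))
              + 2 * ∫⁻ z, κ y z * ‖H (z.1, y.2) - H z‖ₑ ^ 2 ∂(volume.prod ν) := by
          intro y
          rw [lintegral_add_left (by fun_prop), lintegral_const_mul' _ _ (by simp),
            lintegral_const_mul' _ _ (by simp)]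
        simp only [h1]
        have hm : Measurable fun y : W × V =>
            ∫⁻ z, κ y z * ‖H y - H (z.1, y.2)‖ₑ ^ 2 ∂((volume : Measure W).prod ν) :=
          Measurable.lintegral_prod_right' (f := fun x : (W × V) × (W × V) =>
            κ x.1 x.2 * ‖H x.1 - H (x.2.1, x.1.2)‖ₑ ^ 2) (by fun_prop)
        rw [lintegral_add_left (hm.const_mul 2), lintegral_const_mul' _ _ (by simp),
          lintegral_const_mul' _ _ (by simp)]
        gcongr
    _ ≤ 2 * C₁ * (I₁ + I₂) + 2 * C₂ * (I₁ + I₂) := by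
        rw [← mul_assoc, ← mul_assoc]
        gcongr
        · exact le_self_add
        · exact le_add_self
    _ = _ := by push_cast; ring

end ProductGagliardo
end Kinetic

namespace Kinetic
open Filter Topology Metric

/-! ### Fourier transform in p of functions on W × B_R with bounded support in p. -/

section Slices
variable {W : Type*} [NormedAddCommGroup W] [InnerProductSpace ℝ W] [FiniteDimensional ℝ W]
  [MeasurableSpace W] [BorelSpace W]
variable {V : Type*} [NormedAddCommGroup V] [InnerProductSpace ℝ V] [FiniteDimensional ℝ V]
  [MeasurableSpace V] [BorelSpace V]
variable {F : Type*} [NormedAddCommGroup F] [InnerProductSpace ℝ F] [FiniteDimensional ℝ F]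

/-- `G ∈ L²(W × B_R)` is measurable, with support in `{‖p‖ ≤ S} × V`. -/
structure IsSlabL2 (R S : ℝ) (G : W × V → F) : Prop where
  meas : StronglyMeasurable G
  memLp : MemLp G 2 ((volume : Measure W).prod (volume.restrict (ball (0 : V) R)))
  supp : ∀ z, S < ‖z.1‖ → G z = 0

variable {R S : ℝ} {G : W × V → F}

theorem IsSlabL2.lintegral_lt_top (hG : IsSlabL2 R S G) :
    ∫⁻ z, ‖G z‖ₑ ^ 2 ∂((volume : Measure W).prod (volume.restrict (ball (0 : V) R))) < ⊤ :=
  (memLp_two_iff hG.meas.aestronglyMeasurable).1 hG.memLp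

theorem IsSlabL2.slice_meas (hG : IsSlabL2 R S G) (v : V) :
    StronglyMeasurable fun p => G (p, v) :=
  hG.meas.comp_measurable (by fun_prop)

theorem IsSlabL2.lintegral_eq (hG : IsSlabL2 R S G) :
    ∫⁻ z, ‖G z‖ₑ ^ 2 ∂((volume : Measure W).prod (volume.restrict (ball (0 : V) R)))
      = ∫⁻ v in ball (0 : V) R, ∫⁻ p, ‖G (p, v)‖ₑ ^ 2 :=
  lintegral_prod_symm _ (hG.meas.enorm.pow_const 2).aemeasurable

/-- Fubini gives square integrability of almost every slice, and bounded support in p then gives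
integrability, so that the transforms are honest integrals. -/
theorem IsSlabL2.slice_ae (hG : IsSlabL2 R S G) : ∀ᵐ v ∂(volume.restrict (ball (0 : V) R)),
    Integrable (fun p => G (p, v)) ∧ MemLp (fun p => G (p, v)) 2 := by
  have h := hG.lintegral_lt_top
  rw [hG.lintegral_eq] at h
  have hm : Measurable fun v => ∫⁻ p, ‖G (p, v)‖ₑ ^ 2 :=
    Measurable.lintegral_prod_left' (f := fun z : W × V => ‖G z‖ₑ ^ 2) (hG.meas.enorm.pow_const 2)
  filter_upwards [ae_lt_top hm h.ne] with v hv
  have h2 : MemLp (fun p => G (p, v)) 2 :=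
    (memLp_two_iff (hG.slice_meas v).aestronglyMeasurable).2 hv
  refine ⟨?_, h2⟩
  rw [← integrableOn_iff_integrable_of_support_subset (s := closedBall (0 : W) S)]
  · have : IsFiniteMeasure (volume.restrict (closedBall (0 : W) S)) :=
      ⟨by simpa using measure_closedBall_lt_top⟩
    exact (h2.mono_measure Measure.restrict_le_self).integrable (by norm_num)
  · intro p hp
    rw [mem_closedBall_zero_iff]
    by_contra hc
    exact hp (hG.supp (p, v) (not_le.1 hc))

theorem IsSlabL2.integrable (hG : IsSlabL2 R S G) :
    Integrable G ((volume : Measure W).prod (volume.restrict (ball (0 : V) R))) := by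
  set ν := volume.restrict (ball (0 : V) R)
  have hν : IsFiniteMeasure ν := ⟨by simpa [ν] using measure_ball_lt_top⟩
  rw [← integrableOn_iff_integrable_of_support_subset (s := closedBall (0 : W) S ×ˢ univ)]
  · have : IsFiniteMeasure
        (((volume : Measure W).prod ν).restrict (closedBall (0 : W) S ×ˢ univ)) := by
      refine ⟨?_⟩
      rw [Measure.restrict_apply_univ, Measure.prod_prod]
      exact ENNReal.mul_lt_top measure_closedBall_lt_top (measure_lt_top _ _)
    exact (hG.memLp.mono_measure Measure.restrict_le_self).integrable (by norm_num)
  · intro p hp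
    refine ⟨?_, mem_univ _⟩
    rw [mem_closedBall_zero_iff]
    by_contra hc
    exact hp (hG.supp p (not_le.1 hc))

theorem IsSlabL2.stronglyMeasurable_transform (hG : IsSlabL2 R S G) {τ : W → ℝ}
    (hτ : Continuous τ) : StronglyMeasurable fun v => ∫ p, τ p • G (p, v) := by
  refine StronglyMeasurable.integral_prod_left' (f := fun z : W × V => τ z.1 • G z) ?_
  exact (hτ.comp continuous_fst).stronglyMeasurable.smul hG.meas

/-- Cauchy–Schwarz on the bounded support in p. The conclusion holds for every frequency and not
just almost every one, so the problem in v can be posed at each ζ. -/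
theorem IsSlabL2.memLp_transform (hG : IsSlabL2 R S G) {τ : W → ℝ}
    (hτ : Continuous τ) (hτ1 : ∀ p, |τ p| ≤ 1) :
    MemLp (fun v => ∫ p, τ p • G (p, v)) 2 (volume.restrict (ball (0 : V) R)) := by
  rw [memLp_two_iff (hG.stronglyMeasurable_transform hτ).aestronglyMeasurable]
  have hpt : ∀ v, ‖∫ p, τ p • G (p, v)‖ₑ ^ 2
      ≤ volume (closedBall (0 : W) S) * ∫⁻ p, ‖G (p, v)‖ₑ ^ 2 := by
    intro v
    have h1 : ∫ p, τ p • G (p, v) = ∫ p in closedBall (0 : W) S, τ p • G (p, v) := by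
      refine (setIntegral_eq_integral_of_forall_compl_eq_zero fun p hp => ?_).symm
      rw [hG.supp (p, v) (by simpa using hp), smul_zero]
    rw [h1]
    refine (sq_enorm_integral_smul_le hτ.aestronglyMeasurable
      (hG.slice_meas v).aestronglyMeasurable).trans ?_
    refine mul_le_mul' ?_ (lintegral_mono' Measure.restrict_le_self le_rfl)
    calc _ ≤ ∫⁻ p in closedBall (0 : W) S, 1 := by
          refine lintegral_mono fun p => ?_
          refine pow_le_one₀ zero_le ?_
          rw [← ofReal_norm, ENNReal.ofReal_le_one]
          exact hτ1 p
      _ = _ := by simp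
  refine lt_of_le_of_lt (lintegral_mono hpt) ?_
  rw [lintegral_const_mul' _ _ measure_closedBall_lt_top.ne, ← hG.lintegral_eq]
  exact ENNReal.mul_lt_top measure_closedBall_lt_top hG.lintegral_lt_top

/-- Fubini in the form needed to pass from the phase space to a fixed frequency. A linear form A
covers at once multiplication by a test function, its derivative, and an inner product. -/
theorem IsSlabL2.integral_mul_clm (hG : IsSlabL2 R S G) {τ : W → ℝ} (hτ : Continuous τ)
    (hτ1 : ∀ p, |τ p| ≤ 1) {A : V → F →L[ℝ] ℝ} (hA : StronglyMeasurable A) {c : ℝ}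
    (hAc : ∀ v, ‖A v‖ ≤ c) :
    ∫ z, τ z.1 * A z.2 (G z) ∂((volume : Measure W).prod (volume.restrict (ball (0 : V) R)))
      = ∫ v in ball (0 : V) R, A v (∫ p, τ p • G (p, v)) := by
  have hi : Integrable (fun z : W × V => τ z.1 * A z.2 (G z))
      ((volume : Measure W).prod (volume.restrict (ball (0 : V) R))) := by
    refine (hG.integrable.norm.const_mul c).mono' ?_ (Eventually.of_forall fun z => ?_)
    · refine (hτ.comp continuous_fst).aestronglyMeasurable.mul ?_
      exact aestronglyMeasurable_clm_apply
        (hA.comp_measurable measurable_snd).aestronglyMeasurable hG.meas.aestronglyMeasurable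
    · rw [norm_mul]
      calc _ ≤ 1 * (‖A z.2‖ * ‖G z‖) := by
            gcongr
            · exact hτ1 z.1
            · exact ContinuousLinearMap.le_opNorm _ _
        _ ≤ _ := by rw [one_mul]; gcongr; exact hAc _
  rw [integral_prod_symm _ hi]
  refine integral_congr_ae ?_
  filter_upwards [hG.slice_ae] with v hv
  have hτi : Integrable fun p => τ p • G (p, v) :=
    Integrable.bdd_smul (φ := τ) hv.1 1 hτ.aestronglyMeasurable (Eventually.of_forall hτ1)
  rw [← ContinuousLinearMap.integral_comp_comm _ hτi]
  simp

theorem IsSlabL2.measurable_cosT (hG : IsSlabL2 R S G) :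
    StronglyMeasurable fun x : W × V => cosT (fun p => G (p, x.2)) x.1 := by
  refine StronglyMeasurable.integral_prod_left' (f := fun z : W × (W × V) =>
    Real.cos (2 * Real.pi * inner ℝ z.1 z.2.1) • G (z.1, z.2.2)) ?_
  exact (Continuous.stronglyMeasurable (by fun_prop)).smul (hG.meas.comp_measurable (by fun_prop))

theorem IsSlabL2.measurable_sinT (hG : IsSlabL2 R S G) :
    StronglyMeasurable fun x : W × V => sinT (fun p => G (p, x.2)) x.1 := by
  refine StronglyMeasurable.integral_prod_left' (f := fun z : W × (W × V) =>
    Real.sin (2 * Real.pi * inner ℝ z.1 z.2.1) • G (z.1, z.2.2)) ?_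
  exact (Continuous.stronglyMeasurable (by fun_prop)).smul (hG.meas.comp_measurable (by fun_prop))

theorem IsSlabL2.plancherel (hG : IsSlabL2 R S G) :
    ∫⁻ ζ, ((∫⁻ v in ball (0 : V) R, ‖cosT (fun p => G (p, v)) ζ‖ₑ ^ 2)
        + ∫⁻ v in ball (0 : V) R, ‖sinT (fun p => G (p, v)) ζ‖ₑ ^ 2)
      = ∫⁻ z, ‖G z‖ₑ ^ 2 ∂((volume : Measure W).prod (volume.restrict (ball (0 : V) R))) := by
  have hc : Measurable fun x : W × V => ‖cosT (fun p => G (p, x.2)) x.1‖ₑ ^ 2 :=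
    hG.measurable_cosT.enorm.pow_const 2
  have hs : Measurable fun x : W × V => ‖sinT (fun p => G (p, x.2)) x.1‖ₑ ^ 2 :=
    hG.measurable_sinT.enorm.pow_const 2
  have hcs : Measurable fun x : W × V => ‖cosT (fun p => G (p, x.2)) x.1‖ₑ ^ 2
      + ‖sinT (fun p => G (p, x.2)) x.1‖ₑ ^ 2 := hc.add hs
  rw [hG.lintegral_eq]
  calc _ = ∫⁻ ζ, ∫⁻ v in ball (0 : V) R, (‖cosT (fun p => G (p, v)) ζ‖ₑ ^ 2
          + ‖sinT (fun p => G (p, v)) ζ‖ₑ ^ 2) := by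
        refine lintegral_congr fun ζ => ?_
        have hcζ : StronglyMeasurable fun v => cosT (fun p => G (p, v)) ζ :=
          hG.stronglyMeasurable_transform (by fun_prop)
        rw [lintegral_add_left (hcζ.enorm.pow_const 2)]
    _ = ∫⁻ v in ball (0 : V) R, ∫⁻ ζ, (‖cosT (fun p => G (p, v)) ζ‖ₑ ^ 2
          + ‖sinT (fun p => G (p, v)) ζ‖ₑ ^ 2) := by
        rw [lintegral_lintegral_swap]
        exact hcs.aemeasurable
    _ = _ := by
        refine lintegral_congr_ae ?_
        filter_upwards [hG.slice_ae] with v hv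
        exact lintegral_cosT_sinT hv.1 hv.2

end Slices

/-! ### The transported field, its symbol, and the equation at a fixed frequency. -/

section Core
variable {W : Type*} [NormedAddCommGroup W] [InnerProductSpace ℝ W] [FiniteDimensional ℝ W]
  [MeasurableSpace W] [BorelSpace W]
variable {V : Type*} [NormedAddCommGroup V] [InnerProductSpace ℝ V] [FiniteDimensional ℝ V]
  [MeasurableSpace V] [BorelSpace V]

/-- A bounded velocity field `a` on `B_R` with square integrable weak derivative `Da`, which is
nondegenerate in the sense that `|a · ζ|` is small only on small sets. -/
structure IsNondegenerateField (R α : ℝ) (K Ma Bv : ℝ≥0) (A : ℝ) (a : V → W)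
    (Da : V → V →L[ℝ] W) : Prop where
  meas : StronglyMeasurable a
  bound : ∀ v, ‖a v‖ ≤ A
  deriv_meas : StronglyMeasurable Da
  deriv_bound : ∫⁻ v in ball 0 R, ‖Da v‖ₑ ^ 2 ≤ Ma
  weak : ∀ φ : V → ℝ, IsTest (ball 0 R) φ → ∀ e : V,
    ∫ v in ball 0 R, fderiv ℝ φ v e • a v = - ∫ v in ball 0 R, φ v • Da v e
  volume_le : volume (ball (0 : V) R) ≤ Bv
  nondegenerate : ∀ ζ : W, ζ ≠ 0 → ∀ t : ℝ, 0 < t →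
    volume {v | v ∈ ball (0 : V) R ∧ |inner ℝ (a v) ζ| ≤ t * ‖ζ‖} ≤ K * ENNReal.ofReal (t ^ α)

/-- The symbol of the transport operator at frequency `ζ`. -/
noncomputable def symbol (a : V → W) (ζ : W) (v : V) : ℝ := 2 * Real.pi * inner ℝ (a v) ζ

/-- The weak derivative of the symbol. -/
noncomputable def symbolDeriv (Da : V → V →L[ℝ] W) (ζ : W) (v : V) : V →L[ℝ] ℝ :=
  ((2 * Real.pi) • innerSL ℝ ζ) ∘L Da v

variable {R α A : ℝ} {K Ma Bv : ℝ≥0} {a : V → W} {Da : V → V →L[ℝ] W}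

theorem symbolDeriv_apply (ζ : W) (v e : V) :
    symbolDeriv Da ζ v e = 2 * Real.pi * inner ℝ ζ (Da v e) := by
  simp [symbolDeriv]

theorem IsNondegenerateField.symbol_meas (ha : IsNondegenerateField R α K Ma Bv A a Da) (ζ : W) :
    StronglyMeasurable (symbol a ζ) :=
  (ha.meas.inner stronglyMeasurable_const).const_mul _

theorem IsNondegenerateField.abs_symbol_le (ha : IsNondegenerateField R α K Ma Bv A a Da) (ζ : W)
    (v : V) : |symbol a ζ v| ≤ 2 * Real.pi * (A * ‖ζ‖) := by
  rw [symbol, abs_mul, abs_of_pos (by positivity : 0 < 2 * Real.pi)]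
  gcongr
  refine (abs_real_inner_le_norm _ _).trans ?_
  gcongr
  exact ha.bound v

theorem IsNondegenerateField.symbolDeriv_meas (ha : IsNondegenerateField R α K Ma Bv A a Da)
    (ζ : W) : StronglyMeasurable (symbolDeriv Da ζ) := by
  have : Continuous fun L : V →L[ℝ] W => ((2 * Real.pi) • innerSL ℝ ζ) ∘L L := by fun_prop
  exact this.comp_stronglyMeasurable ha.deriv_meas

theorem IsNondegenerateField.lintegral_symbolDeriv_le
    (ha : IsNondegenerateField R α K Ma Bv A a Da) (ζ : W) :
    ∫⁻ v in ball 0 R, ‖symbolDeriv Da ζ v‖ₑ ^ 2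
      ≤ (((2 * Real.pi) ^ 2).toNNReal * Ma : ℝ≥0) * ENNReal.ofReal (‖ζ‖ ^ 2) := by
  have hpt : ∀ v, ‖symbolDeriv Da ζ v‖ₑ ^ 2
      ≤ ENNReal.ofReal ((2 * Real.pi * ‖ζ‖) ^ 2) * ‖Da v‖ₑ ^ 2 := by
    intro v
    rw [← ofReal_norm, ← ofReal_norm, ← ENNReal.ofReal_pow (norm_nonneg _),
      ← ENNReal.ofReal_pow (norm_nonneg _), ← ENNReal.ofReal_mul (by positivity), ← mul_pow]
    refine ENNReal.ofReal_le_ofReal ?_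
    gcongr
    refine (ContinuousLinearMap.opNorm_comp_le _ _).trans ?_
    gcongr
    rw [norm_smul, innerSL_apply_norm, Real.norm_of_nonneg (by positivity)]
  refine (lintegral_mono hpt).trans ?_
  rw [lintegral_const_mul' _ _ (by simp), mul_pow, ENNReal.ofReal_mul (by positivity)]
  push_cast
  rw [← ENNReal.ofReal, mul_right_comm]
  gcongr
  exact ha.deriv_bound

theorem IsNondegenerateField.symbolDeriv_memLp (ha : IsNondegenerateField R α K Ma Bv A a Da)
    (ζ : W) : MemLp (symbolDeriv Da ζ) 2 (volume.restrict (ball 0 R)) := by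
  rw [memLp_two_iff (ha.symbolDeriv_meas ζ).aestronglyMeasurable]
  exact lt_of_le_of_lt (ha.lintegral_symbolDeriv_le ζ) 
    (ENNReal.mul_lt_top ENNReal.coe_lt_top ENNReal.ofReal_lt_top)

theorem IsNondegenerateField.hasWeakDeriv (ha : IsNondegenerateField R α K Ma Bv A a Da) (ζ : W) :
    HasWeakDeriv R (symbol a ζ) (symbolDeriv Da ζ) := by
  intro φ hφ e
  have hfin : IsFiniteMeasure (volume.restrict (ball (0 : V) R)) :=
    ⟨by simpa using measure_ball_lt_top⟩
  have hai : Integrable a (volume.restrict (ball (0 : V) R)) :=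
    Integrable.of_bound ha.meas.aestronglyMeasurable A (Eventually.of_forall ha.bound)
  have hDi : Integrable Da (volume.restrict (ball (0 : V) R)) := by
    refine MemLp.integrable (q := 2) (by norm_num) ?_
    rw [memLp_two_iff ha.deriv_meas.aestronglyMeasurable]
    exact lt_of_le_of_lt ha.deriv_bound (by simp)
  have hφd : Continuous fun v => fderiv ℝ φ v e :=
    (hφ.smooth.continuous_fderiv (by simp)).clm_apply continuous_const
  obtain ⟨c, hc⟩ := ((hφ.compact.fderiv_apply (𝕜 := ℝ) e)).exists_bound_of_continuous hφd
  obtain ⟨c', hc'⟩ := hφ.compact.exists_bound_of_continuous hφ.smooth.continuous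
  have h1 : Integrable (fun v => fderiv ℝ φ v e • a v) (volume.restrict (ball (0 : V) R)) :=
    Integrable.bdd_smul (φ := fun v => fderiv ℝ φ v e) hai c hφd.aestronglyMeasurable
      (Eventually.of_forall hc)
  have h2 : Integrable (fun v => φ v • Da v e) (volume.restrict (ball (0 : V) R)) :=
    Integrable.bdd_smul (φ := φ) (hDi.apply_continuousLinearMap e) c'
      hφ.smooth.continuous.aestronglyMeasurable (Eventually.of_forall hc')
  have h := congrArg (fun x => 2 * Real.pi * inner ℝ ζ x) (ha.weak φ hφ e)
  simp only [inner_neg_right, mul_neg] at h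
  rw [← integral_inner h1, ← integral_inner h2, ← integral_const_mul, ← integral_const_mul] at h
  calc _ = ∫ v in ball 0 R, 2 * Real.pi * inner ℝ ζ (fderiv ℝ φ v e • a v) := by
        refine integral_congr_ae (Eventually.of_forall fun v => ?_)
        simp only [symbol, inner_smul_right]
        rw [real_inner_comm]
        ring
    _ = _ := h
    _ = _ := by
        congr 1
        refine integral_congr_ae (Eventually.of_forall fun v => ?_)
        simp only [symbolDeriv_apply, inner_smul_right]
        ring

theorem IsNondegenerateField.volume_symbol_le (ha : IsNondegenerateField R α K Ma Bv A a Da)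
    {ζ : W} (hζ : ζ ≠ 0) {t : ℝ} (ht : 0 < t) :
    volume {v | v ∈ ball (0 : V) R ∧ |symbol a ζ v| ≤ t * ‖ζ‖} ≤ K * ENNReal.ofReal (t ^ α) := by
  refine (measure_mono ?_).trans (ha.nondegenerate ζ hζ t ht)
  rintro v ⟨hv, h⟩
  refine ⟨hv, le_trans ?_ h⟩
  rw [symbol, abs_mul, abs_of_pos (by positivity : 0 < 2 * Real.pi)]
  refine le_mul_of_one_le_left (abs_nonneg _) ?_
  nlinarith [Real.pi_gt_three]

/-- The transport equation, tested against products of smooth functions. -/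
def SolvesSplit (R : ℝ) (a : V → W) (h g₀ : W × V → ℝ) (g₁ : W × V → V) (c : W → ℝ) : Prop :=
  ∀ ψ : V → ℝ, IsTest (ball 0 R) ψ →
    ∫ z, h z * (fderiv ℝ c z.1 (a z.2) * ψ z.2) 
        ∂((volume : Measure W).prod (volume.restrict (ball (0 : V) R)))
      = ∫ z, c z.1 * fderiv ℝ ψ z.2 (g₁ z)
          ∂((volume : Measure W).prod (volume.restrict (ball (0 : V) R)))
        - ∫ z, g₀ z * (c z.1 * ψ z.2)
          ∂((volume : Measure W).prod (volume.restrict (ball (0 : V) R)))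

theorem hasFDerivAt_phase (ζ p : W) : HasFDerivAt (fun p : W => 2 * Real.pi * inner ℝ p ζ)
    ((2 * Real.pi) • innerSL ℝ ζ) p := by
  have h : HasFDerivAt (fun p : W => inner ℝ ζ p) (innerSL ℝ ζ) p := (innerSL ℝ ζ).hasFDerivAt
  have h2 := h.const_mul (2 * Real.pi)
  simp only [real_inner_comm] at h2 ⊢
  exact h2

theorem fderiv_cos_phase (ζ p w : W) :
    fderiv ℝ (fun p : W => Real.cos (2 * Real.pi * inner ℝ p ζ)) p w
      = - (Real.sin (2 * Real.pi * inner ℝ p ζ) * (2 * Real.pi * inner ℝ w ζ)) := by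
  rw [((hasFDerivAt_phase ζ p).cos).fderiv]
  simp [real_inner_comm]

theorem fderiv_sin_phase (ζ p w : W) :
    fderiv ℝ (fun p : W => Real.sin (2 * Real.pi * inner ℝ p ζ)) p w
      = Real.cos (2 * Real.pi * inner ℝ p ζ) * (2 * Real.pi * inner ℝ w ζ) := by
  rw [((hasFDerivAt_phase ζ p).sin).fderiv]
  simp [real_inner_comm]

variable {S : ℝ} {h g₀ : W × V → ℝ} {g₁ : W × V → V}

/-- Differentiating one phase produces the other, so the symbol multiplies the transform of h with
phase τ while the sources carry τ'. The sign s covers both pairs: s = 1 for (cos, sin) and s = -1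
for (sin, cos). -/
theorem IsNondegenerateField.transform_equation (ha : IsNondegenerateField R α K Ma Bv A a Da)
    (hh : IsSlabL2 R S h) (hg₀ : IsSlabL2 R S g₀) (hg₁ : IsSlabL2 R S g₁) (ζ : W)
    {τ τ' : W → ℝ} {s : ℝ} (hτc : Continuous τ) (hτ : ∀ p, |τ p| ≤ 1) (hτ'c : Continuous τ')
    (hτ' : ∀ p, |τ' p| ≤ 1)
    (hd : ∀ p w, fderiv ℝ τ' p w = s * (τ p * (2 * Real.pi * inner ℝ w ζ))) (hs : s * s = 1)
    (heq : SolvesSplit R a h g₀ g₁ τ') {ψ : V → ℝ} (hψ : IsTest (ball 0 R) ψ) :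
    ∫ v in ball 0 R, symbol a ζ v * ψ v * ∫ p, τ p • h (p, v)
      = (∫ v in ball 0 R, fderiv ℝ ψ v (s • ∫ p, τ' p • g₁ (p, v)))
        + ∫ v in ball 0 R, ψ v * (-s • ∫ p, τ' p • g₀ (p, v)) := by
  obtain ⟨c, hc⟩ := hψ.compact.exists_bound_of_continuous hψ.smooth.continuous
  have hψd := hψ.smooth.continuous_fderiv (n := ∞) (by simp)
  obtain ⟨c', hc'⟩ := (hψ.compact.fderiv ℝ).exists_bound_of_continuous hψd
  have hψm := hψ.smooth.continuous.stronglyMeasurable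
  set Id := ContinuousLinearMap.id ℝ ℝ
  have e1 := hh.integral_mul_clm hτc hτ (A := fun v => (symbol a ζ v * ψ v) • Id)
    (((ha.symbol_meas ζ).mul hψm).smul stronglyMeasurable_const)
    (c := 2 * Real.pi * (A * ‖ζ‖) * c) (fun v => by
      rw [norm_smul, ContinuousLinearMap.norm_id, mul_one, norm_mul]
      have h1 := ha.abs_symbol_le ζ v
      have h2 : 0 ≤ 2 * Real.pi * (A * ‖ζ‖) := (abs_nonneg _).trans h1
      gcongr
      · exact h1
      · exact hc v)
  have e2 := hg₁.integral_mul_clm hτ'c hτ' (A := fun v => fderiv ℝ ψ v) hψd.stronglyMeasurable hc'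
  have e3 := hg₀.integral_mul_clm hτ'c hτ' (A := fun v => ψ v • Id)
    (hψm.smul stronglyMeasurable_const) (c := c) (fun v => by
      rw [norm_smul, ContinuousLinearMap.norm_id, mul_one]; exact hc v)
  simp only [Id, _root_.smul_apply, ContinuousLinearMap.id_apply, smul_eq_mul] at e1 e2 e3
  have h0 := heq ψ hψ
  have h1 : ∀ z : W × V, h z * (fderiv ℝ τ' z.1 (a z.2) * ψ z.2)
      = s * (τ z.1 * (symbol a ζ z.2 * ψ z.2 * h z)) := fun z => by
    rw [hd, symbol]; ring
  have h2 : ∀ z : W × V, g₀ z * (τ' z.1 * ψ z.2) = τ' z.1 * (ψ z.2 * g₀ z) := fun z => by ring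
  simp only [h1, h2] at h0
  rw [integral_const_mul, e1, e2, e3] at h0
  simp only [map_smul, smul_eq_mul]
  have h3 : ∀ v, ψ v * (-s * ∫ p, τ' p * g₀ (p, v)) = -s * (ψ v * ∫ p, τ' p * g₀ (p, v)) :=
    fun v => by ring
  simp only [h3]
  rw [integral_const_mul, integral_const_mul]
  calc _ = s * (s * ∫ v in ball 0 R, symbol a ζ v * ψ v * ∫ p, τ p * h (p, v)) := by
        rw [← mul_assoc, hs, one_mul]
    _ = _ := by rw [h0]; ring

end Core
end Kinetic

namespace Kinetic
open Filter Topology Metric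

/-! ### Integration over frequencies: the estimate for bounded support in p. -/

section SlabEstimate
variable {W : Type*} [NormedAddCommGroup W] [InnerProductSpace ℝ W] [FiniteDimensional ℝ W]
  [MeasurableSpace W] [BorelSpace W]
variable {V : Type*} [NormedAddCommGroup V] [InnerProductSpace ℝ V] [FiniteDimensional ℝ V]
  [MeasurableSpace V] [BorelSpace V]
variable {F : Type*} [NormedAddCommGroup F] [InnerProductSpace ℝ F] [FiniteDimensional ℝ F]

/-- The energy on `B_R` of the Fourier transform in the first variable at frequency `ζ`. -/
noncomputable def sliceEnergy (R : ℝ) (G : W × V → F) (ζ : W) : ℝ≥0∞ :=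
  (∫⁻ v in ball (0 : V) R, ‖cosT (fun p => G (p, v)) ζ‖ₑ ^ 2)
    + ∫⁻ v in ball (0 : V) R, ‖sinT (fun p => G (p, v)) ζ‖ₑ ^ 2

theorem IsSlabL2.measurable_sliceEnergy {R S R' : ℝ} {G : W × V → F} (hG : IsSlabL2 R S G) :
    Measurable (sliceEnergy R' G) := by
  have hc : Measurable fun x : W × V => ‖cosT (fun p => G (p, x.2)) x.1‖ₑ ^ 2 :=
    hG.measurable_cosT.enorm.pow_const 2
  have hs : Measurable fun x : W × V => ‖sinT (fun p => G (p, x.2)) x.1‖ₑ ^ 2 :=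
    hG.measurable_sinT.enorm.pow_const 2
  exact Measurable.add (Measurable.lintegral_prod_right' hc) (Measurable.lintegral_prod_right' hs)

theorem abs_phase_le_one (ζ : W) : (∀ p : W, |Real.cos (2 * Real.pi * inner ℝ p ζ)| ≤ 1)
    ∧ ∀ p : W, |Real.sin (2 * Real.pi * inner ℝ p ζ)| ≤ 1 :=
  ⟨fun _ => Real.abs_cos_le_one _, fun _ => Real.abs_sin_le_one _⟩

-- `exists_frequency_estimate` is applied with lam = ‖ζ‖ to the cosine and to the sine transform,
-- whose sources have the opposite parity. The energies add both parities, so the two bounds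
-- combine.
variable (W V) in
theorem exists_frequency_energy_estimate {α δ ε₀ γ : ℝ} (hα : 0 < α) (hα1 : α ≤ 1) (hδ : 0 < δ)
    (hε₀ : 0 < ε₀) (hε₀1 : ε₀ ≤ 1)
    (hγ : γ = 2 * α * δ / ((4 + α) * (2 + 2 * δ + Module.finrank ℝ V))) (K Ma Bv : ℝ≥0) :
    ∃ C : ℝ≥0, ∀ (R r A S : ℝ) (a : V → W) (Da : V → V →L[ℝ] W) (h g₀ : W × V → ℝ)
      (g₁ : W × V → V) (N : W → ℝ≥0∞), r + ε₀ < R → IsNondegenerateField R α K Ma Bv A a Da →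
      IsSlabL2 R S h → IsSlabL2 R S g₀ → IsSlabL2 R S g₁ →
      (∀ ζ, SolvesSplit R a h g₀ g₁ fun p => Real.cos (2 * Real.pi * inner ℝ p ζ)) →
      (∀ ζ, SolvesSplit R a h g₀ g₁ fun p => Real.sin (2 * Real.pi * inner ℝ p ζ)) →
      (∀ ζ, IncrementBound δ r ε₀ (fun v => cosT (fun p => h (p, v)) ζ) (N ζ)) →
      (∀ ζ, IncrementBound δ r ε₀ (fun v => sinT (fun p => h (p, v)) ζ) (N ζ)) →
      ∀ ζ, ENNReal.ofReal (‖ζ‖ ^ (2 * γ)) * sliceEnergy r h ζ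
        ≤ C * (N ζ + (sliceEnergy R h ζ + sliceEnergy R g₁ ζ + sliceEnergy R g₀ ζ)) := by
  obtain ⟨C, hC⟩ := exists_frequency_estimate V hα hα1 hδ hε₀ hε₀1 hγ K
    (((2 * Real.pi) ^ 2).toNNReal * Ma) Bv
  refine ⟨2 * C + 1, fun R r A S a Da h g₀ g₁ N hr ha hh hg₀ hg₁ heqc heqs hNc hNs ζ => ?_⟩
  have hγ0 : 0 ≤ γ := by rw [hγ]; positivity
  -- For low frequencies the weight is at most 1 and the energy of h on B_R suffices; this is the
  -- summand 1 in the constant.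
  rcases lt_or_ge ‖ζ‖ 1 with hζ | hζ
  · have hrR : ball (0 : V) r ⊆ ball 0 R := ball_subset_ball (by linarith)
    calc _ ≤ 1 * sliceEnergy R h ζ := by
          refine mul_le_mul' ?_ ?_
          · rw [ENNReal.ofReal_le_one]
            exact Real.rpow_le_one (norm_nonneg _) hζ.le (by positivity)
          · exact add_le_add (lintegral_mono_set hrR) (lintegral_mono_set hrR)
      _ ≤ _ := by
          refine mul_le_mul' ?_ ?_
          · push_cast
            exact le_add_self
          · rw [add_assoc]
            exact le_add_self.trans' le_self_add
  have hζ0 : ζ ≠ 0 := by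
    rintro rfl
    norm_num at hζ
  have hcc : Continuous fun p : W => Real.cos (2 * Real.pi * inner ℝ p ζ) := by fun_prop
  have hsc : Continuous fun p : W => Real.sin (2 * Real.pi * inner ℝ p ζ) := by fun_prop
  obtain ⟨hc1, hs1⟩ := abs_phase_le_one ζ
  have key := hC R r hr ha.volume_le ‖ζ‖ hζ (symbol a ζ) (symbolDeriv Da ζ) _ (ha.symbol_meas ζ)
    (ha.abs_symbol_le ζ) (ha.symbolDeriv_meas ζ) (ha.symbolDeriv_memLp ζ) (ha.hasWeakDeriv ζ)
    (ha.lintegral_symbolDeriv_le ζ) (fun t ht => ha.volume_symbol_le hζ0 ht)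
  have k1 := key (fun v => cosT (fun p => h (p, v)) ζ) _ _ (N ζ)
    (hh.stronglyMeasurable_transform hcc)
    ((hg₀.stronglyMeasurable_transform hsc).const_smul (-1 : ℝ))
    ((hg₁.stronglyMeasurable_transform hsc).const_smul (1 : ℝ))
    (hh.memLp_transform hcc hc1)
    ((hg₀.memLp_transform hsc hs1).const_smul (-1 : ℝ))
    ((hg₁.memLp_transform hsc hs1).const_smul (1 : ℝ))
    (fun ψ hψ => ha.transform_equation hh hg₀ hg₁ ζ hcc hc1 hsc hs1
      (fun p w => by rw [fderiv_sin_phase, one_mul]) (by norm_num) (heqs ζ) hψ) (hNc ζ)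
  have k2 := key (fun v => sinT (fun p => h (p, v)) ζ) _ _ (N ζ)
    (hh.stronglyMeasurable_transform hsc)
    ((hg₀.stronglyMeasurable_transform hcc).const_smul (-(-1) : ℝ))
    ((hg₁.stronglyMeasurable_transform hcc).const_smul (-1 : ℝ))
    (hh.memLp_transform hsc hs1)
    ((hg₀.memLp_transform hcc hc1).const_smul (-(-1) : ℝ))
    ((hg₁.memLp_transform hcc hc1).const_smul (-1 : ℝ))
    (fun ψ hψ => ha.transform_equation hh hg₀ hg₁ ζ hsc hs1 hcc hc1
      (fun p w => by rw [fderiv_cos_phase, neg_one_mul]) (by norm_num) (heqc ζ) hψ) (hNs ζ)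
  simp only [Pi.smul_apply, enorm_smul, enorm_neg, enorm_one, one_mul] at k1 k2
  rw [sliceEnergy, mul_add]
  refine (add_le_add k1 k2).trans ?_
  rw [← mul_add]
  calc _ ≤ (C : ℝ≥0∞) * (2 * (N ζ + (sliceEnergy R h ζ + sliceEnergy R g₁ ζ
        + sliceEnergy R g₀ ζ))) := by
        refine mul_le_mul' le_rfl ?_
        rw [two_mul (N ζ + _)]
        refine add_le_add (add_le_add le_rfl ?_) (add_le_add le_rfl ?_)
        · exact add_le_add (add_le_add le_self_add le_add_self) le_add_self
        · exact add_le_add (add_le_add le_add_self le_self_add) le_self_add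
    _ = ((2 * C : ℝ≥0) : ℝ≥0∞) * (N ζ + (sliceEnergy R h ζ + sliceEnergy R g₁ ζ
        + sliceEnergy R g₀ ζ)) := by push_cast; ring
    _ ≤ _ := by
        refine mul_le_mul' ?_ le_rfl
        push_cast
        exact le_self_add

theorem cosT_sub {f g : W → F} (hf : Integrable f) (hg : Integrable g) (ζ : W) :
    cosT (fun p => f p - g p) ζ = cosT f ζ - cosT g ζ := by
  simp only [cosT, smul_sub]
  exact integral_sub (integrable_cos_smul hf ζ) (integrable_cos_smul hg ζ)

theorem sinT_sub {f g : W → F} (hf : Integrable f) (hg : Integrable g) (ζ : W) :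
    sinT (fun p => f p - g p) ζ = sinT f ζ - sinT g ζ := by
  simp only [sinT, smul_sub]
  exact integral_sub (integrable_sin_smul hf ζ) (integrable_sin_smul hg ζ)

/-- Tonelli brings the frequency integral inside; Plancherel is then applied to the difference of
two slices, for almost every pair (v, w). -/
theorem IsSlabL2.plancherel_increment {R S r : ℝ} {G : W × V → F} (hG : IsSlabL2 R S G)
    (hr : r ≤ R) {κ : V → V → ℝ≥0∞} (hκ : Measurable fun x : V × V => κ x.1 x.2) :
    ∫⁻ ζ, ∫⁻ v in ball (0 : V) r, ∫⁻ w in ball (0 : V) r, κ v w *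
        (‖cosT (fun p => G (p, v)) ζ - cosT (fun p => G (p, w)) ζ‖ₑ ^ 2
          + ‖sinT (fun p => G (p, v)) ζ - sinT (fun p => G (p, w)) ζ‖ₑ ^ 2)
      = ∫⁻ v in ball (0 : V) r, ∫⁻ w in ball (0 : V) r, κ v w *
          ∫⁻ q, ‖G (q, v) - G (q, w)‖ₑ ^ 2 := by
  have hae : ∀ᵐ v ∂(volume.restrict (ball (0 : V) r)),
      Integrable (fun p => G (p, v)) ∧ MemLp (fun p => G (p, v)) 2 :=
    ae_mono (Measure.restrict_mono (ball_subset_ball hr) le_rfl) hG.slice_ae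
  have h1 : StronglyMeasurable fun x : (W × V) × V => cosT (fun p => G (p, x.1.2)) x.1.1 :=
    hG.measurable_cosT.comp_measurable measurable_fst
  have h2 : StronglyMeasurable fun x : (W × V) × V => cosT (fun p => G (p, x.2)) x.1.1 :=
    hG.measurable_cosT.comp_measurable (by fun_prop : Measurable fun x : (W × V) × V => (x.1.1, x.2))
  have h3 : StronglyMeasurable fun x : (W × V) × V => sinT (fun p => G (p, x.1.2)) x.1.1 :=
    hG.measurable_sinT.comp_measurable measurable_fst
  have h4 : StronglyMeasurable fun x : (W × V) × V => sinT (fun p => G (p, x.2)) x.1.1 :=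
    hG.measurable_sinT.comp_measurable (by fun_prop : Measurable fun x : (W × V) × V => (x.1.1, x.2))
  have h5 : Measurable fun x : (W × V) × V => κ x.1.2 x.2 :=
    hκ.comp (by fun_prop : Measurable fun x : (W × V) × V => (x.1.2, x.2))
  set Φ : (W × V) × V → ℝ≥0∞ := fun x => κ x.1.2 x.2 *
    (‖cosT (fun p => G (p, x.1.2)) x.1.1 - cosT (fun p => G (p, x.2)) x.1.1‖ₑ ^ 2
      + ‖sinT (fun p => G (p, x.1.2)) x.1.1 - sinT (fun p => G (p, x.2)) x.1.1‖ₑ ^ 2) with hΦ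
  have hΦm : Measurable Φ :=
    h5.mul (((h1.sub h2).enorm.pow_const 2).add ((h3.sub h4).enorm.pow_const 2))
  have hint : Measurable fun x : W × V => ∫⁻ w in ball (0 : V) r, Φ (x, w) :=
    Measurable.lintegral_prod_right' hΦm
  calc _ = ∫⁻ ζ, ∫⁻ v in ball (0 : V) r, ∫⁻ w in ball (0 : V) r, Φ ((ζ, v), w) := rfl
    _ = ∫⁻ v in ball (0 : V) r, ∫⁻ ζ, ∫⁻ w in ball (0 : V) r, Φ ((ζ, v), w) :=
        lintegral_lintegral_swap (f := fun ζ v => ∫⁻ w in ball (0 : V) r, Φ ((ζ, v), w))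
          hint.aemeasurable
    _ = _ := by
        refine lintegral_congr_ae ?_
        filter_upwards [hae] with v hv
        have hm : Measurable fun x : W × V => Φ ((x.1, v), x.2) :=
          hΦm.comp (by fun_prop : Measurable fun x : W × V => ((x.1, v), x.2))
        rw [lintegral_lintegral_swap (f := fun ζ w => Φ ((ζ, v), w)) hm.aemeasurable]
        refine lintegral_congr_ae ?_
        filter_upwards [hae] with w hw
        have hm1 : Measurable fun ζ : W =>
            ‖cosT (fun p => G (p, v)) ζ - cosT (fun p => G (p, w)) ζ‖ₑ ^ 2
            + ‖sinT (fun p => G (p, v)) ζ - sinT (fun p => G (p, w)) ζ‖ₑ ^ 2 := by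
          have hc := ((continuous_cosT hv.1).sub (continuous_cosT hw.1)).enorm.measurable
          have hs := ((continuous_sinT hv.1).sub (continuous_sinT hw.1)).enorm.measurable
          exact (hc.pow_const 2).add (hs.pow_const 2)
        simp only [hΦ]
        rw [lintegral_const_mul _ hm1]
        congr 1
        refine Eq.trans ?_ (lintegral_cosT_sinT (hv.1.sub hw.1) (hv.2.sub hw.2))
        refine lintegral_congr fun ζ => ?_
        rw [← cosT_sub hv.1 hw.1, ← sinT_sub hv.1 hw.1]

/-- The energy of `G` on `W × B_R`. -/
noncomputable def slabEnergy (R : ℝ) (G : W × V → F) : ℝ≥0∞ :=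
  ∫⁻ z, ‖G z‖ₑ ^ 2 ∂((volume : Measure W).prod (volume.restrict (ball (0 : V) R)))

/-- The squared Gagliardo seminorm of order `γ` on `W × B_r`. -/
noncomputable def slabGagliardo (γ r : ℝ) (H : W × V → ℝ) : ℝ≥0∞ :=
  ∫⁻ y, ∫⁻ z, ENNReal.ofReal ((√(‖y.1 - z.1‖ ^ 2 + ‖y.2 - z.2‖ ^ 2)
      ^ ((Module.finrank ℝ W + Module.finrank ℝ V : ℝ) + 2 * γ))⁻¹) * ‖H y - H z‖ₑ ^ 2
      ∂((volume : Measure W).prod (volume.restrict (ball (0 : V) r)))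
      ∂((volume : Measure W).prod (volume.restrict (ball (0 : V) r)))

theorem IsSlabL2.lintegral_sliceEnergy {R S : ℝ} {G : W × V → F} (hG : IsSlabL2 R S G) :
    ∫⁻ ζ, sliceEnergy R G ζ = slabEnergy R G :=
  hG.plancherel

theorem IsSlabL2.mono {R S r : ℝ} {G : W × V → F} (hG : IsSlabL2 R S G) (hr : r ≤ R) :
    IsSlabL2 r S G :=
  ⟨hG.meas, hG.memLp.mono_measure (Measure.prod_mono le_rfl
    (Measure.restrict_mono (ball_subset_ball hr) le_rfl)), hG.supp⟩

variable (W V) in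
theorem exists_spatial_gagliardo_le {γ : ℝ} (hn : 1 ≤ Module.finrank ℝ W) (hγ : 0 < γ)
    (hγ1 : γ < 1) : ∃ C : ℝ≥0, ∀ (r S : ℝ) (h : W × V → ℝ), IsSlabL2 r S h →
      ∫⁻ v in ball (0 : V) r, ∫⁻ p, ∫⁻ q,
          ENNReal.ofReal ((‖p - q‖ ^ (Module.finrank ℝ W + 2 * γ))⁻¹) * ‖h (p, v) - h (q, v)‖ₑ ^ 2
        ≤ C * ∫⁻ ζ, ENNReal.ofReal (‖ζ‖ ^ (2 * γ)) * sliceEnergy r h ζ := by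
  obtain ⟨C, hC⟩ := exists_gagliardo_le_fourier W hn hγ hγ1
  refine ⟨C, fun r S h hh => ?_⟩
  have hc : Measurable fun x : W × V => ‖cosT (fun p => h (p, x.2)) x.1‖ₑ ^ 2 :=
    hh.measurable_cosT.enorm.pow_const 2
  have hs : Measurable fun x : W × V => ‖sinT (fun p => h (p, x.2)) x.1‖ₑ ^ 2 :=
    hh.measurable_sinT.enorm.pow_const 2
  have hκ : Measurable fun x : W × V => ENNReal.ofReal (‖x.1‖ ^ (2 * γ)) := by fun_prop
  have hm : Measurable fun x : W × V => ENNReal.ofReal (‖x.1‖ ^ (2 * γ)) *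
      (‖cosT (fun p => h (p, x.2)) x.1‖ₑ ^ 2 + ‖sinT (fun p => h (p, x.2)) x.1‖ₑ ^ 2) :=
    hκ.mul (hc.add hs)
  calc _ ≤ ∫⁻ v in ball (0 : V) r, C * ∫⁻ ζ, ENNReal.ofReal (‖ζ‖ ^ (2 * γ)) *
          (‖cosT (fun p => h (p, v)) ζ‖ₑ ^ 2 + ‖sinT (fun p => h (p, v)) ζ‖ₑ ^ 2) := by
        refine lintegral_mono_ae ?_
        filter_upwards [hh.slice_ae] with v hv
        exact hC _ (hh.slice_meas v).measurable hv.1 hv.2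
    _ = C * ∫⁻ ζ, ∫⁻ v in ball (0 : V) r, ENNReal.ofReal (‖ζ‖ ^ (2 * γ)) *
          (‖cosT (fun p => h (p, v)) ζ‖ₑ ^ 2 + ‖sinT (fun p => h (p, v)) ζ‖ₑ ^ 2) := by
        rw [lintegral_const_mul' _ _ ENNReal.coe_ne_top]
        congr 1
        exact (lintegral_lintegral_swap (f := fun ζ v => ENNReal.ofReal (‖ζ‖ ^ (2 * γ)) *
          (‖cosT (fun p => h (p, v)) ζ‖ₑ ^ 2 + ‖sinT (fun p => h (p, v)) ζ‖ₑ ^ 2))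
          hm.aemeasurable).symm
    _ = _ := by
        congr 1
        refine lintegral_congr fun ζ => ?_
        have hcζ : StronglyMeasurable fun v => cosT (fun p => h (p, v)) ζ :=
          hh.stronglyMeasurable_transform (by fun_prop)
        rw [lintegral_const_mul' _ _ ENNReal.ofReal_ne_top, sliceEnergy,
          lintegral_add_left (hcζ.enorm.pow_const 2)]

-- The dyadic argument of `exists_gagliardo_le_of_incrementBound` runs at each frequency, with its
-- own bound N ζ, and Plancherel translates the result back.
variable (W V) in
theorem exists_velocity_gagliardo_le {γ δ ε₀ : ℝ} (hγ : 0 < γ) (hγδ : γ < δ) (hε₀ : 0 < ε₀) :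
    ∃ C : ℝ≥0, ∀ (r S : ℝ) (h : W × V → ℝ) (N : W → ℝ≥0∞), IsSlabL2 r S h →
      (∀ ζ, IncrementBound δ r ε₀ (fun v => cosT (fun p => h (p, v)) ζ) (N ζ)) →
      (∀ ζ, IncrementBound δ r ε₀ (fun v => sinT (fun p => h (p, v)) ζ) (N ζ)) →
      ∫⁻ v in ball (0 : V) r, ∫⁻ w in ball (0 : V) r,
          ENNReal.ofReal ((‖v - w‖ ^ (Module.finrank ℝ V + 2 * γ))⁻¹) *
            ∫⁻ q, ‖h (q, v) - h (q, w)‖ₑ ^ 2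
        ≤ C * ((∫⁻ ζ, N ζ) + slabEnergy r h) := by
  obtain ⟨C, hC⟩ := exists_gagliardo_le_of_incrementBound V hγ hγδ hε₀
  refine ⟨2 * C, fun r S h N hh hNc hNs => ?_⟩
  have hκ : Measurable fun x : V × V =>
    ENNReal.ofReal ((‖x.1 - x.2‖ ^ (Module.finrank ℝ V + 2 * γ))⁻¹) := by fun_prop
  rw [← hh.plancherel_increment le_rfl
    (κ := fun v w => ENNReal.ofReal ((‖v - w‖ ^ (Module.finrank ℝ V + 2 * γ))⁻¹)) hκ]
  calc _ ≤ ∫⁻ ζ, ((2 * C : ℝ≥0) : ℝ≥0∞) * (N ζ + sliceEnergy r h ζ) := by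
        refine lintegral_mono fun ζ => ?_
        have hcζ : StronglyMeasurable fun v => cosT (fun p => h (p, v)) ζ :=
          hh.stronglyMeasurable_transform (by fun_prop)
        have hsζ : StronglyMeasurable fun v => sinT (fun p => h (p, v)) ζ :=
          hh.stronglyMeasurable_transform (by fun_prop)
        have hm : Measurable fun x : V × V =>
            ENNReal.ofReal ((‖x.1 - x.2‖ ^ (Module.finrank ℝ V + 2 * γ))⁻¹) *
            ‖cosT (fun p => h (p, x.1)) ζ - cosT (fun p => h (p, x.2)) ζ‖ₑ ^ 2 :=
          hκ.mul (((hcζ.comp_measurable measurable_fst).sub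
            (hcζ.comp_measurable measurable_snd)).enorm.pow_const 2)
        have k1 := hC r _ (N ζ) hcζ.measurable (hNc ζ)
        have k2 := hC r _ (N ζ) hsζ.measurable (hNs ζ)
        simp only [mul_add]
        have e1 : ∀ v : V, ∫⁻ w in ball (0 : V) r,
            (ENNReal.ofReal ((‖v - w‖ ^ (Module.finrank ℝ V + 2 * γ))⁻¹) *
              ‖cosT (fun p => h (p, v)) ζ - cosT (fun p => h (p, w)) ζ‖ₑ ^ 2
            + ENNReal.ofReal ((‖v - w‖ ^ (Module.finrank ℝ V + 2 * γ))⁻¹) *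
              ‖sinT (fun p => h (p, v)) ζ - sinT (fun p => h (p, w)) ζ‖ₑ ^ 2)
            = (∫⁻ w in ball (0 : V) r,
              ENNReal.ofReal ((‖v - w‖ ^ (Module.finrank ℝ V + 2 * γ))⁻¹) *
              ‖cosT (fun p => h (p, v)) ζ - cosT (fun p => h (p, w)) ζ‖ₑ ^ 2)
            + ∫⁻ w in ball (0 : V) r,
              ENNReal.ofReal ((‖v - w‖ ^ (Module.finrank ℝ V + 2 * γ))⁻¹) *
              ‖sinT (fun p => h (p, v)) ζ - sinT (fun p => h (p, w)) ζ‖ₑ ^ 2 := fun v =>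
          lintegral_add_left (hm.comp measurable_prodMk_left) _
        simp only [e1]
        rw [lintegral_add_left (Measurable.lintegral_prod_right' hm)]
        refine (add_le_add k1 k2).trans ?_
        rw [← mul_add]
        have e2 : N ζ + (∫⁻ v in ball (0 : V) r, ‖cosT (fun p => h (p, v)) ζ‖ₑ ^ 2)
            + (N ζ + ∫⁻ v in ball (0 : V) r, ‖sinT (fun p => h (p, v)) ζ‖ₑ ^ 2)
            = N ζ + N ζ + sliceEnergy r h ζ := by
          rw [sliceEnergy]; ring
        rw [e2, ← mul_add]
        calc _ ≤ (C : ℝ≥0∞) * (N ζ + N ζ + (sliceEnergy r h ζ + sliceEnergy r h ζ)) := by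
              gcongr
              exact le_self_add
          _ = _ := by push_cast; ring
    _ = _ := by
        -- Measurability of the energy alone allows the splitting; none is known for N.
        rw [lintegral_const_mul' _ _ ENNReal.coe_ne_top,
          lintegral_add_right _ hh.measurable_sliceEnergy, hh.lintegral_sliceEnergy]

-- The weighted frequency estimate controls differences in p, the increment bounds control
-- differences in v, and the product inequality joins them.
variable (W V) in
theorem exists_slab_estimate {α δ ε₀ γ : ℝ} (hn : 1 ≤ Module.finrank ℝ W) (hα : 0 < α)
    (hα1 : α ≤ 1) (hδ : 0 < δ) (hδ1 : δ ≤ 1) (hε₀ : 0 < ε₀) (hε₀1 : ε₀ ≤ 1)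
    (hγ : γ = 2 * α * δ / ((4 + α) * (2 + 2 * δ + Module.finrank ℝ V))) (K Ma Bv : ℝ≥0) :
    ∃ C : ℝ≥0, ∀ (R r A S : ℝ) (a : V → W) (Da : V → V →L[ℝ] W) (h g₀ : W × V → ℝ)
      (g₁ : W × V → V) (N : W → ℝ≥0∞), r + ε₀ < R → IsNondegenerateField R α K Ma Bv A a Da →
      IsSlabL2 R S h → IsSlabL2 R S g₀ → IsSlabL2 R S g₁ →
      (∀ ζ, SolvesSplit R a h g₀ g₁ fun p => Real.cos (2 * Real.pi * inner ℝ p ζ)) →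
      (∀ ζ, SolvesSplit R a h g₀ g₁ fun p => Real.sin (2 * Real.pi * inner ℝ p ζ)) →
      (∀ ζ, IncrementBound δ r ε₀ (fun v => cosT (fun p => h (p, v)) ζ) (N ζ)) →
      (∀ ζ, IncrementBound δ r ε₀ (fun v => sinT (fun p => h (p, v)) ζ) (N ζ)) →
      slabGagliardo γ r h
        ≤ C * ((∫⁻ ζ, N ζ) + (slabEnergy R h + slabEnergy R g₁ + slabEnergy R g₀)) := by
  have hd0 : (0 : ℝ) ≤ Module.finrank ℝ V := Nat.cast_nonneg _
  have hγ0 : 0 < γ := by rw [hγ]; positivity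
  -- The dyadic sum in v needs γ < δ, and with δ ≤ 1 this also gives the γ < 1 needed for the kernel
  -- in p.
  have hγδ : γ < δ := by
    rw [hγ, div_lt_iff₀ (by positivity)]
    have h1 : (2 : ℝ) * α < (4 + α) * (2 + 2 * δ + Module.finrank ℝ V) := by
      nlinarith [mul_nonneg (by linarith : 0 ≤ 4 + α) hd0, mul_pos (by linarith : 0 < 4 + α) hδ]
    nlinarith
  obtain ⟨C₁, hC₁⟩ := exists_frequency_energy_estimate W V hα hα1 hδ hε₀ hε₀1 hγ K Ma Bv
  obtain ⟨C₂, hC₂⟩ := exists_spatial_gagliardo_le W V hn hγ0 (hγδ.trans_le hδ1)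
  obtain ⟨C₃, hC₃⟩ := exists_velocity_gagliardo_le W V hγ0 hγδ hε₀
  obtain ⟨C₄, hC₄⟩ := exists_product_gagliardo_le W V hγ0
  refine ⟨C₄ * (C₂ * C₁ + C₃), fun R r A S a Da h g₀ g₁ N hr ha hh hg₀ hg₁ heqc heqs hNc hNs => ?_⟩
  have hrR : r ≤ R := by linarith
  have key := hC₁ R r A S a Da h g₀ g₁ N hr ha hh hg₀ hg₁ heqc heqs hNc hNs
  refine (hC₄ h (ball 0 r) hh.meas.measurable).trans ?_
  push_cast
  rw [mul_assoc, add_mul, mul_assoc (C₂ : ℝ≥0∞)]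
  refine mul_le_mul' le_rfl (add_le_add ?_ ?_)
  · refine (hC₂ r S h (hh.mono hrR)).trans (mul_le_mul' le_rfl ?_)
    refine (lintegral_mono key).trans_eq ?_
    rw [lintegral_const_mul' _ _ ENNReal.coe_ne_top, lintegral_add_right, lintegral_add_right,
      lintegral_add_right, hh.lintegral_sliceEnergy, hg₁.lintegral_sliceEnergy,
      hg₀.lintegral_sliceEnergy]
    · exact hg₁.measurable_sliceEnergy
    · exact hg₀.measurable_sliceEnergy
    · exact (hh.measurable_sliceEnergy.add hg₁.measurable_sliceEnergy).add
        hg₀.measurable_sliceEnergy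
  · refine (hC₃ r S h N (hh.mono hrR) hNc hNs).trans ?_
    refine mul_le_mul' le_rfl (add_le_add le_rfl ?_)
    rw [add_assoc]
    exact le_trans (lintegral_mono' (Measure.prod_mono le_rfl
      (Measure.restrict_mono (ball_subset_ball hrR) le_rfl)) le_rfl) le_self_add

end SlabEstimate
end Kinetic

namespace Kinetic
open Filter Topology Metric

/-! ### Velocity regularity passed to the transforms. -/

section VelocityRegularity
variable {W : Type*} [NormedAddCommGroup W] [InnerProductSpace ℝ W] [FiniteDimensional ℝ W]
  [MeasurableSpace W] [BorelSpace W]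
variable {V : Type*} [NormedAddCommGroup V] [InnerProductSpace ℝ V] [FiniteDimensional ℝ V]
  [MeasurableSpace V] [BorelSpace V]
variable {R S r δ ε₀ : ℝ} {h : W × V → ℝ} {D : W × V → V}

theorem IncrementBound.mono {u : V → ℝ} {N N' : ℝ≥0∞} (hu : IncrementBound δ r ε₀ u N)
    (hN : N ≤ N') : IncrementBound δ r ε₀ u N' := fun ε hε hεε =>
  (hu ε hε hεε).trans (mul_le_mul' le_rfl hN)

/-- N ζ is the Gagliardo energy in v of the two transforms together; its integral over ζ is computed
by `IsSlabL2.plancherel_increment`. -/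
theorem IsSlabL2.exists_incrementBound_of_gagliardo (hh : IsSlabL2 R S h) (hδ : 0 < δ)
    (hr : r ≤ R) (hε₀ : r + ε₀ ≤ R) :
    ∃ N : W → ℝ≥0∞,
      (∀ ζ, IncrementBound δ r ε₀ (fun v => cosT (fun p => h (p, v)) ζ) (N ζ)) ∧
      (∀ ζ, IncrementBound δ r ε₀ (fun v => sinT (fun p => h (p, v)) ζ) (N ζ)) ∧
      ∫⁻ ζ, N ζ = ∫⁻ v in ball (0 : V) R, ∫⁻ w in ball (0 : V) R,
          ENNReal.ofReal ((‖v - w‖ ^ (Module.finrank ℝ V + 2 * δ))⁻¹) *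
            ∫⁻ q, ‖h (q, v) - h (q, w)‖ₑ ^ 2 := by
  have hκ : Measurable fun x : V × V =>
    ENNReal.ofReal ((‖x.1 - x.2‖ ^ (Module.finrank ℝ V + 2 * δ))⁻¹) := by fun_prop
  refine ⟨_, fun ζ => ?_, fun ζ => ?_, hh.plancherel_increment le_rfl
    (κ := fun v w => ENNReal.ofReal ((‖v - w‖ ^ (Module.finrank ℝ V + 2 * δ))⁻¹)) hκ⟩
  · refine incrementBound_of_gagliardo hε₀ hδ hr (lintegral_mono fun v => lintegral_mono fun w => ?_)
    exact mul_le_mul' le_rfl le_self_add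
  · refine incrementBound_of_gagliardo hε₀ hδ hr (lintegral_mono fun v => lintegral_mono fun w => ?_)
    exact mul_le_mul' le_rfl le_add_self

/-- The weak velocity gradient, tested against products of smooth functions. -/
def HasSplitGradient (R : ℝ) (h : W × V → ℝ) (D : W × V → V) (c : W → ℝ) : Prop :=
  ∀ ψ : V → ℝ, IsTest (ball 0 R) ψ → ∀ e : V,
    ∫ z, c z.1 * (fderiv ℝ ψ z.2 e * h z)
        ∂((volume : Measure W).prod (volume.restrict (ball (0 : V) R)))
      = - ∫ z, c z.1 * (ψ z.2 * inner ℝ e (D z))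
          ∂((volume : Measure W).prod (volume.restrict (ball (0 : V) R)))

/-- The transform in p commutes with the weak gradient in v, so the transform of D is a weak
derivative of the transform of h and `incrementBound_of_hasWeakDeriv` applies. -/
theorem IsSlabL2.incrementBound_transform (hh : IsSlabL2 R S h) (hD : IsSlabL2 R S D)
    (hε₀ : r + ε₀ ≤ R) {τ : W → ℝ} (hτ : Continuous τ) (hτ1 : ∀ p, |τ p| ≤ 1)
    (hw : HasSplitGradient R h D τ) :
    IncrementBound 1 r ε₀ (fun v => ∫ p, τ p • h (p, v))
      (volume (ball (0 : V) 1) * ∫⁻ v in ball (0 : V) R, ‖∫ p, τ p • D (p, v)‖ₑ ^ 2) := by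
  have hfin : IsFiniteMeasure (volume.restrict (ball (0 : V) R)) :=
    ⟨by simpa using measure_ball_lt_top⟩
  have hDm : StronglyMeasurable fun v => innerSL ℝ (∫ p, τ p • D (p, v)) :=
    (innerSL ℝ).continuous.comp_stronglyMeasurable (hD.stronglyMeasurable_transform hτ)
  have hnorm : ∀ v, ‖innerSL ℝ (∫ p, τ p • D (p, v))‖ₑ = ‖∫ p, τ p • D (p, v)‖ₑ := fun v => by
    rw [← ofReal_norm, innerSL_apply_norm, ofReal_norm]
  have hD2 : MemLp (fun v => innerSL ℝ (∫ p, τ p • D (p, v))) 2 (volume.restrict (ball 0 R)) := by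
    rw [memLp_two_iff hDm.aestronglyMeasurable]
    simp only [hnorm]
    exact (memLp_two_iff (hD.stronglyMeasurable_transform hτ).aestronglyMeasurable).1
      (hD.memLp_transform hτ hτ1)
  have key := incrementBound_of_hasWeakDeriv hε₀ (hh.stronglyMeasurable_transform hτ).measurable
    ((hh.memLp_transform hτ hτ1).integrable (by norm_num)) hDm hD2 ?_
  · simpa only [hnorm] using key
  intro φ hφ e
  set Id := ContinuousLinearMap.id ℝ ℝ
  have hφd : Continuous fun v => fderiv ℝ φ v e :=
    (hφ.smooth.continuous_fderiv (by simp)).clm_apply continuous_const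
  obtain ⟨c, hc⟩ := ((hφ.compact.fderiv_apply (𝕜 := ℝ) e)).exists_bound_of_continuous hφd
  obtain ⟨c', hc'⟩ := hφ.compact.exists_bound_of_continuous hφ.smooth.continuous
  have e1 := hh.integral_mul_clm hτ hτ1 (A := fun v => fderiv ℝ φ v e • Id)
    (hφd.stronglyMeasurable.smul stronglyMeasurable_const) (c := c) (fun v => by
      rw [norm_smul, ContinuousLinearMap.norm_id, mul_one]; exact hc v)
  have e2 := hD.integral_mul_clm hτ hτ1 (A := fun v => φ v • innerSL ℝ e)
    (hφ.smooth.continuous.stronglyMeasurable.smul stronglyMeasurable_const) (c := c' * ‖e‖)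
    (fun v => by
      rw [norm_smul, innerSL_apply_norm]
      gcongr
      exact hc' v)
  simp only [Id, _root_.smul_apply, ContinuousLinearMap.id_apply, smul_eq_mul,
    innerSL_apply_apply] at e1 e2 ⊢
  rw [← e1, hw φ hφ e, e2]
  simp only [real_inner_comm]

theorem IsSlabL2.exists_incrementBound_of_gradient (hh : IsSlabL2 R S h) (hD : IsSlabL2 R S D)
    (hε₀ : r + ε₀ ≤ R)
    (hwc : ∀ ζ, HasSplitGradient R h D fun p => Real.cos (2 * Real.pi * inner ℝ p ζ))
    (hws : ∀ ζ, HasSplitGradient R h D fun p => Real.sin (2 * Real.pi * inner ℝ p ζ)) :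
    ∃ N : W → ℝ≥0∞,
      (∀ ζ, IncrementBound 1 r ε₀ (fun v => cosT (fun p => h (p, v)) ζ) (N ζ)) ∧
      (∀ ζ, IncrementBound 1 r ε₀ (fun v => sinT (fun p => h (p, v)) ζ) (N ζ)) ∧
      ∫⁻ ζ, N ζ = volume (ball (0 : V) 1) * slabEnergy R D := by
  refine ⟨fun ζ => volume (ball (0 : V) 1) * sliceEnergy R D ζ, fun ζ => ?_, fun ζ => ?_, ?_⟩
  · exact (hh.incrementBound_transform hD hε₀ (by fun_prop) (abs_phase_le_one ζ).1 (hwc ζ)).mono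
      (mul_le_mul' le_rfl le_self_add)
  · exact (hh.incrementBound_transform hD hε₀ (by fun_prop) (abs_phase_le_one ζ).2 (hws ζ)).mono
      (mul_le_mul' le_rfl le_add_self)
  · rw [lintegral_const_mul' _ _ measure_ball_lt_top.ne, hD.lintegral_sliceEnergy]

end VelocityRegularity
end Kinetic

namespace Kinetic
open Filter Topology Metric

/-! ### Cutoff in p, its commutator, and its removal. -/

section Truncation
variable {W : Type*} [NormedAddCommGroup W] [InnerProductSpace ℝ W] [FiniteDimensional ℝ W]
  [MeasurableSpace W] [BorelSpace W]
variable {V : Type*} [NormedAddCommGroup V] [InnerProductSpace ℝ V] [FiniteDimensional ℝ V]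
  [MeasurableSpace V] [BorelSpace V]
variable {F F' : Type*} [NormedAddCommGroup F] [InnerProductSpace ℝ F] [FiniteDimensional ℝ F]
  [NormedAddCommGroup F'] [InnerProductSpace ℝ F'] [FiniteDimensional ℝ F']
variable {R S r : ℝ}

theorem slabEnergy_le_of_bound {G : W × V → F} {H : W × V → F'} {k : ℝ≥0}
    (hb : ∀ z, ‖G z‖ ≤ k * ‖H z‖) : slabEnergy R G ≤ (k ^ 2 : ℝ≥0) * slabEnergy R H := by
  rw [slabEnergy, slabEnergy, ← lintegral_const_mul' _ _ ENNReal.coe_ne_top]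
  refine lintegral_mono fun z => ?_
  have h1 : ‖G z‖ₑ ≤ k * ‖H z‖ₑ := by
    rw [← ofReal_norm, ← ofReal_norm, ← ENNReal.ofReal_coe_nnreal, ← ENNReal.ofReal_mul (by simp)]
    exact ENNReal.ofReal_le_ofReal (hb z)
  calc _ ≤ ((k : ℝ≥0∞) * ‖H z‖ₑ) ^ 2 := by gcongr
    _ = _ := by push_cast; ring

theorem slabEnergy_mono {G : W × V → F} {H : W × V → F'} (hb : ∀ z, ‖G z‖ ≤ ‖H z‖) :
    slabEnergy R G ≤ slabEnergy R H := by
  simpa using slabEnergy_le_of_bound (R := R) (k := 1) (by simpa using hb)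

theorem isSlabL2_of_bound {G : W × V → F} {H : W × V → F'} (hG : StronglyMeasurable G)
    (hH : MemLp H 2 ((volume : Measure W).prod (volume.restrict (ball (0 : V) R)))) (k : ℝ)
    (hb : ∀ z, ‖G z‖ ≤ k * ‖H z‖) (hs : ∀ z, S < ‖z.1‖ → G z = 0) : IsSlabL2 R S G :=
  ⟨hG, hH.of_le_mul hG.aestronglyMeasurable (Eventually.of_forall hb), hs⟩

-- Dilating one bump by n + 1 keeps the gradients bounded uniformly in n. Vanishing is required on
-- the open set beyond S n, so the gradient vanishes there as well.
variable (W) in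
theorem exists_cutoff : ∃ (B : ℝ≥0) (χ : ℕ → W → ℝ) (S : ℕ → ℝ),
    (∀ n, ContDiff ℝ ∞ (χ n)) ∧ (∀ n, HasCompactSupport (χ n)) ∧ (∀ n p, |χ n p| ≤ 1) ∧
    (∀ n p, ‖fderiv ℝ (χ n) p‖ ≤ B) ∧ (∀ n p, S n < ‖p‖ → χ n p = 0 ∧ fderiv ℝ (χ n) p = 0) ∧
    ∀ p, ∀ᶠ n in atTop, χ n p = 1 := by
  let f : ContDiffBump (0 : W) := ⟨1, 2, by norm_num, by norm_num⟩
  have hfs : ContDiff ℝ ∞ (f : W → ℝ) := f.contDiff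
  obtain ⟨B, hB⟩ := (f.hasCompactSupport.fderiv ℝ).exists_bound_of_continuous
    (hfs.continuous_fderiv (by simp))
  have hB0 : 0 ≤ B := (norm_nonneg _).trans (hB 0)
  have hsm : ∀ n : ℕ, ContDiff ℝ ∞ fun p : W => f ((n + 1 : ℝ)⁻¹ • p) := fun n =>
    hfs.comp (by fun_prop)
  have hz : ∀ (n : ℕ) (p : W), 2 * (n + 1 : ℝ) < ‖p‖ → f ((n + 1 : ℝ)⁻¹ • p) = 0 := by
    intro n p hp
    refine f.zero_of_le_dist ?_
    rw [dist_zero_right, norm_smul, norm_inv, Real.norm_of_nonneg (by positivity)]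
    change 2 ≤ _
    rw [le_inv_mul_iff₀ (by positivity)]
    linarith
  refine ⟨⟨B, hB0⟩, fun n p => f ((n + 1 : ℝ)⁻¹ • p), fun n => 2 * (n + 1), hsm, fun n => ?_,
    fun n p => ?_, fun n p => ?_, fun n p hp => ⟨hz n p hp, ?_⟩, fun p => ?_⟩
  · exact f.hasCompactSupport.comp_smul (by positivity)
  · rw [abs_of_nonneg f.nonneg]
    exact f.le_one
  · have h1 : HasFDerivAt (fun p : W => f ((n + 1 : ℝ)⁻¹ • p))
        ((n + 1 : ℝ)⁻¹ • fderiv ℝ f ((n + 1 : ℝ)⁻¹ • p)) p := by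
      have h2 := ((hfs.differentiable (by simp)) ((n + 1 : ℝ)⁻¹ • p)).hasFDerivAt
      have h3 := h2.comp p ((hasFDerivAt_id p).const_smul ((n + 1 : ℝ)⁻¹))
      refine h3.congr_fderiv ?_
      ext w
      simp
    rw [h1.fderiv, norm_smul, norm_inv, Real.norm_of_nonneg (by positivity)]
    have h4 : (n + 1 : ℝ)⁻¹ ≤ 1 := inv_le_one_of_one_le₀ (by linarith [n.cast_nonneg (α := ℝ)])
    calc _ ≤ 1 * ‖fderiv ℝ f ((n + 1 : ℝ)⁻¹ • p)‖ := by gcongr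
      _ ≤ B := by rw [one_mul]; exact hB _
  · have : (fun p : W => f ((n + 1 : ℝ)⁻¹ • p)) =ᶠ[𝓝 p] fun _ => 0 := by
      filter_upwards [(isOpen_lt continuous_const continuous_norm).mem_nhds hp] with q hq
      exact hz n q hq
    rw [this.fderiv_eq]
    simp
  · obtain ⟨m, hm⟩ := exists_nat_gt ‖p‖
    filter_upwards [eventually_ge_atTop m] with n hn
    refine f.one_of_mem_closedBall ?_
    rw [mem_closedBall_zero_iff, norm_smul, norm_inv, Real.norm_of_nonneg (by positivity)]
    change _ ≤ (1 : ℝ)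
    rw [inv_mul_le_iff₀ (by positivity)]
    have : (m : ℝ) ≤ n := by exact_mod_cast hn
    linarith

/-- Testing the original equation with χc is testing the truncated one with c, once the derivative
of χ along a is counted as a source. Hence c may be a phase, which has no compact support. -/
theorem SolvesSplit.cutoff {α A : ℝ} {K Ma Bv : ℝ≥0} {a : V → W} {Da : V → V →L[ℝ] W}
    (ha : IsNondegenerateField R α K Ma Bv A a Da) {h g₀ : W × V → ℝ} {g₁ : W × V → V}
    {χ c : W → ℝ} (hχ : ContDiff ℝ ∞ χ) (hc : ContDiff ℝ ∞ c) (hc1 : ∀ p, |c p| ≤ 1) {L : ℝ}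
    (hcL : ∀ p, ‖fderiv ℝ c p‖ ≤ L)
    (hh : IsSlabL2 R S fun z => χ z.1 * h z) (hg₀ : IsSlabL2 R S fun z => χ z.1 * g₀ z)
    (hh' : IsSlabL2 R S fun z => fderiv ℝ χ z.1 (a z.2) * h z)
    (heq : SolvesSplit R a h g₀ g₁ fun p => χ p * c p) :
    SolvesSplit R a (fun z => χ z.1 * h z)
      (fun z => χ z.1 * g₀ z + fderiv ℝ χ z.1 (a z.2) * h z) (fun z => χ z.1 • g₁ z) c := by
  intro ψ hψ
  obtain ⟨k, hk⟩ := hψ.compact.exists_bound_of_continuous hψ.smooth.continuous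
  have hcm : AEStronglyMeasurable (fun z : W × V => c z.1 * ψ z.2)
      ((volume : Measure W).prod (volume.restrict (ball (0 : V) R))) :=
    ((hc.continuous.comp continuous_fst).mul
      (hψ.smooth.continuous.comp continuous_snd)).aestronglyMeasurable
  have hcψ : ∀ z : W × V, ‖c z.1 * ψ z.2‖ ≤ 1 * k := fun z => by
    rw [norm_mul]
    exact mul_le_mul (hc1 _) (hk _) (norm_nonneg _) zero_le_one
  have hdm : AEStronglyMeasurable (fun z : W × V => fderiv ℝ c z.1 (a z.2) * ψ z.2)
      ((volume : Measure W).prod (volume.restrict (ball (0 : V) R))) := by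
    refine AEStronglyMeasurable.mul ?_
      (hψ.smooth.continuous.comp continuous_snd).aestronglyMeasurable
    exact aestronglyMeasurable_clm_apply
      ((hc.continuous_fderiv (by simp)).comp continuous_fst).aestronglyMeasurable
      (ha.meas.comp_measurable measurable_snd).aestronglyMeasurable
  have hdψ : ∀ z : W × V, ‖fderiv ℝ c z.1 (a z.2) * ψ z.2‖ ≤ L * A * k := fun z => by
    rw [norm_mul]
    have h1 : ‖fderiv ℝ c z.1 (a z.2)‖ ≤ L * A :=
      (ContinuousLinearMap.le_opNorm _ _).trans
        (mul_le_mul (hcL _) (ha.bound _) (norm_nonneg _) ((norm_nonneg _).trans (hcL 0)))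
    exact mul_le_mul h1 (hk _) (norm_nonneg _) ((norm_nonneg _).trans h1)
  have i1 : Integrable (fun z => (χ z.1 * g₀ z) * (c z.1 * ψ z.2))
      ((volume : Measure W).prod (volume.restrict (ball (0 : V) R))) :=
    hg₀.integrable.mul_bdd hcm (Eventually.of_forall hcψ)
  have i2 : Integrable (fun z => (fderiv ℝ χ z.1 (a z.2) * h z) * (c z.1 * ψ z.2))
      ((volume : Measure W).prod (volume.restrict (ball (0 : V) R))) :=
    hh'.integrable.mul_bdd hcm (Eventually.of_forall hcψ)
  have i3 : Integrable (fun z => (χ z.1 * h z) * (fderiv ℝ c z.1 (a z.2) * ψ z.2))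
      ((volume : Measure W).prod (volume.restrict (ball (0 : V) R))) :=
    hh.integrable.mul_bdd hdm (Eventually.of_forall hdψ)
  have hd : ∀ p w, fderiv ℝ (fun p => χ p * c p) p w
      = χ p * fderiv ℝ c p w + fderiv ℝ χ p w * c p := by
    intro p w
    rw [fderiv_fun_mul (hχ.differentiable (by simp) p) (hc.differentiable (by simp) p)]
    simp
    ring
  have h0 := heq ψ hψ
  simp only [hd] at h0
  have e1 : ∀ z : W × V, h z * ((χ z.1 * fderiv ℝ c z.1 (a z.2)
      + fderiv ℝ χ z.1 (a z.2) * c z.1) * ψ z.2)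
      = (χ z.1 * h z) * (fderiv ℝ c z.1 (a z.2) * ψ z.2)
        + (fderiv ℝ χ z.1 (a z.2) * h z) * (c z.1 * ψ z.2) := fun z => by ring
  have e2 : ∀ z : W × V, g₀ z * (χ z.1 * c z.1 * ψ z.2) = (χ z.1 * g₀ z) * (c z.1 * ψ z.2) :=
    fun z => by ring
  have e3 : ∀ z : W × V, χ z.1 * c z.1 * fderiv ℝ ψ z.2 (g₁ z)
      = c z.1 * fderiv ℝ ψ z.2 (χ z.1 • g₁ z) := fun z => by
    rw [map_smul, smul_eq_mul]; ring
  simp only [e1, e2, e3] at h0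
  rw [integral_add i3 i2] at h0
  simp only [add_mul]
  rw [integral_add i1 i2]
  linarith

/-- No commutator arises, because χ does not depend on v. -/
theorem HasSplitGradient.cutoff {h : W × V → ℝ} {D : W × V → V} {χ c : W → ℝ}
    (hw : HasSplitGradient R h D fun p => χ p * c p) :
    HasSplitGradient R (fun z => χ z.1 * h z) (fun z => χ z.1 • D z) c := by
  intro ψ hψ e
  have h0 := hw ψ hψ e
  have e1 : ∀ z : W × V, χ z.1 * c z.1 * (fderiv ℝ ψ z.2 e * h z)
      = c z.1 * (fderiv ℝ ψ z.2 e * (χ z.1 * h z)) := fun z => by ring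
  have e2 : ∀ z : W × V, χ z.1 * c z.1 * (ψ z.2 * inner ℝ e (D z))
      = c z.1 * (ψ z.2 * inner ℝ e (χ z.1 • D z)) := fun z => by
    rw [inner_smul_right]; ring
  simpa only [e1, e2] using h0

theorem IsSlabL2.add {G H : W × V → F} (hG : IsSlabL2 R S G) (hH : IsSlabL2 R S H) :
    IsSlabL2 R S fun z => G z + H z :=
  ⟨hG.meas.add hH.meas, hG.memLp.add hH.memLp, fun z hz => by
    rw [hG.supp z hz, hH.supp z hz, add_zero]⟩

theorem IsSlabL2.slabEnergy_add_le {G H : W × V → F} (hG : IsSlabL2 R S G) :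
    slabEnergy R (fun z => G z + H z) ≤ 2 * (slabEnergy R G + slabEnergy R H) := by
  rw [slabEnergy, slabEnergy, slabEnergy, ← lintegral_add_left (hG.meas.enorm.pow_const 2),
    ← lintegral_const_mul' _ _ (by simp)]
  exact lintegral_mono fun z => enorm_add_sq_le _ _

/-- A bound `Q` on the square of the `H^δ_v(B_R)` seminorm of `h`. -/
def HasVelocityBound (δ R : ℝ) (h : W × V → ℝ) (Q : ℝ≥0∞) : Prop :=
  (δ < 1 ∧ ∫⁻ v in ball (0 : V) R, ∫⁻ w in ball (0 : V) R,
      ENNReal.ofReal ((‖v - w‖ ^ (Module.finrank ℝ V + 2 * δ))⁻¹) *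
        ∫⁻ q, ‖h (q, v) - h (q, w)‖ₑ ^ 2 ≤ Q) ∨
  (δ = 1 ∧ ∃ D : W × V → V, StronglyMeasurable D ∧
    MemLp D 2 ((volume : Measure W).prod (volume.restrict (ball (0 : V) R))) ∧
    (∀ c : W → ℝ, ContDiff ℝ ∞ c → HasCompactSupport c → HasSplitGradient R h D c) ∧
    slabEnergy R D ≤ Q)

theorem contDiff_cos_phase (ζ : W) :
    ContDiff ℝ ∞ fun p : W => Real.cos (2 * Real.pi * inner ℝ p ζ) :=
  Real.contDiff_cos.comp (contDiff_const.mul (contDiff_id.inner ℝ contDiff_const))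

theorem contDiff_sin_phase (ζ : W) :
    ContDiff ℝ ∞ fun p : W => Real.sin (2 * Real.pi * inner ℝ p ζ) :=
  Real.contDiff_sin.comp (contDiff_const.mul (contDiff_id.inner ℝ contDiff_const))

theorem HasVelocityBound.exists_incrementBound {δ ε₀ : ℝ} {h : W × V → ℝ} {Q : ℝ≥0∞}
    (hQ : HasVelocityBound δ R h Q) (hδ : 0 < δ) (hr : r ≤ R) (hε₀ : r + ε₀ ≤ R) {χ : W → ℝ}
    (hχ : ContDiff ℝ ∞ χ) (hχc : HasCompactSupport χ) (hχ1 : ∀ p, |χ p| ≤ 1)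
    (hχS : ∀ p, S < ‖p‖ → χ p = 0) (hh : IsSlabL2 R S fun z => χ z.1 * h z) :
    ∃ N : W → ℝ≥0∞,
      (∀ ζ, IncrementBound δ r ε₀ (fun v => cosT (fun p => χ p * h (p, v)) ζ) (N ζ)) ∧
      (∀ ζ, IncrementBound δ r ε₀ (fun v => sinT (fun p => χ p * h (p, v)) ζ) (N ζ)) ∧
      ∫⁻ ζ, N ζ ≤ (1 + volume (ball (0 : V) 1)) * Q := by
  rcases hQ with ⟨-, hQ⟩ | ⟨rfl, D, hDm, hD2, hDw, hDQ⟩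
  · obtain ⟨N, hc, hs, hN⟩ := hh.exists_incrementBound_of_gagliardo hδ hr hε₀
    refine ⟨N, hc, hs, ?_⟩
    rw [hN]
    refine le_trans ?_ (hQ.trans (le_mul_of_one_le_left zero_le le_self_add))
    refine lintegral_mono fun v => lintegral_mono fun w => mul_le_mul' le_rfl
      (lintegral_mono fun q => ?_)
    simp only []
    rw [← mul_sub, enorm_mul]
    refine pow_le_pow_left₀ zero_le (mul_le_of_le_one_left zero_le ?_) 2
    rw [← ofReal_norm, ENNReal.ofReal_le_one]
    exact hχ1 q
  · have hχD : ∀ z : W × V, ‖χ z.1 • D z‖ ≤ ‖D z‖ := fun z => by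
      rw [norm_smul]
      exact mul_le_of_le_one_left (norm_nonneg _) (hχ1 _)
    have hD : IsSlabL2 R S fun z => χ z.1 • D z :=
      isSlabL2_of_bound ((hχ.continuous.comp continuous_fst).stronglyMeasurable.smul hDm) hD2 1
        (by simpa using hχD) (fun z hz => by rw [hχS _ hz, zero_smul])
    obtain ⟨N, hc, hs, hN⟩ := hh.exists_incrementBound_of_gradient hD hε₀
      (fun ζ => (hDw _ (hχ.mul (contDiff_cos_phase ζ)) hχc.mul_right).cutoff)
      (fun ζ => (hDw _ (hχ.mul (contDiff_sin_phase ζ)) hχc.mul_right).cutoff)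
    refine ⟨N, hc, hs, ?_⟩
    rw [hN]
    exact mul_le_mul' le_add_self ((slabEnergy_mono hχD).trans hDQ)

theorem norm_fderiv_phase_le (ζ : W) :
    (∀ p, ‖fderiv ℝ (fun p : W => Real.cos (2 * Real.pi * inner ℝ p ζ)) p‖
      ≤ 2 * Real.pi * ‖ζ‖) ∧
    ∀ p, ‖fderiv ℝ (fun p : W => Real.sin (2 * Real.pi * inner ℝ p ζ)) p‖
      ≤ 2 * Real.pi * ‖ζ‖ := by
  have key : ∀ (x : ℝ) (w : W), |x| ≤ 1 →
      |x * (2 * Real.pi * inner ℝ w ζ)| ≤ 2 * Real.pi * ‖ζ‖ * ‖w‖ := by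
    intro x w hx
    rw [abs_mul, abs_mul, abs_of_pos (by positivity : 0 < 2 * Real.pi)]
    calc _ ≤ 1 * (2 * Real.pi * (‖w‖ * ‖ζ‖)) := by
          gcongr
          exact abs_real_inner_le_norm _ _
      _ = _ := by ring
  refine ⟨fun p => ContinuousLinearMap.opNorm_le_bound _ (by positivity) fun w => ?_,
    fun p => ContinuousLinearMap.opNorm_le_bound _ (by positivity) fun w => ?_⟩
  · rw [fderiv_cos_phase, norm_neg, Real.norm_eq_abs]
    exact key _ _ (Real.abs_sin_le_one _)
  · rw [fderiv_sin_phase, Real.norm_eq_abs]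
    exact key _ _ (Real.abs_cos_le_one _)

/-- The cutoff integrands are eventually equal to the limiting one at each pair of points, so
Fatou's lemma, once in each variable, gives the bound. -/
theorem slabGagliardo_le_of_tendsto {γ : ℝ} {h : W × V → ℝ} (hh : Measurable h) {χ : ℕ → W → ℝ}
    (hχ : ∀ n, Continuous (χ n)) (hχ1 : ∀ p, ∀ᶠ n in atTop, χ n p = 1) {M : ℝ≥0∞}
    (hM : ∀ n, slabGagliardo γ r (fun z : W × V => χ n z.1 * h z) ≤ M) :
    slabGagliardo γ r h ≤ M := by
  set μ := (volume : Measure W).prod (volume.restrict (ball (0 : V) r)) with hμ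
  set κ : (W × V) → (W × V) → ℝ≥0∞ := fun y z =>
    ENNReal.ofReal ((√(‖y.1 - z.1‖ ^ 2 + ‖y.2 - z.2‖ ^ 2)
      ^ ((Module.finrank ℝ W + Module.finrank ℝ V : ℝ) + 2 * γ))⁻¹) with hκ
  have hκm : Measurable fun x : (W × V) × (W × V) => κ x.1 x.2 := by
    simp only [hκ]
    fun_prop
  set Φ : ℕ → (W × V) × (W × V) → ℝ≥0∞ := fun n x =>
    κ x.1 x.2 * ‖χ n x.1.1 * h x.1 - χ n x.2.1 * h x.2‖ₑ ^ 2 with hΦ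
  have hΦm : ∀ n, Measurable (Φ n) := by
    intro n
    have h1 : Measurable fun z : W × V => χ n z.1 * h z :=
      ((hχ n).measurable.comp measurable_fst).mul hh
    exact hκm.mul (((h1.comp measurable_fst).sub (h1.comp measurable_snd)).enorm.pow_const 2)
  have hΦ2 : ∀ n y, Measurable fun z => Φ n (y, z) := fun n y =>
    (hΦm n).comp measurable_prodMk_left
  calc slabGagliardo γ r h ≤ ∫⁻ y, ∫⁻ z, liminf (fun n => Φ n (y, z)) atTop ∂μ ∂μ := by
        refine lintegral_mono fun y => lintegral_mono fun z => ?_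
        refine le_liminf_of_le (by isBoundedDefault) ?_
        filter_upwards [hχ1 y.1, hχ1 z.1] with n h1 h2
        simp only [hΦ, hκ, h1, h2, one_mul]
        exact le_rfl
    _ ≤ ∫⁻ y, liminf (fun n => ∫⁻ z, Φ n (y, z) ∂μ) atTop ∂μ :=
        lintegral_mono fun y => lintegral_liminf_le fun n => hΦ2 n y
    _ ≤ liminf (fun n => ∫⁻ y, ∫⁻ z, Φ n (y, z) ∂μ ∂μ) atTop :=
        lintegral_liminf_le fun n => (hΦm n).lintegral_prod_right'
    _ ≤ M := liminf_le_of_le (by isBoundedDefault) fun b hb => by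
        obtain ⟨n, hn⟩ := hb.exists
        exact hn.trans (hM n)

-- The slab estimate is applied to χ_n h with sources χ_n g₁ and χ_n g₀ plus the commutator. The
-- commutator is at most B A |h| whatever n is, so the constant is uniform and n can tend to
-- infinity.
variable (W V) in
theorem exists_cylinder_estimate {α δ ε₀ γ : ℝ} (hn : 1 ≤ Module.finrank ℝ W) (hα : 0 < α)
    (hα1 : α ≤ 1) (hδ : 0 < δ) (hδ1 : δ ≤ 1) (hε₀ : 0 < ε₀) (hε₀1 : ε₀ ≤ 1)
    (hγ : γ = 2 * α * δ / ((4 + α) * (2 + 2 * δ + Module.finrank ℝ V))) (K Ma Bv A : ℝ≥0) :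
    ∃ C : ℝ≥0, ∀ (R r : ℝ) (a : V → W) (Da : V → V →L[ℝ] W) (h g₀ : W × V → ℝ)
      (g₁ : W × V → V) (Q : ℝ≥0∞), r + ε₀ < R → IsNondegenerateField R α K Ma Bv A a Da →
      StronglyMeasurable h → StronglyMeasurable g₀ → StronglyMeasurable g₁ →
      MemLp h 2 ((volume : Measure W).prod (volume.restrict (ball (0 : V) R))) →
      MemLp g₀ 2 ((volume : Measure W).prod (volume.restrict (ball (0 : V) R))) →
      MemLp g₁ 2 ((volume : Measure W).prod (volume.restrict (ball (0 : V) R))) →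
      (∀ c : W → ℝ, ContDiff ℝ ∞ c → HasCompactSupport c → SolvesSplit R a h g₀ g₁ c) →
      HasVelocityBound δ R h Q →
      slabGagliardo γ r h ≤ C * (Q + (slabEnergy R h + slabEnergy R g₁ + slabEnergy R g₀)) := by
  obtain ⟨C, hC⟩ := exists_slab_estimate W V hn hα hα1 hδ hδ1 hε₀ hε₀1 hγ K Ma Bv
  obtain ⟨B, χ, S, hχ, hχc, hχ1, hχB, hχS, hχlim⟩ := exists_cutoff W
  refine ⟨C * ((1 + (volume (ball (0 : V) 1)).toNNReal) + (1 + 2 + 2 * (B * A) ^ 2)),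
    fun R r a Da h g₀ g₁ Q hr ha hhm hg₀m hg₁m hh2 hg₀2 hg₁2 heq hQ => ?_⟩
  refine slabGagliardo_le_of_tendsto hhm.measurable (fun n => (hχ n).continuous) hχlim fun n => ?_
  have hχm : StronglyMeasurable fun z : W × V => χ n z.1 :=
    ((hχ n).continuous.comp continuous_fst).stronglyMeasurable
  have bd : ∀ (z : W × V) (x : ℝ), ‖χ n z.1 * x‖ ≤ ‖x‖ := fun z x => by
    rw [norm_mul]
    exact mul_le_of_le_one_left (norm_nonneg _) (hχ1 n _)
  have bg₁ : ∀ z : W × V, ‖χ n z.1 • g₁ z‖ ≤ ‖g₁ z‖ := fun z => by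
    rw [norm_smul]
    exact mul_le_of_le_one_left (norm_nonneg _) (hχ1 n _)
  have hh : IsSlabL2 R (S n) fun z => χ n z.1 * h z :=
    isSlabL2_of_bound (hχm.mul hhm) hh2 1 (fun z => by simpa using bd z (h z))
      (fun z hz => by simp [(hχS n _ hz).1])
  have hg₀ : IsSlabL2 R (S n) fun z => χ n z.1 * g₀ z :=
    isSlabL2_of_bound (hχm.mul hg₀m) hg₀2 1 (fun z => by simpa using bd z (g₀ z))
      (fun z hz => by simp [(hχS n _ hz).1])
  have hg₁ : IsSlabL2 R (S n) fun z => χ n z.1 • g₁ z :=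
    isSlabL2_of_bound (hχm.smul hg₁m) hg₁2 1 (by simpa using bg₁)
      (fun z hz => by simp [(hχS n _ hz).1])
  have bd' : ∀ z : W × V, ‖fderiv ℝ (χ n) z.1 (a z.2) * h z‖ ≤ (B * A : ℝ≥0) * ‖h z‖ := by
    intro z
    rw [norm_mul]
    push_cast
    gcongr
    exact (ContinuousLinearMap.le_opNorm _ _).trans
      (mul_le_mul (hχB n _) (ha.bound _) (norm_nonneg _) B.2)
  have hcomm : StronglyMeasurable fun z : W × V => fderiv ℝ (χ n) z.1 (a z.2) := by
    have h1 : StronglyMeasurable fun z : W × V => (fderiv ℝ (χ n) z.1, a z.2) :=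
      (((hχ n).continuous_fderiv (by simp)).comp continuous_fst).stronglyMeasurable.prodMk
        (ha.meas.comp_measurable measurable_snd)
    exact isBoundedBilinearMap_apply.continuous.comp_stronglyMeasurable h1
  have hh' : IsSlabL2 R (S n) fun z => fderiv ℝ (χ n) z.1 (a z.2) * h z :=
    isSlabL2_of_bound (hcomm.mul hhm) hh2 _ bd' (fun z hz => by simp [(hχS n _ hz).2])
  obtain ⟨N, hNc, hNs, hN⟩ := hQ.exists_incrementBound (r := r) (ε₀ := ε₀) hδ (by linarith)
    (by linarith) (hχ n) (hχc n) (hχ1 n) (fun p hp => (hχS n p hp).1) hh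
  have key := hC R r A (S n) a Da _ _ _ N hr ha hh (hg₀.add hh') hg₁
    (fun ζ => (heq _ ((hχ n).mul (contDiff_cos_phase ζ)) (hχc n).mul_right).cutoff ha (hχ n)
      (contDiff_cos_phase ζ)
      (abs_phase_le_one ζ).1 (norm_fderiv_phase_le ζ).1 hh hg₀ hh')
    (fun ζ => (heq _ ((hχ n).mul (contDiff_sin_phase ζ)) (hχc n).mul_right).cutoff ha (hχ n)
      (contDiff_sin_phase ζ)
      (abs_phase_le_one ζ).2 (norm_fderiv_phase_le ζ).2 hh hg₀ hh') hNc hNs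
  refine key.trans ?_
  have E1 : slabEnergy R (fun z : W × V => χ n z.1 * h z) ≤ slabEnergy R h :=
    slabEnergy_mono fun z => bd z (h z)
  have E2 : slabEnergy R (fun z : W × V => χ n z.1 • g₁ z) ≤ slabEnergy R g₁ :=
    slabEnergy_mono bg₁
  have E3 : slabEnergy R (fun z : W × V => χ n z.1 * g₀ z) ≤ slabEnergy R g₀ :=
    slabEnergy_mono fun z => bd z (g₀ z)
  have E4 := slabEnergy_le_of_bound (R := R) bd'
  have hv : volume (ball (0 : V) 1) = ((volume (ball (0 : V) 1)).toNNReal : ℝ≥0∞) :=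
    (ENNReal.coe_toNNReal measure_ball_lt_top.ne).symm
  rw [hv] at hN
  push_cast at hN E4 ⊢
  rw [mul_assoc]
  refine mul_le_mul' le_rfl ?_
  set x := slabEnergy R h
  set y := slabEnergy R g₁
  set w := slabEnergy R g₀
  set k : ℝ≥0∞ := ((B : ℝ≥0∞) * A) ^ 2
  set q : ℝ≥0∞ := 1 + ((volume (ball (0 : V) 1)).toNNReal : ℝ≥0∞)
  calc _ ≤ q * Q + (x + y + 2 * (w + k * x)) := by
        refine add_le_add hN (add_le_add (add_le_add E1 E2) (hg₀.slabEnergy_add_le.trans ?_))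
        gcongr
    -- The added terms are exactly what is missing from the expanded product of the constant with Q
    -- + (x + y + w).
    _ ≤ q * Q + (x + y + 2 * (w + k * x)) + (q * (x + y + w)
          + (1 + 2 + 2 * k) * Q + (2 * x + 2 * y + w + 2 * k * y + 2 * k * w)) := le_self_add
    _ = _ := by ring

end Truncation
end Kinetic

namespace Kinetic
open Filter Topology Metric

/-! ### Identification of the phase space with (Euclidean space-time) × (velocities). -/

section PhaseSpace
variable {d₁ d₂ : ℕ} {R r : ℝ}

/-- Space-time `ℝ × ℝ^{d₁}` with its Euclidean norm. -/
abbrev SpaceTime (d₁ : ℕ) : Type := WithLp 2 (ℝ × E d₁)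

theorem finrank_spaceTime (d₁ : ℕ) : Module.finrank ℝ (SpaceTime d₁) = 1 + d₁ := by
  rw [(WithLp.linearEquiv 2 ℝ (ℝ × E d₁)).finrank_eq, Module.finrank_prod, Module.finrank_self,
    finrank_euclideanSpace_fin]

/-- The measurable identification of `(ℝ × ℝ^{d₁}) × ℝ^{d₂}` with the phase space. -/
def phaseEquiv (d₁ d₂ : ℕ) : SpaceTime d₁ × E d₂ ≃ᵐ Phase d₁ d₂ :=
  (MeasurableEquiv.prodCongr (MeasurableEquiv.toLp 2 (ℝ × E d₁)).symm
    (MeasurableEquiv.refl (E d₂))).trans MeasurableEquiv.prodAssoc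

theorem phaseEquiv_apply (p : SpaceTime d₁) (v : E d₂) :
    phaseEquiv d₁ d₂ (p, v) = (p.fst, p.snd, v) := rfl

theorem measurePreserving_phaseEquiv :
    MeasurePreserving (phaseEquiv d₁ d₂) (volume.prod volume) volume := by
  have h1 : MeasurePreserving (MeasurableEquiv.prodCongr (MeasurableEquiv.toLp 2 (ℝ × E d₁)).symm
      (MeasurableEquiv.refl (E d₂))) (volume.prod volume) (volume.prod volume) :=
    (WithLp.volume_preserving_ofLp ℝ (E d₁)).prod (MeasurePreserving.id volume)
  exact (measurePreserving_prodAssoc volume volume volume).comp h1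

theorem measurePreserving_phaseEquiv_cyl (d₁ d₂ : ℕ) (R : ℝ) :
    MeasurePreserving (phaseEquiv d₁ d₂)
      ((volume : Measure (SpaceTime d₁)).prod (volume.restrict (ball (0 : E d₂) R)))
      (cylMeasure d₁ d₂ R) := by
  have hm : MeasurableSet (cyl d₁ d₂ R) :=
    measurableSet_ball.preimage (by fun_prop : Measurable fun z : Phase d₁ d₂ => z.2.2)
  have h := (measurePreserving_phaseEquiv (d₁ := d₁) (d₂ := d₂)).restrict_preimage hm
  have h2 : phaseEquiv d₁ d₂ ⁻¹' cyl d₁ d₂ R = univ ×ˢ ball 0 R := by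
    ext ⟨p, v⟩
    simp [phaseEquiv_apply, cyl]
  rwa [h2, ← Measure.prod_restrict, Measure.restrict_univ] at h

theorem integral_phaseEquiv {F : Type*} [NormedAddCommGroup F] [NormedSpace ℝ F]
    (f : Phase d₁ d₂ → F) :
    ∫ z, f (phaseEquiv d₁ d₂ z)
        ∂((volume : Measure (SpaceTime d₁)).prod (volume.restrict (ball (0 : E d₂) R)))
      = ∫ z, f z ∂(cylMeasure d₁ d₂ R) :=
  (measurePreserving_phaseEquiv_cyl d₁ d₂ R).integral_comp (phaseEquiv d₁ d₂).measurableEmbedding f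

theorem lintegral_phaseEquiv (f : Phase d₁ d₂ → ℝ≥0∞) :
    ∫⁻ z, f (phaseEquiv d₁ d₂ z)
        ∂((volume : Measure (SpaceTime d₁)).prod (volume.restrict (ball (0 : E d₂) R)))
      = ∫⁻ z, f z ∂(cylMeasure d₁ d₂ R) :=
  (measurePreserving_phaseEquiv_cyl d₁ d₂ R).lintegral_comp_emb
    (phaseEquiv d₁ d₂).measurableEmbedding f

theorem lintegral_ofLp (f : ℝ × E d₁ → ℝ≥0∞) :
    ∫⁻ p : SpaceTime d₁, f (p.fst, p.snd) = ∫⁻ p, f p :=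
  (WithLp.volume_preserving_ofLp ℝ (E d₁)).lintegral_comp_emb
    (MeasurableEquiv.toLp 2 (ℝ × E d₁)).symm.measurableEmbedding f

/-- The projection of the phase space to space-time. -/
def toSpaceTime (d₁ d₂ : ℕ) : Phase d₁ d₂ →L[ℝ] SpaceTime d₁ :=
  (WithLp.prodContinuousLinearEquiv 2 ℝ ℝ (E d₁)).symm.toContinuousLinearMap ∘L
    ((ContinuousLinearMap.fst ℝ ℝ (E d₁ × E d₂)).prod
      (ContinuousLinearMap.fst ℝ (E d₁) (E d₂) ∘L ContinuousLinearMap.snd ℝ ℝ (E d₁ × E d₂)))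

/-- The projection of the phase space to the velocity. -/
def toVelocity (d₁ d₂ : ℕ) : Phase d₁ d₂ →L[ℝ] E d₂ :=
  ContinuousLinearMap.snd ℝ (E d₁) (E d₂) ∘L ContinuousLinearMap.snd ℝ ℝ (E d₁ × E d₂)

/-- Products c(t, x) ψ(v) are the only test functions the argument uses. Their support lies in the
continuous image of a product of compact sets. -/
theorem isTest_tensor {c : SpaceTime d₁ → ℝ} (hc : ContDiff ℝ ∞ c) (hcc : HasCompactSupport c)
    {ψ : E d₂ → ℝ} (hψ : IsTest (ball 0 R) ψ) :
    IsTest (cyl d₁ d₂ R) fun z => c (toSpaceTime d₁ d₂ z) * ψ z.2.2 := by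
  have hT : Continuous fun x : SpaceTime d₁ × E d₂ => ((x.1.fst, x.1.snd, x.2) : Phase d₁ d₂) := by
    fun_prop
  have hK := ((hcc.isCompact.prod hψ.compact.isCompact).image hT)
  have hsub : Function.support (fun z => c (toSpaceTime d₁ d₂ z) * ψ z.2.2)
      ⊆ (fun x : SpaceTime d₁ × E d₂ => ((x.1.fst, x.1.snd, x.2) : Phase d₁ d₂)) ''
        (tsupport c ×ˢ tsupport ψ) := by
    intro z hz
    rw [Function.mem_support, mul_ne_zero_iff] at hz
    exact ⟨(toSpaceTime d₁ d₂ z, z.2.2), ⟨subset_tsupport _ hz.1, subset_tsupport _ hz.2⟩, rfl⟩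
  refine ⟨?_, HasCompactSupport.of_support_subset_isCompact hK hsub, ?_⟩
  · exact (hc.comp (toSpaceTime d₁ d₂).contDiff).mul (hψ.smooth.comp (toVelocity d₁ d₂).contDiff)
  · refine (closure_minimal hsub hK.isClosed).trans ?_
    rintro _ ⟨x, hx, rfl⟩
    exact hψ.subset hx.2

theorem fderiv_tensor {c : SpaceTime d₁ → ℝ} (hc : ContDiff ℝ ∞ c) {ψ : E d₂ → ℝ}
    (hψ : ContDiff ℝ ∞ ψ) (z w : Phase d₁ d₂) :
    fderiv ℝ (fun z => c (toSpaceTime d₁ d₂ z) * ψ z.2.2) z w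
      = fderiv ℝ c (toSpaceTime d₁ d₂ z) (toSpaceTime d₁ d₂ w) * ψ z.2.2
        + c (toSpaceTime d₁ d₂ z) * fderiv ℝ ψ z.2.2 w.2.2 := by
  have h1 : HasFDerivAt (fun z => c (toSpaceTime d₁ d₂ z))
      (fderiv ℝ c (toSpaceTime d₁ d₂ z) ∘L toSpaceTime d₁ d₂) z :=
    (hc.differentiable (by simp) _).hasFDerivAt.comp z (toSpaceTime d₁ d₂).hasFDerivAt
  have h2 : HasFDerivAt (fun z : Phase d₁ d₂ => ψ z.2.2)
      (fderiv ℝ ψ z.2.2 ∘L toVelocity d₁ d₂) z :=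
    HasFDerivAt.comp z (hψ.differentiable (by simp) z.2.2).hasFDerivAt
      (toVelocity d₁ d₂).hasFDerivAt
  have h3 : HasFDerivAt (fun z => c (toSpaceTime d₁ d₂ z) * ψ z.2.2) _ z := h1.mul h2
  rw [h3.fderiv]
  simp [toVelocity]
  ring

end PhaseSpace
end Kinetic

namespace Kinetic
open Filter Topology Metric

/-! ### Nondegeneracy and regularity of the field (1, b). -/

section Field
variable {d₁ d₂ : ℕ} {R r : ℝ}

/-- The field `(1, b)` of the transport operator `∂_t + b · ∇_x`. -/
def spaceTimeField (b : E d₂ → E d₁) (v : E d₂) : SpaceTime d₁ := WithLp.toLp 2 (1, b v)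

/-- The inclusion of space in space-time. -/
def spaceInclusion (d₁ : ℕ) : E d₁ →L[ℝ] SpaceTime d₁ :=
  (WithLp.prodContinuousLinearEquiv 2 ℝ ℝ (E d₁)).symm.toContinuousLinearMap ∘L
    ContinuousLinearMap.inr ℝ ℝ (E d₁)

theorem spaceInclusion_apply (x : E d₁) : spaceInclusion d₁ x = WithLp.toLp 2 (0, x) := rfl

theorem norm_spaceInclusion_apply (x : E d₁) : ‖spaceInclusion d₁ x‖ = ‖x‖ := by
  rw [← sq_eq_sq₀ (norm_nonneg _) (norm_nonneg _), WithLp.prod_norm_sq_eq_of_L2]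
  simp [spaceInclusion_apply]

theorem spaceTimeField_eq (b : E d₂ → E d₁) (v : E d₂) :
    spaceTimeField b v = WithLp.toLp 2 ((1 : ℝ), (0 : E d₁)) + spaceInclusion d₁ (b v) := by
  rw [spaceInclusion_apply, ← WithLp.toLp_add]
  simp [spaceTimeField]

theorem norm_spaceTimeField_le {b : E d₂ → E d₁} {M₀ : ℝ≥0} (hb : ∀ v, ‖b v‖ ≤ M₀) (v : E d₂) :
    ‖spaceTimeField b v‖ ≤ (1 + M₀ : ℝ≥0) := by
  have h1 : ‖(WithLp.toLp 2 ((1 : ℝ), (0 : E d₁)))‖ = 1 := by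
    rw [← sq_eq_sq₀ (norm_nonneg _) zero_le_one, WithLp.prod_norm_sq_eq_of_L2]
    simp
  rw [spaceTimeField_eq]
  refine (norm_add_le _ _).trans ?_
  rw [h1, norm_spaceInclusion_apply]
  push_cast
  linarith [hb v]

theorem inner_spaceTimeField (b : E d₂ → E d₁) (ζ : SpaceTime d₁) (v : E d₂) :
    inner ℝ (spaceTimeField b v) ζ = ζ.fst + inner ℝ (b v) ζ.snd := by
  rw [WithLp.prod_inner_apply]
  simp [spaceTimeField]

/-- This is the weak derivative of the constant first component of (1, b). -/
theorem setIntegral_fderiv_eq_zero {φ : E d₂ → ℝ} (hφ : IsTest (ball 0 R) φ) (e : E d₂) :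
    ∫ v in ball 0 R, fderiv ℝ φ v e = 0 := by
  have hc : Continuous fun v => fderiv ℝ φ v e :=
    (hφ.smooth.continuous_fderiv (by simp)).clm_apply continuous_const
  have h1 : ∫ v in ball 0 R, fderiv ℝ φ v e = ∫ v, fderiv ℝ φ v e := by
    refine setIntegral_eq_integral_of_forall_compl_eq_zero fun v hv => ?_
    have : v ∉ tsupport (fderiv ℝ φ) := fun h => hv (hφ.subset (tsupport_fderiv_subset ℝ h))
    rw [image_eq_zero_of_notMem_tsupport this]
    rfl
  have h2 := integral_mul_fderiv_eq_neg_fderiv_mul_of_integrable (μ := (volume : Measure (E d₂)))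
    (f := fun _ => (1 : ℝ)) (g := φ) (v := e) (by simp)
    (by simpa using hc.integrable_of_hasCompactSupport (hφ.compact.fderiv_apply (𝕜 := ℝ) e))
    (by simpa using hφ.smooth.continuous.integrable_of_hasCompactSupport hφ.compact)
    (by simp) (fun x _ => hφ.smooth.differentiable (by simp) x)
  rw [h1]
  simpa using h2

/-- At level 1 + M₀ the sublevel set of b·ν is the whole ball. Thus the volume of B_R is controlled
by K, α and M₀, and R itself drops out of the constants. -/
theorem volume_ball_le_of_nondegenerate (hd₁ : 0 < d₁) {K α : ℝ} {M₀ : ℝ≥0} {b : E d₂ → E d₁}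
    (hb : ∀ v, ‖b v‖ ≤ M₀) (hnd : Nondegenerate R K α b) :
    volume (ball (0 : E d₂) R) ≤ ENNReal.ofReal (K * (1 + M₀) ^ α) := by
  have : Nonempty (Fin d₁) := ⟨⟨0, hd₁⟩⟩
  obtain ⟨ν, hν⟩ := exists_norm_eq (E d₁) zero_le_one
  refine (measure_mono fun v hv => ?_).trans (hnd 0 ν hν (1 + M₀) (by positivity))
  refine ⟨hv, ?_⟩
  rw [zero_add]
  refine (abs_real_inner_le_norm _ _).trans ?_
  rw [hν, mul_one]
  linarith [hb v]

/-- Write ζ = (τ, ξ). If |ξ| is comparable with |ζ|, dividing by |ξ| reduces to the assumed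
condition with μ = τ/|ξ|. Otherwise τ dominates and |τ + b·ξ| ≥ |ζ|/2 everywhere. -/
theorem volume_spaceTimeField_le {K α : ℝ} {M₀ Bv : ℝ≥0} (hK : 0 ≤ K) (hα : 0 ≤ α)
    {b : E d₂ → E d₁} (hb : ∀ v, ‖b v‖ ≤ M₀) (hnd : Nondegenerate R K α b)
    (hv : volume (ball (0 : E d₂) R) ≤ Bv) {ζ : SpaceTime d₁} (hζ : ζ ≠ 0) {t : ℝ} (ht : 0 < t) :
    volume {v | v ∈ ball (0 : E d₂) R ∧ |inner ℝ (spaceTimeField b v) ζ| ≤ t * ‖ζ‖}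
      ≤ ((K * (2 * (1 + M₀)) ^ α).toNNReal + Bv * ((2 : ℝ) ^ α).toNNReal : ℝ≥0)
        * ENNReal.ofReal (t ^ α) := by
  have hζ0 : 0 < ‖ζ‖ := norm_pos_iff.2 hζ
  push_cast
  rw [add_mul, ← ENNReal.ofReal, ← ENNReal.ofReal, mul_assoc (Bv : ℝ≥0∞),
    ← ENNReal.ofReal_mul (by positivity), ← ENNReal.ofReal_mul (by positivity), mul_assoc K,
    ← Real.mul_rpow (by positivity) ht.le, ← Real.mul_rpow (by positivity) ht.le]
  simp only [inner_spaceTimeField]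
  rcases le_or_gt ‖ζ‖ (2 * (1 + M₀) * ‖ζ.snd‖) with h | h
  · have hξ : 0 < ‖ζ.snd‖ := by
      by_contra hc
      have : ‖ζ.snd‖ = 0 := le_antisymm (not_lt.1 hc) (norm_nonneg _)
      rw [this] at h
      linarith
    refine le_trans ?_ le_self_add
    refine le_trans (measure_mono ?_) (hnd (ζ.fst / ‖ζ.snd‖) (‖ζ.snd‖⁻¹ • ζ.snd) ?_
      (2 * (1 + M₀) * t) (by positivity))
    · rintro v ⟨hv, hv2⟩
      refine ⟨hv, ?_⟩
      have e : ζ.fst / ‖ζ.snd‖ + inner ℝ (b v) (‖ζ.snd‖⁻¹ • ζ.snd)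
          = (ζ.fst + inner ℝ (b v) ζ.snd) / ‖ζ.snd‖ := by
        rw [inner_smul_right]
        field_simp
      rw [e, abs_div, abs_of_pos hξ, div_le_iff₀ hξ]
      refine hv2.trans ?_
      calc t * ‖ζ‖ ≤ t * (2 * (1 + M₀) * ‖ζ.snd‖) := by gcongr
        _ = _ := by ring
    · rw [norm_smul, norm_inv, norm_norm, inv_mul_cancel₀ hξ.ne']
  · refine le_trans ?_ le_add_self
    have hfs : ‖ζ‖ ≤ |ζ.fst| + ‖ζ.snd‖ := by
      refine le_of_sq_le_sq ?_ (by positivity)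
      rw [WithLp.prod_norm_sq_eq_of_L2, Real.norm_eq_abs]
      nlinarith [abs_nonneg ζ.fst, norm_nonneg ζ.snd,
        mul_nonneg (abs_nonneg ζ.fst) (norm_nonneg ζ.snd)]
    have hlow : ∀ v, ‖ζ‖ / 2 ≤ |ζ.fst + inner ℝ (b v) ζ.snd| := by
      intro v
      have h1 : |inner ℝ (b v) ζ.snd| ≤ M₀ * ‖ζ.snd‖ :=
        (abs_real_inner_le_norm _ _).trans (by gcongr; exact hb v)
      have h2 : |ζ.fst| - |inner ℝ (b v) ζ.snd| ≤ |ζ.fst + inner ℝ (b v) ζ.snd| := by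
        have := abs_sub_abs_le_abs_sub ζ.fst (-inner ℝ (b v) ζ.snd)
        rwa [abs_neg, sub_neg_eq_add] at this
      linarith
    -- When τ dominates, the sublevel set is empty for t < 1/2; for t ≥ 1/2 the volume of the ball
    -- is enough because (2t)^α ≥ 1.
    rcases lt_or_ge t (1 / 2) with ht2 | ht2
    · have hempty : {v | v ∈ ball (0 : E d₂) R ∧
          |ζ.fst + inner ℝ (b v) ζ.snd| ≤ t * ‖ζ‖} = ∅ := by
        ext v
        simp only [mem_ofPred_eq, mem_empty_iff_false, iff_false, not_and, not_le]
        intro _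
        refine lt_of_lt_of_le ?_ (hlow v)
        rw [div_eq_mul_one_div, mul_comm]
        gcongr
      rw [hempty, measure_empty]
      exact zero_le
    · refine (measure_mono fun v hv => hv.1).trans (hv.trans ?_)
      refine le_mul_of_one_le_right zero_le ?_
      rw [ENNReal.one_le_ofReal]
      exact Real.one_le_rpow (by linarith) hα

theorem isNondegenerateField_spaceTimeField (hd₁ : 0 < d₁) {K α : ℝ} {M₀ M₁ : ℝ≥0} (hK : 0 ≤ K)
    (hα : 0 ≤ α) {b : E d₂ → E d₁} {Db : E d₂ → E d₂ →L[ℝ] E d₁} (hbm : StronglyMeasurable b)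
    (hb : ∀ v, ‖b v‖ ≤ M₀) (hDm : StronglyMeasurable Db)
    (hD : ∫⁻ v in ball 0 R, ‖Db v‖ₑ ^ 2 ≤ (M₁ ^ 2 : ℝ≥0))
    (hw : ∀ φ : E d₂ → ℝ, IsTest (ball 0 R) φ → ∀ e : E d₂,
      ∫ v in ball 0 R, fderiv ℝ φ v e • b v = - ∫ v in ball 0 R, φ v • Db v e)
    (hnd : Nondegenerate R K α b) :
    IsNondegenerateField R α
      ((K * (2 * (1 + M₀)) ^ α).toNNReal
        + (K * (1 + M₀) ^ α).toNNReal * ((2 : ℝ) ^ α).toNNReal)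
      (M₁ ^ 2) (K * (1 + M₀) ^ α).toNNReal (1 + M₀ : ℝ≥0) (spaceTimeField b)
      (fun v => spaceInclusion d₁ ∘L Db v) := by
  have hv := volume_ball_le_of_nondegenerate hd₁ hb hnd
  have hfield : spaceTimeField b
      = fun v => WithLp.toLp 2 ((1 : ℝ), (0 : E d₁)) + spaceInclusion d₁ (b v) :=
    funext (spaceTimeField_eq b)
  refine ⟨?_, norm_spaceTimeField_le hb, ?_, ?_, ?_, hv, fun ζ hζ t ht =>
    volume_spaceTimeField_le hK hα hb hnd hv hζ ht⟩
  · rw [hfield]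
    exact stronglyMeasurable_const.add ((spaceInclusion d₁).continuous.comp_stronglyMeasurable hbm)
  · have : Continuous fun L : E d₂ →L[ℝ] E d₁ => spaceInclusion d₁ ∘L L := by fun_prop
    exact this.comp_stronglyMeasurable hDm
  · refine (lintegral_mono fun v => ?_).trans hD
    have h1 : ‖spaceInclusion d₁ ∘L Db v‖ ≤ ‖Db v‖ :=
      ContinuousLinearMap.opNorm_le_bound _ (norm_nonneg _) fun w => by
        rw [ContinuousLinearMap.comp_apply, norm_spaceInclusion_apply]
        exact ContinuousLinearMap.le_opNorm _ _
    refine pow_le_pow_left₀ zero_le ?_ 2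
    rw [← ofReal_norm, ← ofReal_norm]
    exact ENNReal.ofReal_le_ofReal h1
  · intro φ hφ e
    have hfin : IsFiniteMeasure (volume.restrict (ball (0 : E d₂) R)) :=
      ⟨by simpa using measure_ball_lt_top⟩
    have hφd : Continuous fun v => fderiv ℝ φ v e :=
      (hφ.smooth.continuous_fderiv (by simp)).clm_apply continuous_const
    obtain ⟨c, hc⟩ := ((hφ.compact.fderiv_apply (𝕜 := ℝ) e)).exists_bound_of_continuous hφd
    obtain ⟨c', hc'⟩ := hφ.compact.exists_bound_of_continuous hφ.smooth.continuous
    have hbi : Integrable b (volume.restrict (ball (0 : E d₂) R)) :=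
      Integrable.of_bound hbm.aestronglyMeasurable M₀ (Eventually.of_forall hb)
    have hDi : Integrable Db (volume.restrict (ball (0 : E d₂) R)) := by
      refine MemLp.integrable (q := 2) (by norm_num) ?_
      rw [memLp_two_iff hDm.aestronglyMeasurable]
      exact lt_of_le_of_lt hD ENNReal.coe_lt_top
    have h0 : Integrable (fun v => fderiv ℝ φ v e) (volume.restrict (ball (0 : E d₂) R)) :=
      Integrable.of_bound hφd.aestronglyMeasurable c (Eventually.of_forall hc)
    have h1 : Integrable (fun v => fderiv ℝ φ v e • b v) (volume.restrict (ball (0 : E d₂) R)) :=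
      Integrable.bdd_smul (φ := fun v => fderiv ℝ φ v e) hbi c hφd.aestronglyMeasurable
        (Eventually.of_forall hc)
    have h2 : Integrable (fun v => φ v • Db v e) (volume.restrict (ball (0 : E d₂) R)) :=
      Integrable.bdd_smul (φ := φ) (hDi.apply_continuousLinearMap e) c'
        hφ.smooth.continuous.aestronglyMeasurable (Eventually.of_forall hc')
    have e1 : ∀ v, fderiv ℝ φ v e • spaceTimeField b v
        = fderiv ℝ φ v e • WithLp.toLp 2 ((1 : ℝ), (0 : E d₁))
          + spaceInclusion d₁ (fderiv ℝ φ v e • b v) := fun v => by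
      rw [spaceTimeField_eq, smul_add, map_smul]
    have e2 : ∀ v, φ v • (spaceInclusion d₁ ∘L Db v) e = spaceInclusion d₁ (φ v • Db v e) :=
      fun v => by rw [map_smul]; rfl
    simp only [e1, e2]
    rw [integral_add (h0.smul_const _) ((spaceInclusion d₁).integrable_comp h1),
      integral_smul_const, setIntegral_fderiv_eq_zero hφ, zero_smul, zero_add,
      ContinuousLinearMap.integral_comp_comm _ h1, ContinuousLinearMap.integral_comp_comm _ h2,
      hw φ hφ e, map_neg]

/-- The bound on b is made to hold everywhere by putting b to zero where it fails, a null set in the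
ball. Every hypothesis, nondegeneracy included, sees b only up to null sets of the ball. -/
theorem exists_bounded_representative {K α : ℝ} {M₀ M₁ : ℝ≥0} {b : E d₂ → E d₁}
    {Db : E d₂ → E d₂ →L[ℝ] E d₁} (hb : IsBoundedH1 R b Db)
    (hM₀ : eLpNorm b ⊤ (ballMeasure d₂ R) ≤ M₀) (hM₁ : eLpNorm Db 2 (ballMeasure d₂ R) ≤ M₁)
    (hnd : Nondegenerate R K α b) :
    ∃ (b' : E d₂ → E d₁) (Db' : E d₂ → E d₂ →L[ℝ] E d₁), b =ᵐ[ballMeasure d₂ R] b' ∧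
      StronglyMeasurable b' ∧ (∀ v, ‖b' v‖ ≤ M₀) ∧ StronglyMeasurable Db' ∧
      (∫⁻ v in ball 0 R, ‖Db' v‖ₑ ^ 2 ≤ (M₁ ^ 2 : ℝ≥0)) ∧
      (∀ φ : E d₂ → ℝ, IsTest (ball 0 R) φ → ∀ e : E d₂,
        ∫ v in ball 0 R, fderiv ℝ φ v e • b' v = - ∫ v in ball 0 R, φ v • Db' v e) ∧
      Nondegenerate R K α b' := by
  have hbm := hb.memLp_top.1
  have hDm := hb.memLp_two.1
  set b₀ := hbm.mk b
  have hb₀ : StronglyMeasurable b₀ := hbm.stronglyMeasurable_mk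
  set Db' := hDm.mk Db
  have hDb' : StronglyMeasurable Db' := hDm.stronglyMeasurable_mk
  have hset : MeasurableSet {v | ‖b₀ v‖ ≤ M₀} :=
    measurableSet_le hb₀.norm.measurable measurable_const
  have haeD : Db =ᵐ[ballMeasure d₂ R] Db' := hDm.ae_eq_mk
  have hae : b =ᵐ[ballMeasure d₂ R] {v | ‖b₀ v‖ ≤ M₀}.indicator b₀ := by
    filter_upwards [hbm.ae_eq_mk, ae_le_eLpNormEssSup (f := b) (μ := ballMeasure d₂ R)] with v h1 h2
    have h3 : ‖b₀ v‖ ≤ M₀ := by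
      rw [← eLpNorm_exponent_top] at h2
      have h4 := h2.trans hM₀
      rw [h1, enorm_le_coe] at h4
      exact_mod_cast h4
    rw [indicator_of_mem (by exact h3), h1]
  refine ⟨{v | ‖b₀ v‖ ≤ M₀}.indicator b₀, Db', hae, hb₀.indicator hset, fun v => ?_, hDb', ?_, ?_,
    fun μ ν hν ε hε => ?_⟩
  · by_cases h : v ∈ {v | ‖b₀ v‖ ≤ M₀}
    · rw [indicator_of_mem h]
      exact h
    · rw [indicator_of_notMem h, norm_zero]
      exact M₀.2
  · rw [← eLpNorm_two_sq]
    push_cast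
    refine pow_le_pow_left₀ zero_le ?_ 2
    exact (eLpNorm_congr_ae haeD).symm.trans_le hM₁
  · intro φ hφ e
    refine Eq.trans (integral_congr_ae ?_) ((hb.weak φ hφ e).trans (congrArg _ (integral_congr_ae ?_)))
    · filter_upwards [hae] with v hv
      rw [hv]
    · filter_upwards [haeD] with v hv
      rw [hv]
  · refine le_trans (le_of_eq ?_) (hnd μ ν hν ε hε)
    have hcomm : ∀ f : E d₂ → E d₁, {v : E d₂ | v ∈ ball (0 : E d₂) R ∧ |μ + inner ℝ (f v) ν| ≤ ε}
        = {v | |μ + inner ℝ (f v) ν| ≤ ε} ∩ ball 0 R := fun f => by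
      ext v; exact and_comm
    rw [hcomm, hcomm, ← Measure.restrict_apply' measurableSet_ball,
      ← Measure.restrict_apply' measurableSet_ball]
    refine measure_congr ?_
    filter_upwards [hae] with v hv
    change (|μ + inner ℝ _ ν| ≤ ε) = (|μ + inner ℝ (b v) ν| ≤ ε)
    rw [hv]

end Field
end Kinetic

namespace Kinetic
open Filter Topology Metric

/-! ### Transfer of hypotheses and norms to the original phase space. -/

section Transfer
variable {d₁ d₂ : ℕ} {R r : ℝ}

theorem ae_cylMeasure_of_ae_ballMeasure {P : E d₂ → Prop} (h : ∀ᵐ v ∂(ballMeasure d₂ R), P v) :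
    ∀ᵐ z ∂(cylMeasure d₁ d₂ R), P z.2.2 := by
  have h1 : ∀ᵐ z ∂((volume : Measure (SpaceTime d₁)).prod (volume.restrict (ball (0 : E d₂) R))),
      P z.2 := Measure.quasiMeasurePreserving_snd.ae h
  exact ((measurePreserving_phaseEquiv_cyl d₁ d₂ R).symm _).quasiMeasurePreserving.ae h1

/-- The distributional equation is tested with c(t, x) ψ(v); the transport derivative sees only c
and the velocity divergence only ψ. -/
theorem solvesSplit_of_solvesTransport {b b' : E d₂ → E d₁} {h g₀ h' g₀' : Phase d₁ d₂ → ℝ}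
    {g₁ g₁' : Phase d₁ d₂ → E d₂} (hb : b =ᵐ[ballMeasure d₂ R] b')
    (hh : h =ᵐ[cylMeasure d₁ d₂ R] h') (hg₀ : g₀ =ᵐ[cylMeasure d₁ d₂ R] g₀')
    (hg₁ : g₁ =ᵐ[cylMeasure d₁ d₂ R] g₁') (hsol : SolvesTransport R b h g₀ g₁)
    {c : SpaceTime d₁ → ℝ} (hc : ContDiff ℝ ∞ c) (hcc : HasCompactSupport c) :
    SolvesSplit R (spaceTimeField b') (h' ∘ phaseEquiv d₁ d₂) (g₀' ∘ phaseEquiv d₁ d₂)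
      (g₁' ∘ phaseEquiv d₁ d₂) c := by
  intro ψ hψ
  have key := hsol _ (isTest_tensor hc hcc hψ)
  simp only [fderiv_tensor hc hψ.smooth] at key
  have t1 : ∀ x : E d₁, toSpaceTime d₁ d₂ (1, x, 0) = WithLp.toLp 2 (1, x) := fun x => rfl
  have t2 : ∀ x : E d₂, toSpaceTime d₁ d₂ (0, 0, x) = 0 := fun x => rfl
  simp only [t1, t2, map_zero, mul_zero, add_zero, zero_mul, zero_add] at key
  have e1 : ∫ z, (h' ∘ phaseEquiv d₁ d₂) z * (fderiv ℝ c z.1 (spaceTimeField b' z.2) * ψ z.2)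
        ∂((volume : Measure (SpaceTime d₁)).prod (volume.restrict (ball (0 : E d₂) R)))
      = ∫ z, h z * (fderiv ℝ c (toSpaceTime d₁ d₂ z) (WithLp.toLp 2 (1, b z.2.2)) * ψ z.2.2)
        ∂(cylMeasure d₁ d₂ R) := by
    refine (integral_phaseEquiv (fun z => h' z * (fderiv ℝ c (toSpaceTime d₁ d₂ z)
      (spaceTimeField b' z.2.2) * ψ z.2.2))).trans (integral_congr_ae ?_)
    filter_upwards [hh, ae_cylMeasure_of_ae_ballMeasure (d₁ := d₁) hb] with z h1 h2
    rw [h1, h2, spaceTimeField]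
  have e2 : ∫ z, c z.1 * fderiv ℝ ψ z.2 ((g₁' ∘ phaseEquiv d₁ d₂) z)
        ∂((volume : Measure (SpaceTime d₁)).prod (volume.restrict (ball (0 : E d₂) R)))
      = ∫ z, c (toSpaceTime d₁ d₂ z) * fderiv ℝ ψ z.2.2 (g₁ z) ∂(cylMeasure d₁ d₂ R) := by
    refine (integral_phaseEquiv (fun z => c (toSpaceTime d₁ d₂ z) *
      fderiv ℝ ψ z.2.2 (g₁' z))).trans (integral_congr_ae ?_)
    filter_upwards [hg₁] with z h1
    rw [h1]
  have e3 : ∫ z, (g₀' ∘ phaseEquiv d₁ d₂) z * (c z.1 * ψ z.2)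
        ∂((volume : Measure (SpaceTime d₁)).prod (volume.restrict (ball (0 : E d₂) R)))
      = ∫ z, g₀ z * (c (toSpaceTime d₁ d₂ z) * ψ z.2.2) ∂(cylMeasure d₁ d₂ R) := by
    refine (integral_phaseEquiv (fun z => g₀' z * (c (toSpaceTime d₁ d₂ z) * ψ z.2.2))).trans
      (integral_congr_ae ?_)
    filter_upwards [hg₀] with z h1
    rw [h1]
  rw [e1, e2, e3]
  linarith

theorem hasSplitGradient_of_isWeakVelocityGradient {h h' : Phase d₁ d₂ → ℝ}
    {D D' : Phase d₁ d₂ → E d₂} (hh : h =ᵐ[cylMeasure d₁ d₂ R] h')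
    (hDD : D =ᵐ[cylMeasure d₁ d₂ R] D') (hD : IsWeakVelocityGradient R h D)
    {c : SpaceTime d₁ → ℝ} (hc : ContDiff ℝ ∞ c) (hcc : HasCompactSupport c) :
    HasSplitGradient R (h' ∘ phaseEquiv d₁ d₂) (D' ∘ phaseEquiv d₁ d₂) c := by
  intro ψ hψ e
  have key := hD.weak _ (isTest_tensor hc hcc hψ) e
  simp only [fderiv_tensor hc hψ.smooth] at key
  have t2 : ∀ x : E d₂, toSpaceTime d₁ d₂ (0, 0, x) = 0 := fun x => rfl
  simp only [t2, map_zero, zero_mul, zero_add] at key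
  have e1 : ∫ z, c z.1 * (fderiv ℝ ψ z.2 e * (h' ∘ phaseEquiv d₁ d₂) z)
        ∂((volume : Measure (SpaceTime d₁)).prod (volume.restrict (ball (0 : E d₂) R)))
      = ∫ z, h z * (c (toSpaceTime d₁ d₂ z) * fderiv ℝ ψ z.2.2 e) ∂(cylMeasure d₁ d₂ R) := by
    refine (integral_phaseEquiv (fun z => c (toSpaceTime d₁ d₂ z) *
      (fderiv ℝ ψ z.2.2 e * h' z))).trans (integral_congr_ae ?_)
    filter_upwards [hh] with z h1
    rw [h1]
    ring
  have e2 : ∫ z, c z.1 * (ψ z.2 * inner ℝ e ((D' ∘ phaseEquiv d₁ d₂) z))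
        ∂((volume : Measure (SpaceTime d₁)).prod (volume.restrict (ball (0 : E d₂) R)))
      = ∫ z, c (toSpaceTime d₁ d₂ z) * ψ z.2.2 * inner ℝ (D z) e ∂(cylMeasure d₁ d₂ R) := by
    refine (integral_phaseEquiv (fun z => c (toSpaceTime d₁ d₂ z) *
      (ψ z.2.2 * inner ℝ e (D' z)))).trans (integral_congr_ae ?_)
    filter_upwards [hDD] with z h1
    rw [h1, real_inner_comm]
    ring
  rw [e1, e2, key]

theorem slabEnergy_comp_phaseEquiv {F : Type*} [NormedAddCommGroup F] [InnerProductSpace ℝ F]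
    {f f' : Phase d₁ d₂ → F} (hf : f =ᵐ[cylMeasure d₁ d₂ R] f') :
    slabEnergy R (f' ∘ phaseEquiv d₁ d₂) = eLpNorm f 2 (cylMeasure d₁ d₂ R) ^ 2 := by
  rw [eLpNorm_congr_ae hf, eLpNorm_two_sq]
  exact lintegral_phaseEquiv fun z => ‖f' z‖ₑ ^ 2

theorem ofReal_sq_div_eq (x y k : ℝ) (hk : 0 ≤ k) :
    ENNReal.ofReal (|x - y| ^ 2 / k) = ENNReal.ofReal k⁻¹ * ‖x - y‖ₑ ^ 2 := by
  rw [div_eq_inv_mul, ENNReal.ofReal_mul (inv_nonneg.2 hk), ENNReal.ofReal_pow (abs_nonneg _),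
    ← Real.norm_eq_abs, ofReal_norm]

theorem lintegral_increment_swap {W V : Type*} [MeasurableSpace W] [MeasurableSpace V]
    {μ : Measure W} {ν : Measure V} [SFinite μ] [SFinite ν] {κ : V → V → ℝ≥0∞}
    (hκ : Measurable fun x : V × V => κ x.1 x.2) {H : W × V → ℝ} (hH : Measurable H) :
    ∫⁻ p, ∫⁻ v, ∫⁻ w, κ v w * ‖H (p, v) - H (p, w)‖ₑ ^ 2 ∂ν ∂ν ∂μ
      = ∫⁻ v, ∫⁻ w, κ v w * ∫⁻ p, ‖H (p, v) - H (p, w)‖ₑ ^ 2 ∂μ ∂ν ∂ν := by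
  set Φ : (W × V) × V → ℝ≥0∞ := fun x => κ x.1.2 x.2 * ‖H x.1 - H (x.1.1, x.2)‖ₑ ^ 2
  have hΦm : Measurable Φ := by
    have h1 : Measurable fun x : (W × V) × V => κ x.1.2 x.2 :=
      hκ.comp (by fun_prop : Measurable fun x : (W × V) × V => (x.1.2, x.2))
    have h2 : Measurable fun x : (W × V) × V => H (x.1.1, x.2) := hH.comp (by fun_prop)
    exact h1.mul (((hH.comp measurable_fst).sub h2).enorm.pow_const 2)
  calc _ = ∫⁻ p, ∫⁻ v, ∫⁻ w, Φ ((p, v), w) ∂ν ∂ν ∂μ := rfl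
    _ = ∫⁻ v, ∫⁻ p, ∫⁻ w, Φ ((p, v), w) ∂ν ∂μ ∂ν := by
        have h1 : Measurable fun x : W × V => ∫⁻ w, Φ (x, w) ∂ν :=
          Measurable.lintegral_prod_right' hΦm
        exact lintegral_lintegral_swap (f := fun p v => ∫⁻ w, Φ ((p, v), w) ∂ν) h1.aemeasurable
    _ = _ := by
        refine lintegral_congr fun v => ?_
        have h1 : Measurable fun x : W × V => Φ ((x.1, v), x.2) := hΦm.comp (by fun_prop)
        rw [lintegral_lintegral_swap (f := fun p w => Φ ((p, v), w)) h1.aemeasurable]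
        refine lintegral_congr fun w => ?_
        have h2 : Measurable fun q : W => ‖H (q, v) - H (q, w)‖ₑ ^ 2 := by
          have h3 : Measurable fun q : W => H (q, v) := hH.comp (by fun_prop)
          have h4 : Measurable fun q : W => H (q, w) := hH.comp (by fun_prop)
          exact (h3.sub h4).enorm.pow_const 2
        exact lintegral_const_mul (κ v w) h2

theorem lintegral_ballGagliardoSq {δ : ℝ} {h h' : Phase d₁ d₂ → ℝ} (hm : StronglyMeasurable h')
    (hh : h =ᵐ[cylMeasure d₁ d₂ R] h') :
    ∫⁻ p : ℝ × E d₁, ballGagliardoSq δ R (fun v => h (p.1, p.2, v))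
      = ∫⁻ v in ball (0 : E d₂) R, ∫⁻ w in ball (0 : E d₂) R,
        ENNReal.ofReal ((‖v - w‖ ^ (Module.finrank ℝ (E d₂) + 2 * δ))⁻¹) *
          ∫⁻ q : SpaceTime d₁,
            ‖(h' ∘ phaseEquiv d₁ d₂) (q, v) - (h' ∘ phaseEquiv d₁ d₂) (q, w)‖ₑ ^ 2 := by
  set H := h' ∘ phaseEquiv d₁ d₂
  have hHm : Measurable H := hm.measurable.comp (phaseEquiv d₁ d₂).measurable
  have hae : ∀ᵐ p : SpaceTime d₁, ∀ᵐ v ∂(volume.restrict (ball (0 : E d₂) R)),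
      h (p.fst, p.snd, v) = H (p, v) := by
    have h1 : ∀ᵐ z ∂((volume : Measure (SpaceTime d₁)).prod (volume.restrict (ball (0 : E d₂) R))),
        h (phaseEquiv d₁ d₂ z) = H z :=
      (measurePreserving_phaseEquiv_cyl d₁ d₂ R).quasiMeasurePreserving.ae hh
    exact Measure.ae_ae_of_ae_prod h1
  clear_value H
  have hκ : Measurable fun x : E d₂ × E d₂ =>
      ENNReal.ofReal ((‖x.1 - x.2‖ ^ (Module.finrank ℝ (E d₂) + 2 * δ))⁻¹) := by fun_prop
  rw [← lintegral_increment_swap (κ := fun v w =>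
    ENNReal.ofReal ((‖v - w‖ ^ (Module.finrank ℝ (E d₂) + 2 * δ))⁻¹)) hκ hHm,
    ← lintegral_ofLp fun p => ballGagliardoSq δ R (fun v => h (p.1, p.2, v))]
  refine lintegral_congr_ae ?_
  filter_upwards [hae] with p hp
  refine lintegral_congr_ae ?_
  filter_upwards [hp] with v hv
  refine lintegral_congr_ae ?_
  filter_upwards [hp] with w hw
  rw [hv, hw, ofReal_sq_div_eq _ _ _ (by positivity), finrank_euclideanSpace_fin]

/-- For δ = 1 the seminorm is an infimum over weak gradients: the bound holds for each gradient, and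
dividing by C ≠ 0 lets it pass to the infimum. If there is no gradient the infimum is ∞ and the
inequality is vacuous. -/
theorem le_of_hasVelocityBound {δ : ℝ} (hδ : δ ≤ 1) {h h' : Phase d₁ d₂ → ℝ}
    (hm : StronglyMeasurable h') (hh : h =ᵐ[cylMeasure d₁ d₂ R] h') {X Y : ℝ≥0∞} {C : ℝ≥0}
    (hC : C ≠ 0)
    (hX : ∀ Q, HasVelocityBound δ R (h' ∘ phaseEquiv d₁ d₂) Q → X ≤ C * (Q + Y)) :
    X ≤ C * (velocitySeminormSq δ R h + Y) := by
  rw [velocitySeminormSq]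
  split_ifs with hδ1
  · exact hX _ (Or.inl ⟨hδ1, (lintegral_ballGagliardoSq hm hh).ge⟩)
  · have hC' : (C : ℝ≥0∞) ≠ 0 := by simpa using hC
    rw [← ENNReal.div_le_iff' hC' ENNReal.coe_ne_top, ← tsub_le_iff_right]
    refine le_iInf₂ fun D hD => ?_
    rw [tsub_le_iff_right, ENNReal.div_le_iff' hC' ENNReal.coe_ne_top]
    have hDae := hD.memLp.1.ae_eq_mk
    refine hX _ (Or.inr ⟨le_antisymm hδ (not_lt.1 hδ1), hD.memLp.1.mk D ∘ phaseEquiv d₁ d₂,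
      hD.memLp.1.stronglyMeasurable_mk.comp_measurable (phaseEquiv d₁ d₂).measurable,
      (hD.memLp.ae_eq hDae).comp_measurePreserving (measurePreserving_phaseEquiv_cyl d₁ d₂ R),
      fun c hc hcc => hasSplitGradient_of_isWeakVelocityGradient hh hDae hD hc hcc,
      (slabEnergy_comp_phaseEquiv hDae).le⟩)

theorem euclDist_phaseEquiv (y z : SpaceTime d₁ × E d₂) :
    euclDist (phaseEquiv d₁ d₂ y) (phaseEquiv d₁ d₂ z)
      = √(‖y.1 - z.1‖ ^ 2 + ‖y.2 - z.2‖ ^ 2) := by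
  rw [euclDist, WithLp.prod_norm_sq_eq_of_L2]
  rfl

theorem lintegral_gagliardo_eq {γ : ℝ} {h h' : Phase d₁ d₂ → ℝ}
    (hh : h =ᵐ[cylMeasure d₁ d₂ r] h') :
    ∫⁻ y, ∫⁻ z, ENNReal.ofReal
        (|h y - h z| ^ 2 / euclDist y z ^ ((1 + d₁ + d₂ : ℝ) + 2 * γ))
        ∂(cylMeasure d₁ d₂ r) ∂(cylMeasure d₁ d₂ r)
      = slabGagliardo γ r (h' ∘ phaseEquiv d₁ d₂) := by
  calc _ = ∫⁻ y, ∫⁻ z, ENNReal.ofReal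
        (|h' y - h' z| ^ 2 / euclDist y z ^ ((1 + d₁ + d₂ : ℝ) + 2 * γ))
        ∂(cylMeasure d₁ d₂ r) ∂(cylMeasure d₁ d₂ r) := by
        refine lintegral_congr_ae ?_
        filter_upwards [hh] with y hy
        refine lintegral_congr_ae ?_
        filter_upwards [hh] with z hz
        rw [hy, hz]
    _ = _ := by
        rw [← lintegral_phaseEquiv]
        refine lintegral_congr fun y => ?_
        rw [← lintegral_phaseEquiv]
        refine lintegral_congr fun z => ?_
        rw [euclDist_phaseEquiv, ofReal_sq_div_eq _ _ _ (by positivity), finrank_spaceTime,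
          finrank_euclideanSpace_fin]
        push_cast
        rfl

theorem rpow_half_le_of_le_sq {x y : ℝ≥0∞} (h : x ≤ y ^ 2) : x ^ (1 / 2 : ℝ) ≤ y := by
  calc x ^ (1 / 2 : ℝ) ≤ (y ^ (2 : ℝ)) ^ (1 / 2 : ℝ) := by
        refine ENNReal.rpow_le_rpow ?_ (by norm_num)
        exact_mod_cast h
    _ = y := by rw [← ENNReal.rpow_mul]; norm_num

theorem velocityNorm_sq (δ : ℝ) (h : Phase d₁ d₂ → ℝ) :
    velocityNorm δ R h ^ 2 = eLpNorm h 2 (cylMeasure d₁ d₂ R) ^ 2 + velocitySeminormSq δ R h := by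
  rw [velocityNorm, ← ENNReal.rpow_natCast, ← ENNReal.rpow_mul]
  norm_num

theorem exists_sobolevNorm_sq_le (hd₁ : 0 < d₁) {α δ σ K : ℝ} (hα : α ∈ Ioc (0 : ℝ) 1)
    (hδ : δ ∈ Ioc (0 : ℝ) 1) (hK : 0 < K) (hσ : 0 < σ) (M₀ M₁ : ℝ≥0) :
    ∃ C : ℝ≥0, ∀ R r : ℝ, R - r = σ → ∀ (b : E d₂ → E d₁) (Db : E d₂ → E d₂ →L[ℝ] E d₁),
      IsBoundedH1 R b Db → eLpNorm b ⊤ (ballMeasure d₂ R) ≤ M₀ →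
      eLpNorm Db 2 (ballMeasure d₂ R) ≤ M₁ → Nondegenerate R K α b →
      ∀ (h g₀ : Phase d₁ d₂ → ℝ) (g₁ : Phase d₁ d₂ → E d₂),
        MemLp h 2 (cylMeasure d₁ d₂ R) → MemLp g₀ 2 (cylMeasure d₁ d₂ R) →
        MemLp g₁ 2 (cylMeasure d₁ d₂ R) → SolvesTransport R b h g₀ g₁ →
        eLpNorm h 2 (cylMeasure d₁ d₂ r) ^ 2 + (∫⁻ y, ∫⁻ z, ENNReal.ofReal
          (|h y - h z| ^ 2 / euclDist y z ^ ((1 + d₁ + d₂ : ℝ)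
            + 2 * (2 * α * δ / ((4 + α) * (2 + 2 * δ + d₂)))))
          ∂(cylMeasure d₁ d₂ r) ∂(cylMeasure d₁ d₂ r))
        ≤ C * (velocityNorm δ R h ^ 2 + eLpNorm g₁ 2 (cylMeasure d₁ d₂ R) ^ 2
            + eLpNorm g₀ 2 (cylMeasure d₁ d₂ R) ^ 2) := by
  -- The largest velocity scale must satisfy r + ε₀ < R and ε₀ ≤ 1, so it can be fixed from σ = R -
  -- r alone.
  have hε₀ : 0 < min (σ / 2) 1 := lt_min (by linarith) one_pos
  obtain ⟨C, hC⟩ := exists_cylinder_estimate (SpaceTime d₁) (E d₂)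
    (γ := 2 * α * δ / ((4 + α) * (2 + 2 * δ + d₂))) (by rw [finrank_spaceTime]; omega) hα.1 hα.2
    hδ.1 hδ.2 hε₀ (min_le_right _ _) (by rw [finrank_euclideanSpace_fin])
    ((K * (2 * (1 + M₀)) ^ α).toNNReal + (K * (1 + M₀) ^ α).toNNReal * ((2 : ℝ) ^ α).toNNReal)
    (M₁ ^ 2) (K * (1 + M₀) ^ α).toNNReal (1 + M₀)
  -- The outer 1 pays for the L² norm on the smaller cylinder; C + 1 replaces C to be nonzero, as
  -- `le_of_hasVelocityBound` requires.
  refine ⟨1 + (C + 1), fun R r hRr b Db hb hM₀ hM₁ hnd h g₀ g₁ hh hg₀ hg₁ hsol => ?_⟩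
  obtain ⟨b', Db', hbae, hbm, hbM, hDm, hDM, hw, hnd'⟩ :=
    exists_bounded_representative hb hM₀ hM₁ hnd
  have ha := isNondegenerateField_spaceTimeField hd₁ hK.le hα.1.le hbm hbM hDm hDM hw hnd'
  have hT := measurePreserving_phaseEquiv_cyl d₁ d₂ R
  have hTm := (phaseEquiv d₁ d₂).measurable
  have eh := hh.1.ae_eq_mk
  have eg₀ := hg₀.1.ae_eq_mk
  have eg₁ := hg₁.1.ae_eq_mk
  have hε₀σ : min (σ / 2) 1 < σ := (min_le_left _ _).trans_lt (by linarith)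
  have hmono : cylMeasure d₁ d₂ r ≤ cylMeasure d₁ d₂ R := by
    refine Measure.restrict_mono (fun z hz => ?_) le_rfl
    exact ball_subset_ball (by linarith : r ≤ R) hz
  have key := le_of_hasVelocityBound (C := C + 1) hδ.2 hh.1.stronglyMeasurable_mk eh
    (X := slabGagliardo (2 * α * δ / ((4 + α) * (2 + 2 * δ + d₂))) r
      (hh.1.mk h ∘ phaseEquiv d₁ d₂))
    (Y := eLpNorm h 2 (cylMeasure d₁ d₂ R) ^ 2 + eLpNorm g₁ 2 (cylMeasure d₁ d₂ R) ^ 2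
      + eLpNorm g₀ 2 (cylMeasure d₁ d₂ R) ^ 2) (by positivity) (fun Q hQ => by
      have h1 := hC R r _ _ _ _ _ Q (by linarith) ha
        (hh.1.stronglyMeasurable_mk.comp_measurable hTm)
        (hg₀.1.stronglyMeasurable_mk.comp_measurable hTm)
        (hg₁.1.stronglyMeasurable_mk.comp_measurable hTm)
        ((hh.ae_eq eh).comp_measurePreserving hT)
        ((hg₀.ae_eq eg₀).comp_measurePreserving hT)
        ((hg₁.ae_eq eg₁).comp_measurePreserving hT)
        (fun c hc hcc => solvesSplit_of_solvesTransport hbae eh eg₀ eg₁ hsol hc hcc) hQ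
      rw [slabEnergy_comp_phaseEquiv eh, slabEnergy_comp_phaseEquiv eg₀,
        slabEnergy_comp_phaseEquiv eg₁] at h1
      refine h1.trans (mul_le_mul' ?_ le_rfl)
      push_cast
      exact le_self_add)
  rw [lintegral_gagliardo_eq (ae_mono hmono eh), velocityNorm_sq]
  have h2 : eLpNorm h 2 (cylMeasure d₁ d₂ r) ^ 2 ≤ eLpNorm h 2 (cylMeasure d₁ d₂ R) ^ 2 :=
    pow_le_pow_left₀ zero_le (eLpNorm_mono_measure _ hmono) 2
  rw [ENNReal.coe_add, ENNReal.coe_one, add_mul (1 : ℝ≥0∞), one_mul]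
  refine add_le_add (h2.trans (le_self_add.trans (le_self_add.trans le_self_add))) (key.trans_eq ?_)
  ring

end Transfer
end Kinetic

/-! ### The theorem: square roots of the squared estimate. -/

theorem lemma2p2 (d₁ d₂ : ℕ) (hd₁ : 0 < d₁) (hd₂ : 0 < d₂)
    (α δ : ℝ) (hα : α ∈ Set.Ioc (0 : ℝ) 1) (hδ : δ ∈ Set.Ioc (0 : ℝ) 1)
    (K σ : ℝ) (hK : 0 < K) (hσ : 0 < σ) (M₀ M₁ : ℝ≥0) :
    ∃ C : ℝ≥0, 0 < C ∧
      ∀ R r : ℝ, 0 < r → r < R → R - r = σ →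
      ∀ (b : Kinetic.E d₂ → Kinetic.E d₁)
        (Db : Kinetic.E d₂ → Kinetic.E d₂ →L[ℝ] Kinetic.E d₁),
        Kinetic.IsBoundedH1 R b Db →
        eLpNorm b ∞ (Kinetic.ballMeasure d₂ R) ≤ M₀ →
        eLpNorm Db 2 (Kinetic.ballMeasure d₂ R) ≤ M₁ →
        Kinetic.Nondegenerate R K α b →
      ∀ (h g₀ : Kinetic.Phase d₁ d₂ → ℝ) (g₁ : Kinetic.Phase d₁ d₂ → Kinetic.E d₂),
        MemLp h 2 (Kinetic.cylMeasure d₁ d₂ R) →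
        MemLp g₀ 2 (Kinetic.cylMeasure d₁ d₂ R) →
        MemLp g₁ 2 (Kinetic.cylMeasure d₁ d₂ R) →
        Kinetic.SolvesTransport R b h g₀ g₁ →
        Kinetic.MemVelocitySobolev δ R h →
        Kinetic.MemSobolev (2 * α * δ / ((4 + α) * (2 + 2 * δ + d₂))) r h ∧
        Kinetic.sobolevNorm (2 * α * δ / ((4 + α) * (2 + 2 * δ + d₂))) r h
          ≤ C * (Kinetic.velocityNorm δ R h
              + eLpNorm g₁ 2 (Kinetic.cylMeasure d₁ d₂ R)
              + eLpNorm g₀ 2 (Kinetic.cylMeasure d₁ d₂ R)) := by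
  obtain ⟨C, hC⟩ := Kinetic.exists_sobolevNorm_sq_le (d₂ := d₂) hd₁ hα hδ hK hσ M₀ M₁
  refine ⟨1 + C, by positivity, fun R r _ hrR hRr b Db hb hM₀ hM₁ hnd h g₀ g₁ hh hg₀ hg₁ hsol hv => ?_⟩
  have key : Kinetic.sobolevNorm (2 * α * δ / ((4 + α) * (2 + 2 * δ + d₂))) r h
      ≤ ((1 + C : ℝ≥0) : ℝ≥0∞) * (Kinetic.velocityNorm δ R h
        + eLpNorm g₁ 2 (Kinetic.cylMeasure d₁ d₂ R)
        + eLpNorm g₀ 2 (Kinetic.cylMeasure d₁ d₂ R)) := by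
    refine Kinetic.rpow_half_le_of_le_sq
      ((hC R r hRr b Db hb hM₀ hM₁ hnd h g₀ g₁ hh hg₀ hg₁ hsol).trans ?_)
    set x := Kinetic.velocityNorm δ R h
    set y := eLpNorm g₁ 2 (Kinetic.cylMeasure d₁ d₂ R)
    set z := eLpNorm g₀ 2 (Kinetic.cylMeasure d₁ d₂ R)
    rw [mul_pow]
    push_cast
    refine mul_le_mul' ?_ ?_
    -- Passing from squares to norms uses C ≤ (1 + C)² and the fact that a sum of squares is at most
    -- the square of the sum.
    · calc (C : ℝ≥0∞) ≤ C + (1 + C + C ^ 2) := le_self_add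
        _ = _ := by ring
    · calc x ^ 2 + y ^ 2 + z ^ 2 ≤ x ^ 2 + y ^ 2 + z ^ 2 + 2 * (x * y + x * z + y * z) :=
            le_self_add
        _ = _ := by ring
  refine ⟨⟨?_, key.trans_lt ?_⟩, key⟩
  · refine hh.1.mono_measure (Measure.restrict_mono (fun w hw => ?_) le_rfl)
    exact Metric.ball_subset_ball hrR.le hw
  · exact ENNReal.mul_lt_top ENNReal.coe_lt_top
      (ENNReal.add_lt_top.2 ⟨ENNReal.add_lt_top.2 ⟨hv.2, hg₁.2⟩, hg₀.2⟩)
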